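/- Let $\mathbb K=\mathbb R$ or $\mathbb C$ and let $n\ge 3$. All germs are smooth ($C^\infty$) if $\mathbb K=\mathbb R$ and holomorphic if $\mathbb K=\mathbb C$; $\mathcal O_k$ is the ring of germs of functions on $\mathbb K^k$ at $0$, and $\theta_k$ is the space of germs of vector fields on $\mathbb K^k$ at $0$. For a multigerm $h=\{h_1,\dots,h_r\}:(\mathbb K^n,S)\to(\mathbb K^p,0)$, each branch written in coordinates centred at its source point, put $\theta(h)=\bigoplus_i \mathcal O_n^p$, $th(\chi)=(dh_i\circ\chi_i)_i$ for $\chi=(\chi_i)_i$ with $\chi_i\in\theta_n$, $wh(\eta)=(\eta\circ h_i)_i$ for $\eta\in\theta_p$, $T\mathcal A_eh=th\big(\bigoplus_i\theta_n\big)+wh(\theta_p)$, $N\mathcal A_e(h)=\theta(h)/T\mathcal A_eh$, and $\mathcal A_e\text{-cod}(h)=\dim_{\mathbb K}N\mathcal A_e(h)$. The multigerm $h$ is (infinitesimally) stable if $T\mathcal A_eh=\theta(h)$, and $\mathrm{Lift}(h)$ is the set of $\eta\in\theta_p$ such that $wh(\eta)=th(\chi)$ for some $\chi$. Let $$f(x_1,\ldots,x_{n-2})=(x_1^{n+1}+x_2x_1+\cdots+x_{n-2}x_1^{n-3},\;x_2,\ldots,x_{n-2}),$$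 $$F(x_1,\ldots,x_{n-2},y,z)=(x_1^{n+1}+x_2x_1+\cdots+x_{n-2}x_1^{n-3}+yx_1^{n-2}+zx_1^{n-1},\;x_2,\ldots,x_{n-2},\;y,\;z)$$ (the $A_n$ singularity), and let $g(x_1,\ldots,x_{n-2},y,z)=(x_1,\ldots,x_{n-2},y,z^3+yz)$. Then $F$ is a 2-parameter stable unfolding of $f$, so that the bigerm $\{F,g\}$ is the cuspidal concatenation of $f$ (with respect to $F$), and $$\mathcal A_e\text{-cod}(\{F,g\})=n .$$ Moreover, let $T_\Sigma\subset\mathcal O_{n-1}$ (variables $x_1,\dots,x_{n-2},z$) be the space of all germs $-z\,\eta_{n-1}(x,-3z^2,-2z^3)+\eta_n(x,-3z^2,-2z^3)$, where $\eta=(\eta_1,\dots,\eta_n)\in\mathrm{Lift}(F)$. Then the classes of $1,\,z,\,x_1z,\,\ldots,\,x_{n-2}z$ form a basis of $\mathcal O_{n-1}/T_\Sigma$ over $\mathbb K$, and the classes of $(0,\xi\,\partial/\partial Z)\in\theta(F)\oplus\theta(g)$, for $\xi=1,\,z,\,x_1z,\,\ldots,\,x_{n-2}z$, where $Z$ is the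 last target coordinate, form a basis of $N\mathcal A_e(\{F,g\})$. -/

import Mathlib

open Filter Topology
open scoped ContDiff

/-- `h` is smooth (`C^∞` over `ℝ`, equivalently holomorphic over `ℂ`) on a neighbourhood of `x`. -/
def SmoothNear (𝕜 : Type*) [RCLike 𝕜] {E V : Type*} [NormedAddCommGroup E] [NormedSpace 𝕜 E]
    [NormedAddCommGroup V] [NormedSpace 𝕜 V] (h : E → V) (x : E) : Prop :=
  ∀ᶠ y in 𝓝 x, ContDiffAt 𝕜 ∞ h y

/-- The space of germs at `0 ∈ 𝕜ⁿ` of smooth (over `ℂ`: holomorphic) maps with values in `V`.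
For `V = 𝕜` this is `𝒪ₙ`, for `V = 𝕜ᵖ` it is `𝒪ₙᵖ`. -/
def SmoothGerms (𝕜 : Type*) [RCLike 𝕜] (n : ℕ) (V : Type*) [NormedAddCommGroup V]
    [NormedSpace 𝕜 V] : Submodule 𝕜 (Germ (𝓝 (0 : Fin n → 𝕜)) V) where
  carrier := {φ | ∃ h : (Fin n → 𝕜) → V, SmoothNear 𝕜 h 0 ∧ φ = (h : Germ (𝓝 (0 : Fin n → 𝕜)) V)}
  add_mem' := by
    rintro _ _ ⟨h, hh, rfl⟩ ⟨k, hk, rfl⟩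
    refine ⟨h + k, ?_, rfl⟩
    filter_upwards [hh, hk] with y h1 h2 using h1.add h2
  zero_mem' := ⟨0, Eventually.of_forall fun _ => contDiffAt_const, rfl⟩
  smul_mem' := by
    rintro c _ ⟨h, hh, rfl⟩
    refine ⟨c • h, ?_, rfl⟩
    filter_upwards [hh] with y h1 using h1.const_smul c

/-- The germ at `0` of a smooth map. -/
def germOf {𝕜 : Type*} [RCLike 𝕜] {n : ℕ} {V : Type*} [NormedAddCommGroup V] [NormedSpace 𝕜 V]
    (h : (Fin n → 𝕜) → V) (hh : ContDiff 𝕜 ∞ h) : SmoothGerms 𝕜 n V :=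
  ⟨(h : Germ (𝓝 (0 : Fin n → 𝕜)) V), h, Eventually.of_forall fun _ => hh.contDiffAt, rfl⟩

/-- A multigerm `(𝕜ⁿ, S) → (𝕜ᵖ, 0)` with branches indexed by `ι` (`ι` is in bijection with `S`).
Each branch is written in coordinates centred at its own source point, and is given by a
representative. -/
structure MultiGerm (𝕜 : Type*) [RCLike 𝕜] (ι : Type*) (n p : ℕ) where
  branch : ι → (Fin n → 𝕜) → (Fin p → 𝕜)
  smooth : ∀ i, SmoothNear 𝕜 (branch i) 0
  map_zero : ∀ i, branch i 0 = 0

namespace MultiGerm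

variable {𝕜 : Type*} [RCLike 𝕜] {ι κ : Type*} {n p : ℕ}

theorem tendsto (f : MultiGerm 𝕜 ι n p) (i : ι) : Tendsto (f.branch i) (𝓝 0) (𝓝 0) := by
  have h := (f.smooth i).self_of_nhds.continuousAt.tendsto
  rwa [f.map_zero i] at h

/-- `tf : θ(𝕜ⁿ)_S → θ(f)`, `χ ↦ df ∘ χ`, branch by branch. -/
noncomputable def tf (f : MultiGerm 𝕜 ι n p) :
    (ι → SmoothGerms 𝕜 n (Fin n → 𝕜)) →ₗ[𝕜] (ι → SmoothGerms 𝕜 n (Fin p → 𝕜)) where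
  toFun χ i := ⟨Germ.map₂ (fun (L : (Fin n → 𝕜) →L[𝕜] (Fin p → 𝕜)) v => L v)
      ((fderiv 𝕜 (f.branch i) : (Fin n → 𝕜) → _) : Germ (𝓝 (0 : Fin n → 𝕜)) _) (χ i).1, by
    obtain ⟨h, hh, he⟩ := (χ i).2
    rw [he]
    refine ⟨fun x => fderiv 𝕜 (f.branch i) x (h x), ?_, rfl⟩
    filter_upwards [f.smooth i, hh] with y h1 h2
    exact (h1.fderiv_right (m := ∞) (by norm_num)).clm_apply h2⟩
  map_add' χ χ' := by
    funext i
    apply Subtype.ext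
    obtain ⟨h, -, he⟩ := (χ i).2
    obtain ⟨h', -, he'⟩ := (χ' i).2
    simp only [Pi.add_apply, Submodule.coe_add, he, he', ← Germ.coe_add, Germ.map₂_coe, map_add]
    rfl
  map_smul' c χ := by
    funext i
    apply Subtype.ext
    obtain ⟨h, -, he⟩ := (χ i).2
    simp only [Pi.smul_apply, Submodule.coe_smul, he, ← Germ.coe_smul, Germ.map₂_coe, map_smul,
      RingHom.id_apply]
    rfl

/-- `wf : θ(𝕜ᵖ)₀ → θ(f)`, `η ↦ η ∘ f`. -/
def wf (f : MultiGerm 𝕜 ι n p) :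
    SmoothGerms 𝕜 p (Fin p → 𝕜) →ₗ[𝕜] (ι → SmoothGerms 𝕜 n (Fin p → 𝕜)) where
  toFun η i := ⟨η.1.compTendsto (f.branch i) (f.tendsto i), by
    obtain ⟨h, hh, he⟩ := η.2
    rw [he]
    refine ⟨h ∘ f.branch i, ?_, rfl⟩
    filter_upwards [f.smooth i, (f.tendsto i).eventually hh] with y h1 h2 using h2.comp y h1⟩
  map_add' η η' := by
    funext i
    apply Subtype.ext
    obtain ⟨h, -, he⟩ := η.2
    obtain ⟨h', -, he'⟩ := η'.2
    simp only [Pi.add_apply, Submodule.coe_add, he, he']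
    rfl
  map_smul' c η := by
    funext i
    apply Subtype.ext
    obtain ⟨h, -, he⟩ := η.2
    simp only [Pi.smul_apply, Submodule.coe_smul, he, RingHom.id_apply]
    rfl

/-- The `𝒜ₑ`-tangent space `T𝒜ₑ f = tf(θₙ) + wf(θₚ)`, a subspace of `θ(f)`. -/
noncomputable def tangentAe (f : MultiGerm 𝕜 ι n p) : Submodule 𝕜 (ι → SmoothGerms 𝕜 n (Fin p → 𝕜)) :=
  LinearMap.range f.tf ⊔ LinearMap.range f.wf

/-- `N𝒜ₑ(f) = θ(f) / T𝒜ₑ f`. -/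
abbrev NAe (f : MultiGerm 𝕜 ι n p) : Type _ :=
  (ι → SmoothGerms 𝕜 n (Fin p → 𝕜)) ⧸ f.tangentAe

/-- The `𝒜ₑ`-codimension of `f`: the dimension over `𝕜` of `N𝒜ₑ(f)`, as a cardinal. -/
noncomputable def codimAe (f : MultiGerm 𝕜 ι n p) : Cardinal := Module.rank 𝕜 f.NAe

/-- (Infinitesimal) stability: every element of `θ(f)` lies in `T𝒜ₑ f`. -/
def IsStable (f : MultiGerm 𝕜 ι n p) : Prop := f.tangentAe = ⊤

/-- The germs at `0 ∈ 𝕜ᵖ` of vector fields `η` liftable over `f`, i.e. with `df ∘ ξ = η ∘ f` for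
some `ξ`. -/
noncomputable def Lift (f : MultiGerm 𝕜 ι n p) : Submodule 𝕜 (SmoothGerms 𝕜 p (Fin p → 𝕜)) :=
  (LinearMap.range f.tf).comap f.wf

/-- The multigerm `{f, g}`, whose branches are those of `f` together with those of `g`. -/
def concat (f : MultiGerm 𝕜 ι n p) (g : MultiGerm 𝕜 κ n p) : MultiGerm 𝕜 (ι ⊕ κ) n p where
  branch := Sum.elim f.branch g.branch
  smooth := by rintro (i | i); exacts [f.smooth i, g.smooth i]
  map_zero := by rintro (i | i); exacts [f.map_zero i, g.map_zero i]

/-- The monogerm of a smooth map fixing the origin. -/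
def mono (h : (Fin n → 𝕜) → (Fin p → 𝕜)) (hh : ContDiff 𝕜 ∞ h) (h0 : h 0 = 0) :
    MultiGerm 𝕜 Unit n p where
  branch _ := h
  smooth _ := Eventually.of_forall fun _ => hh.contDiffAt
  map_zero _ := h0

/-- `F` is a 2-parameter stable unfolding of `f`: it has the form `F(x, λ) = (f_λ(x), λ)` with
`λ ∈ 𝕜²`, `f_0 = f`, and it is stable. -/
def IsStableUnfolding₂ {m : ℕ} (f : MultiGerm 𝕜 ι m m) (F : MultiGerm 𝕜 ι (m + 2) (m + 2)) :
    Prop :=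
  (∀ i, ∀ᶠ x in 𝓝 (0 : Fin (m + 2) → 𝕜), ∀ j : Fin 2,
    F.branch i x (Fin.natAdd m j) = x (Fin.natAdd m j)) ∧
  (∀ i, ∀ᶠ x in 𝓝 (0 : Fin m → 𝕜), ∀ j : Fin m,
    F.branch i (Fin.append x 0) (Fin.castAdd 2 j) = f.branch i x j) ∧
  F.IsStable

end MultiGerm

/-- The map `𝕜ᵏ → 𝕜ᵏ`, `(x₁, …, x_k) ↦ (x₁^N + x₂ x₁ + x₃ x₁² + ⋯ + x_k x₁^(k-1), x₂, …, x_k)`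
(the coordinate `x_{j+1}` has index `j : Fin k`). -/
def typeAMap (𝕜 : Type*) [RCLike 𝕜] (k N : ℕ) (x : Fin k → 𝕜) (i : Fin k) : 𝕜 :=
  if (i : ℕ) = 0 then x i ^ N + ∑ j ∈ Finset.univ.erase i, x j * x i ^ (j : ℕ) else x i

theorem contDiff_typeAMap (𝕜 : Type*) [RCLike 𝕜] (k N : ℕ) : ContDiff 𝕜 ∞ (typeAMap 𝕜 k N) := by
  rw [contDiff_pi]
  intro i
  by_cases hi : (i : ℕ) = 0
  · simp only [typeAMap, hi, if_true]
    fun_prop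
  · simp only [typeAMap, hi, if_false]
    fun_prop

theorem typeAMap_zero (𝕜 : Type*) [RCLike 𝕜] (k N : ℕ) : typeAMap 𝕜 k (N + 1) 0 = 0 := by
  funext i
  simp [typeAMap]

/-- For `n = m + 2`, the germ
`f(x₁, …, x_{n-2}) = (x₁^(n+1) + x₂ x₁ + ⋯ + x_{n-2} x₁^(n-3), x₂, …, x_{n-2})`. -/
def germf (𝕜 : Type*) [RCLike 𝕜] (m : ℕ) : MultiGerm 𝕜 Unit m m :=
  .mono (typeAMap 𝕜 m (m + 2 + 1)) (contDiff_typeAMap 𝕜 _ _) (typeAMap_zero 𝕜 _ _)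

/-- For `n = m + 2`, the `A_n` singularity `F(x₁, …, x_{n-2}, y, z) =
(x₁^(n+1) + x₂ x₁ + ⋯ + x_{n-2} x₁^(n-3) + y x₁^(n-2) + z x₁^(n-1), x₂, …, x_{n-2}, y, z)`. -/
def germF (𝕜 : Type*) [RCLike 𝕜] (m : ℕ) : MultiGerm 𝕜 Unit (m + 2) (m + 2) :=
  .mono (typeAMap 𝕜 (m + 2) (m + 2 + 1)) (contDiff_typeAMap 𝕜 _ _) (typeAMap_zero 𝕜 _ _)

/-- The index of the coordinate `y` of `(x₁, …, x_m, y, z)`. -/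
abbrev idxY (m : ℕ) : Fin (m + 2) := (Fin.last m).castSucc

/-- The index of the coordinate `z` of `(x₁, …, x_m, y, z)`. -/
abbrev idxZ (m : ℕ) : Fin (m + 2) := Fin.last (m + 1)

/-- `(x₁, …, x_m, y, z) ↦ (x₁, …, x_m, y, z³ + y z)`. -/
def cuspMap (𝕜 : Type*) [RCLike 𝕜] (m : ℕ) (x : Fin (m + 2) → 𝕜) (i : Fin (m + 2)) : 𝕜 :=
  if i = idxZ m then x (idxZ m) ^ 3 + x (idxY m) * x (idxZ m) else x i

theorem contDiff_cuspMap (𝕜 : Type*) [RCLike 𝕜] (m : ℕ) : ContDiff 𝕜 ∞ (cuspMap 𝕜 m) := by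
  rw [contDiff_pi]
  intro i
  by_cases hi : i = idxZ m
  · simp only [cuspMap, hi, if_true]
    fun_prop
  · simp only [cuspMap, hi, if_false]
    fun_prop

/-- The suspension of a cusp `g(x₁, …, x_m, y, z) = (x₁, …, x_m, y, z³ + y z)`. -/
def germg (𝕜 : Type*) [RCLike 𝕜] (m : ℕ) : MultiGerm 𝕜 Unit (m + 2) (m + 2) :=
  .mono (cuspMap 𝕜 m) (contDiff_cuspMap 𝕜 m) (by funext i; simp [cuspMap])

/-- The multigerm `{F, g}`, which is the cuspidal concatenation of `f` when `F` is a 2-parameter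
stable unfolding of `f`. -/
def cuspidalConcat {𝕜 : Type*} [RCLike 𝕜] {ι : Type*} {m : ℕ}
    (F : MultiGerm 𝕜 ι (m + 2) (m + 2)) : MultiGerm 𝕜 (ι ⊕ Unit) (m + 2) (m + 2) :=
  F.concat (germg 𝕜 m)

/-- `φ(x₁, …, x_m, z) = (x₁, …, x_m, -3z², -2z³)`. -/
def cuspParam (𝕜 : Type*) [RCLike 𝕜] (m : ℕ) (u : Fin (m + 1) → 𝕜) : Fin (m + 2) → 𝕜 :=
  Fin.snoc (Fin.snoc (fun i : Fin m => u i.castSucc) (-3 * u (Fin.last m) ^ 2) :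
    Fin (m + 1) → 𝕜) (-2 * u (Fin.last m) ^ 3)

theorem contDiff_cuspParam (𝕜 : Type*) [RCLike 𝕜] (m : ℕ) : ContDiff 𝕜 ∞ (cuspParam 𝕜 m) := by
  rw [contDiff_pi]
  intro i
  induction i using Fin.lastCases with
  | last => simp only [cuspParam, Fin.snoc_last]; fun_prop
  | cast i =>
    induction i using Fin.lastCases with
    | last => simp only [cuspParam, Fin.snoc_last, Fin.snoc_castSucc]; fun_prop
    | cast i => simp only [cuspParam, Fin.snoc_castSucc]; fun_prop

theorem cuspParam_zero (𝕜 : Type*) [RCLike 𝕜] (m : ℕ) : cuspParam 𝕜 m 0 = 0 := by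
  funext i
  induction i using Fin.lastCases with
  | last => simp [cuspParam]
  | cast i =>
    induction i using Fin.lastCases with
    | last => simp [cuspParam]
    | cast i => simp [cuspParam]

theorem tendsto_cuspParam (𝕜 : Type*) [RCLike 𝕜] (m : ℕ) :
    Tendsto (cuspParam 𝕜 m) (𝓝 0) (𝓝 0) := by
  have h := (contDiff_cuspParam 𝕜 m).continuous.tendsto 0
  rwa [cuspParam_zero] at h

/-- The map sending a vector field germ `η` on `𝕜ⁿ`, `n = m + 2`, to the function germ
`-z η_{n-1}(x, -3z², -2z³) + η_n(x, -3z², -2z³)` in the `n - 1` variables `(x, z)`. -/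
def cuspRestrict (𝕜 : Type*) [RCLike 𝕜] (m : ℕ) :
    SmoothGerms 𝕜 (m + 2) (Fin (m + 2) → 𝕜) →ₗ[𝕜] SmoothGerms 𝕜 (m + 1) 𝕜 where
  toFun η := ⟨Germ.map₂ (fun (u : Fin (m + 1) → 𝕜) (w : Fin (m + 2) → 𝕜) =>
        -u (Fin.last m) * w (idxY m) + w (idxZ m))
      ((id : (Fin (m + 1) → 𝕜) → _) : Germ (𝓝 (0 : Fin (m + 1) → 𝕜)) _)
      (η.1.compTendsto (cuspParam 𝕜 m) (tendsto_cuspParam 𝕜 m)), by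
    obtain ⟨h, hh, he⟩ := η.2
    rw [he]
    refine ⟨fun u => -u (Fin.last m) * h (cuspParam 𝕜 m u) (idxY m)
      + h (cuspParam 𝕜 m u) (idxZ m), ?_, rfl⟩
    filter_upwards [(tendsto_cuspParam 𝕜 m).eventually hh] with y h2
    have h3 : ContDiffAt 𝕜 ∞ (fun u => h (cuspParam 𝕜 m u)) y :=
      h2.comp y (contDiff_cuspParam 𝕜 m).contDiffAt
    have h4 := contDiffAt_pi.1 h3
    have h5 : ContDiffAt 𝕜 ∞ (fun u : Fin (m + 1) → 𝕜 => -u (Fin.last m)) y := by fun_prop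
    exact (h5.mul (h4 _)).add (h4 _)⟩
  map_add' η η' := by
    apply Subtype.ext
    obtain ⟨h, -, he⟩ := η.2
    obtain ⟨h', -, he'⟩ := η'.2
    simp only [Submodule.coe_add, he, he', ← Germ.coe_add, Germ.coe_compTendsto, Germ.map₂_coe]
    congr 1
    funext u
    simp only [Function.comp, Pi.add_apply, id]
    ring
  map_smul' c η := by
    apply Subtype.ext
    obtain ⟨h, -, he⟩ := η.2
    simp only [Submodule.coe_smul, he, ← Germ.coe_smul, Germ.coe_compTendsto, Germ.map₂_coe,
      RingHom.id_apply]
    congr 1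
    funext u
    simp only [Function.comp, Pi.smul_apply, id, smul_eq_mul]
    ring

/-- The subspace of `𝒪_{n-1}`, `n = m + 2`, of all germs
`-z η_{n-1}(x, -3z², -2z³) + η_n(x, -3z², -2z³)` with `η` liftable over `F`. -/
noncomputable def TSigma {𝕜 : Type*} [RCLike 𝕜] {ι : Type*} {m : ℕ} (F : MultiGerm 𝕜 ι (m + 2) (m + 2)) :
    Submodule 𝕜 (SmoothGerms 𝕜 (m + 1) 𝕜) :=
  F.Lift.map (cuspRestrict 𝕜 m)

/-- The `n = m + 2` monomials `1, z, x₁ z, …, x_m z`, as functions of the values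
`x = (x₁, …, x_m)` and `z`. -/
def basisMonomial {𝕜 : Type*} [RCLike 𝕜] {m : ℕ} (x : Fin m → 𝕜) (z : 𝕜) : Fin (m + 2) → 𝕜 :=
  Fin.cons 1 (Fin.cons z fun i => x i * z)

theorem contDiff_basisMonomial {𝕜 : Type*} [RCLike 𝕜] {m k : ℕ} (s : Fin m → Fin k) (t : Fin k)
    (a : Fin (m + 2)) :
    ContDiff 𝕜 ∞ (fun u : Fin k → 𝕜 => basisMonomial (fun i => u (s i)) (u t) a) := by
  refine Fin.cases ?_ (fun b => Fin.cases ?_ (fun i => ?_) b) a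
  · simp only [basisMonomial, Fin.cons_zero]; fun_prop
  · simp only [basisMonomial, Fin.cons_succ, Fin.cons_zero]; fun_prop
  · simp only [basisMonomial, Fin.cons_succ]; fun_prop

/-- The germs `1, z, x₁ z, …, x_m z` in `𝒪_{n-1}`, `n = m + 2`, with variables `(x₁, …, x_m, z)`. -/
def monomialGerm (𝕜 : Type*) [RCLike 𝕜] (m : ℕ) (a : Fin (m + 2)) : SmoothGerms 𝕜 (m + 1) 𝕜 :=
  germOf (fun u => basisMonomial (fun i => u i.castSucc) (u (Fin.last m)) a)
    (contDiff_basisMonomial _ _ a)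

/-- The elements `(0, ξ ∂/∂Z)` of `θ({F, g}) = θ(F) ⊕ θ(g)`, for `ξ = 1, z, x₁ z, …, x_m z` in the
variables `(x₁, …, x_m, y, z)`; `∂/∂Z` is the last coordinate field. -/
def monomialField (𝕜 : Type*) [RCLike 𝕜] (m : ℕ) (a : Fin (m + 2)) :
    Unit ⊕ Unit → SmoothGerms 𝕜 (m + 2) (Fin (m + 2) → 𝕜) :=
  Sum.elim 0 fun _ =>
    germOf (fun u => Pi.single (idxZ m)
        (basisMonomial (fun i => u i.castSucc.castSucc) (u (idxZ m)) a))
      ((ContinuousLinearMap.single 𝕜 (fun _ : Fin (m + 2) => 𝕜) (idxZ m)).contDiff.comp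
        (contDiff_basisMonomial _ _ a))

/-! Write n = m + 2, let P be the first component of F viewed as a polynomial in t = x₁, and P_t its
t-derivative (`typeADeriv`), of degree n in t.

Division. Everything rests on `hasLocalDivision_rclike`: dividing a smooth germ by a monic
polynomial in one coordinate, with coefficients linear in the other coordinates, leaves a remainder
polynomial with smooth coefficients. Over ℂ this is Weierstrass division, by Cauchy integrals over a
circle. Over ℝ it is Malgrange division, obtained in `exists_division_schwartz`. There a Schwartz
function times a Gaussian is expanded by Fourier inversion. Each exponential is entire in t, so
Cauchy's formula on a pair of horizontal lines applies to it. The lines have to avoid the roots of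
the divisor, and this is arranged smoothly in the parameters by a partition of unity over finitely
many heights, controlled by a resultant.

Stability of F. A field b along F is in the image of dF exactly when b₀ - ∑ t^j b_j (j ≥ 1) is
divisible by P_t. The n remainder coefficients of such a division depend on target coordinates only,
so the n components of η absorb them.

Reduction. A field b along g is in the image of dg exactly when b_Z - z b_Y vanishes on the critical
set y = -3z², which g maps by φ(x, z) = (x, -3z², -2z³). As F is stable, the F-branch of any class
can be cleared, and N𝒜ₑ({F, g}) becomes 𝒪_{n-1} / T_Σ (`exists_quotient_TSigma_equiv`).

Spanning. Let R be the ring of germs f ∘ φ, I its ideal generated by the coordinates, and M = R +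
zR, which contains every smooth germ in (x, z). T_Σ is an R-module. Let B_{l+1} be the coefficient
of t^l in P - X, where X is the first target coordinate, and put B₀ = 0. Reducing t^p · t P_t modulo
P_t produces liftable fields (`exists_liftable_of_reduction`), and these give (n+1-l) B_{l+1} -
(n+2-l) z B_l ∈ T_Σ + I²M for l ≤ n - 1. The last relation has no error term and says z³ ∈ T_Σ.
Multiplying the relations by the B_i gives I²M ⊆ T_Σ + I³M, hence I²M ⊆ T_Σ by Nakayama. What
remains modulo T_Σ is spanned by 1, z and the z x_i.

Independence. Evaluating the lift equation along curves tangent to the x₁-axis shows that a liftable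
η vanishes at 0 and constrains its linear part A (`IsLiftableA.exists_linear_part`). Suppose -z η_Y
+ η_Z restricts to a combination of 1, z, x_i z. Along (x, z) = (s²ξ, s), degrees 0 and 1 kill the
first two coefficients, and degree 2 kills all entries of the Z row of A but the last. The
constraints then kill the x-entries of the Y row, and the ξ-dependence in degree 3 forces the
remaining coefficients to vanish. -/

/-! ### Smoothness of integrals of kernels of temperate growth against rapidly decreasing weights.
-/

section TemperateIntegral

open MeasureTheory Function

universe u

/-- A polynomial bound in w that is uniform for the parameter in a unit ball; it is the dominating
function for differentiation under the integral. -/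
theorem Function.HasTemperateGrowth.norm_le_mul_of_dist_le {W E F : Type*} [NormedAddCommGroup W]
    [NormedSpace ℝ W] [NormedAddCommGroup E]
    [NormedSpace ℝ E] [NormedAddCommGroup F] [NormedSpace ℝ F] {Φ : W × E → F}
    (hΦ : Φ.HasTemperateGrowth) (e : E) :
    ∃ (k : ℕ) (C : ℝ), 0 ≤ C ∧ ∀ w, ∀ y ∈ Metric.ball e 1, ‖Φ (w, y)‖ ≤ C * (1 + ‖w‖) ^ k := by
  obtain ⟨k, C, hC, h⟩ := hΦ.norm_iteratedFDeriv_le_uniform 0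
  refine ⟨k, C * (2 + ‖e‖) ^ k, by positivity, fun w y hy => ?_⟩
  have h1 := h 0 le_rfl (w, y)
  rw [norm_iteratedFDeriv_zero] at h1
  refine h1.trans ?_
  rw [mul_assoc, ← mul_pow]
  gcongr
  have h2 : ‖y‖ ≤ ‖e‖ + 1 := by
    have := norm_le_norm_add_norm_sub' y e
    rw [mem_ball_iff_norm] at hy
    linarith
  have h3 : ‖(w, y)‖ ≤ ‖w‖ + ‖y‖ := by
    rw [Prod.norm_mk]
    exact max_le_add_of_nonneg (norm_nonneg _) (norm_nonneg _)
  nlinarith [norm_nonneg w, norm_nonneg e, norm_nonneg y]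

theorem Function.HasTemperateGrowth.fderiv_comp_clm {E E' F : Type*} [NormedAddCommGroup E]
    [NormedSpace ℝ E] [NormedAddCommGroup E'] [NormedSpace ℝ E'] [NormedAddCommGroup F]
    [NormedSpace ℝ F] {Φ : E → F} (hΦ : Φ.HasTemperateGrowth) (L : E' →L[ℝ] E) :
    Function.HasTemperateGrowth fun x => (fderiv ℝ Φ x).comp L := by
  have h : Function.HasTemperateGrowth (fderiv ℝ Φ) := by
    refine ⟨hΦ.1.fderiv_right (by simp), fun n => ?_⟩
    obtain ⟨k, C, h⟩ := hΦ.2 (n + 1)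
    refine ⟨k, C, fun x => ?_⟩
    rw [norm_iteratedFDeriv_fderiv]
    exact h x
  exact ((ContinuousLinearMap.compL ℝ E' E F).flip L).hasTemperateGrowth.comp h

variable {W : Type*} [NormedAddCommGroup W] [NormedSpace ℝ W] [MeasurableSpace W] [BorelSpace W]
  [SecondCountableTopology W] {μ : Measure W} {g : W → ℂ}

theorem integrable_smul_temperate {E F : Type*} [NormedAddCommGroup E]
    [NormedSpace ℝ E] [NormedAddCommGroup F] [NormedSpace ℝ F] [NormedSpace ℂ F]
    (hg : AEStronglyMeasurable g μ)
    (hgi : ∀ N : ℕ, Integrable (fun w => ‖g w‖ * (1 + ‖w‖) ^ N) μ)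
    {Φ : W × E → F} (hΦ : Φ.HasTemperateGrowth) (e : E) :
    Integrable (fun w => g w • Φ (w, e)) μ := by
  obtain ⟨k, C, hC, h⟩ := hΦ.norm_le_mul_of_dist_le e
  have hc : Continuous fun w => Φ (w, e) := hΦ.1.continuous.comp (by fun_prop)
  refine ((hgi k).const_mul C).mono' (hg.smul hc.aestronglyMeasurable) (ae_of_all _ fun w => ?_)
  rw [norm_smul]
  have := h w e (Metric.mem_ball_self one_pos)
  calc ‖g w‖ * ‖Φ (w, e)‖ ≤ ‖g w‖ * (C * (1 + ‖w‖) ^ k) := by gcongr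
    _ = _ := by ring

theorem hasFDerivAt_integral_smul_temperate {E F : Type*} [NormedAddCommGroup E]
    [NormedSpace ℝ E] [NormedAddCommGroup F] [NormedSpace ℝ F] [NormedSpace ℂ F]
    [IsScalarTower ℝ ℂ F] (hg : AEStronglyMeasurable g μ)
    (hgi : ∀ N : ℕ, Integrable (fun w => ‖g w‖ * (1 + ‖w‖) ^ N) μ)
    {Φ : W × E → F} (hΦ : Φ.HasTemperateGrowth) (e : E) :
    HasFDerivAt (fun e => ∫ w, g w • Φ (w, e) ∂μ)
      (∫ w, g w • (fderiv ℝ Φ (w, e)).comp (ContinuousLinearMap.inr ℝ W E) ∂μ) e := by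
  have hΦ' := hΦ.fderiv_comp_clm (ContinuousLinearMap.inr ℝ W E)
  obtain ⟨k, C, hC, h⟩ := hΦ'.norm_le_mul_of_dist_le e
  refine hasFDerivAt_integral_of_dominated_of_fderiv_le (𝕜 := ℝ)
    (F := fun e w => g w • Φ (w, e))
    (F' := fun e w => g w • (fderiv ℝ Φ (w, e)).comp (ContinuousLinearMap.inr ℝ W E))
    (s := Metric.ball e 1) (bound := fun w => C * (‖g w‖ * (1 + ‖w‖) ^ k))
    (Metric.ball_mem_nhds e one_pos) ?_ (integrable_smul_temperate hg hgi hΦ e)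
    (integrable_smul_temperate hg hgi hΦ' e).aestronglyMeasurable ?_ ((hgi k).const_mul C) ?_
  · exact Eventually.of_forall fun y => (integrable_smul_temperate hg hgi hΦ y).aestronglyMeasurable
  · refine ae_of_all _ fun w y hy => ?_
    rw [norm_smul]
    calc _ ≤ ‖g w‖ * (C * (1 + ‖w‖) ^ k) := by gcongr; exact h w y hy
      _ = _ := by ring
  · refine ae_of_all _ fun w y _ => ?_
    have h1 : HasFDerivAt Φ (fderiv ℝ Φ (w, y)) (w, y) :=
      (hΦ.1.differentiable (by simp)).differentiableAt.hasFDerivAt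
    have h2 := (h1.comp y (hasFDerivAt_prodMk_right w y)).const_smul (g w)
    exact h2

/-- The derivative is an integral of the same shape whose kernel takes values in linear maps E → F,
so induction on the order with F generalized applies. E and F share a universe so that this space of
linear maps stays in it. -/
theorem contDiff_integral_smul_temperate {E F : Type u} [NormedAddCommGroup E]
    [NormedSpace ℝ E] [NormedAddCommGroup F] [NormedSpace ℝ F] [NormedSpace ℂ F]
    [IsScalarTower ℝ ℂ F] (hg : AEStronglyMeasurable g μ)
    (hgi : ∀ N : ℕ, Integrable (fun w => ‖g w‖ * (1 + ‖w‖) ^ N) μ)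
    {Φ : W × E → F} (hΦ : Φ.HasTemperateGrowth) :
    ContDiff ℝ ∞ fun e => ∫ w, g w • Φ (w, e) ∂μ := by
  rw [contDiff_infty]
  intro n
  induction n generalizing F with
  | zero =>
    exact contDiff_zero.2 (continuous_iff_continuousAt.2 fun e =>
      (hasFDerivAt_integral_smul_temperate hg hgi hΦ e).continuousAt)
  | succ n ih =>
    push_cast
    rw [contDiff_succ_iff_hasFDerivAt]
    exact ⟨_, ih (hΦ.fderiv_comp_clm (ContinuousLinearMap.inr ℝ W E)),
      fun e => hasFDerivAt_integral_smul_temperate hg hgi hΦ e⟩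

end TemperateIntegral

/-! ### Building blocks of temperate growth: inverses, cutoffs, exponentials. -/

section TemperateLemmas

open Function

variable {E : Type*} [NormedAddCommGroup E] [NormedSpace ℝ E]

theorem Function.HasTemperateGrowth.inv_of_one_le {f : E → ℝ} (hf : f.HasTemperateGrowth)
    (h1 : ∀ x, 1 ≤ f x) : Function.HasTemperateGrowth fun x => (f x)⁻¹ := by
  have hunique : UniqueDiffOn ℝ (Set.Ioi (1 / 2 : ℝ)) := isOpen_Ioi.uniqueDiffOn
  have hne : ∀ x ∈ Set.Ioi (1 / 2 : ℝ), x ≠ 0 := fun x hx => by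
    have := Set.mem_Ioi.1 hx
    intro h; rw [h] at this; norm_num at this
  -- On this open set, which contains the range of `f`, every derivative of the inverse is bounded.
  refine HasTemperateGrowth.comp' (g := fun x : ℝ => x⁻¹) (t := Set.Ioi (1 / 2)) ?_ hunique
    (fun x hx => (contDiffAt_inv ℝ (hne x hx)).contDiffWithinAt) ?_ hf
  · rintro _ ⟨x, rfl⟩
    exact Set.mem_Ioi.2 (by linarith [h1 x])
  · intro N
    refine ⟨0, N.factorial * 2 ^ (N + 1), by positivity, fun n hn x hx => ?_⟩
    rw [norm_iteratedFDerivWithin_eq_norm_iteratedDerivWithin,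
      iteratedDerivWithin_eq_iteratedDeriv hunique (contDiffAt_inv ℝ (hne x hx)) hx,
      iteratedDeriv_eq_iterate, iter_deriv_inv]
    have hx' : (1 / 2 : ℝ) < x := hx
    have h0 : (0 : ℝ) < x := by linarith
    have h3 : |x ^ (-1 - n : ℤ)| ≤ 2 ^ (n + 1) := by
      have : (-1 - n : ℤ) = -((n + 1 : ℕ) : ℤ) := by push_cast; ring
      rw [this, zpow_neg, zpow_natCast, abs_of_pos (by positivity), ← inv_pow]
      gcongr
      rw [inv_le_comm₀ h0 (by norm_num)]
      linarith
    simp only [norm_mul, norm_pow, norm_neg, norm_one, one_pow, one_mul, pow_zero, mul_one,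
      RCLike.norm_natCast, Real.norm_eq_abs]
    gcongr
    exact h3.trans (pow_le_pow_right₀ (by norm_num) (Nat.add_le_add_right hn 1))

/-- A smooth cutoff on `ℝ` equal to `1` on `[-1/2, 1/2]` and to `0` outside `(-1, 1)`. -/
noncomputable def unitBump : ContDiffBump (0 : ℝ) := ⟨1 / 2, 1, by norm_num, by norm_num⟩

theorem unitBump_eq_one {s : ℝ} (hs : |s| ≤ 1 / 2) : unitBump s = 1 :=
  unitBump.one_of_mem_closedBall (by simpa [unitBump] using hs)

theorem unitBump_eq_zero {s : ℝ} (hs : 1 ≤ |s|) : unitBump s = 0 :=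
  unitBump.zero_of_le_dist (by simpa [unitBump] using hs)

@[fun_prop]
theorem hasTemperateGrowth_unitBump : Function.HasTemperateGrowth (fun s => unitBump s) :=
  unitBump.hasCompactSupport.hasTemperateGrowth unitBump.contDiff

/-- A smooth function on `ℝ` equal to `s⁻¹` for `1 ≤ |s|`. -/
noncomputable def smoothInv (s : ℝ) : ℝ := 4 * s * (4 * s ^ 2 + 4 * unitBump s)⁻¹

theorem smoothInv_eq {s : ℝ} (hs : 1 ≤ |s|) : smoothInv s = s⁻¹ := by
  have : s ≠ 0 := by rintro rfl; norm_num at hs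
  rw [smoothInv, unitBump_eq_zero hs]
  field_simp
  ring

-- The denominator is at least 1 everywhere: near 0 the bump contributes 4, and for |s| ≥ 1/2
-- already 4s² ≥ 1. This is the purpose of the factors 4 in `smoothInv`.
@[fun_prop]
theorem hasTemperateGrowth_smoothInv : Function.HasTemperateGrowth smoothInv := by
  have h : Function.HasTemperateGrowth fun s : ℝ => (4 * s ^ 2 + 4 * unitBump s)⁻¹ := by
    refine Function.HasTemperateGrowth.inv_of_one_le (by fun_prop) fun s => ?_
    rcases le_total |s| (1 / 2) with h | h
    · rw [unitBump_eq_one h]; nlinarith [sq_nonneg s]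
    · have := unitBump.nonneg (x := s)
      have h2 := sq_abs s
      nlinarith
  unfold smoothInv
  fun_prop

/-- A smooth function on `ℝ` equal to `0` on `[-1/2, 1/2]` and to `1` outside `(-1, 1)`. -/
noncomputable def smoothStep (s : ℝ) : ℝ := 1 - unitBump s

theorem smoothStep_eq_one {s : ℝ} (hs : 1 ≤ |s|) : smoothStep s = 1 := by
  rw [smoothStep, unitBump_eq_zero hs, sub_zero]

theorem half_le_of_smoothStep_ne_zero {s : ℝ} (hs : smoothStep s ≠ 0) : 1 / 2 ≤ |s| := by
  by_contra! h
  exact hs (by rw [smoothStep, unitBump_eq_one h.le, sub_self])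

theorem smoothStep_nonneg (s : ℝ) : 0 ≤ smoothStep s := sub_nonneg.2 unitBump.le_one

@[fun_prop]
theorem hasTemperateGrowth_smoothStep : Function.HasTemperateGrowth smoothStep := by
  unfold smoothStep
  fun_prop

theorem Function.HasTemperateGrowth.comp_fun {D F : Type*} [NormedAddCommGroup D] [NormedSpace ℝ D]
    [NormedAddCommGroup F] [NormedSpace ℝ F] {g : E → F} {f : D → E}
    (hg : g.HasTemperateGrowth) (hf : f.HasTemperateGrowth) :
    Function.HasTemperateGrowth fun x => g (f x) :=
  hg.comp hf

@[fun_prop]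
theorem hasTemperateGrowth_cexp_ofReal_mul_I :
    Function.HasTemperateGrowth fun x : ℝ => Complex.exp (x * Complex.I) := by
  refine ⟨(Complex.ofRealCLM.contDiff.mul contDiff_const).cexp, fun n => ⟨0, 1, fun x => ?_⟩⟩
  have h : ∀ n : ℕ, iteratedDeriv n (fun x : ℝ => Complex.exp (x * Complex.I)) =
      fun x : ℝ => Complex.I ^ n * Complex.exp (x * Complex.I) := by
    intro n
    induction n with
    | zero => simp
    | succ n ih =>
      rw [iteratedDeriv_succ, ih]
      funext x
      have h1 : HasDerivAt (fun x : ℝ => (x : ℂ) * Complex.I) Complex.I x := by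
        simpa using (Complex.ofRealCLM.hasDerivAt (x := x)).mul_const Complex.I
      rw [((h1.cexp).const_mul _).deriv]
      ring
  rw [norm_iteratedFDeriv_eq_norm_iteratedDeriv, h]
  simp [Complex.norm_exp_ofReal_mul_I]

/-- A compactly supported smooth function on `ℝ` equal to `exp` on `[-7, 7]`. -/
noncomputable def cutExp (s : ℝ) : ℝ := Real.exp s * unitBump (s / 14)

theorem cutExp_eq {s : ℝ} (hs : |s| ≤ 7) : cutExp s = Real.exp s := by
  rw [cutExp, unitBump_eq_one, mul_one]
  rw [abs_div, abs_of_pos (by norm_num : (0 : ℝ) < 14)]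
  linarith

@[fun_prop]
theorem hasTemperateGrowth_cutExp : Function.HasTemperateGrowth cutExp := by
  refine HasCompactSupport.hasTemperateGrowth ?_ ?_
  · refine HasCompactSupport.of_support_subset_isCompact (isCompact_Icc (a := -14) (b := 14)) ?_
    intro s hs
    rw [Function.mem_support, cutExp] at hs
    by_contra h
    refine hs ?_
    rw [unitBump_eq_zero, mul_zero]
    rw [Set.mem_Icc, not_and_or, not_le, not_le] at h
    rw [abs_div, abs_of_pos (by norm_num : (0 : ℝ) < 14), le_div_iff₀ (by norm_num), le_abs]
    rcases h with h | h
    · right; linarith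
    · left; linarith
  · have : ContDiff ℝ ∞ (fun s : ℝ => unitBump (s / 14)) := unitBump.contDiff.comp (by fun_prop)
    exact Real.contDiff_exp.mul this

end TemperateLemmas

/-! ### Cauchy's formula on a horizontal strip. -/

section LineIntegrals

open MeasureTheory Complex intervalIntegral

theorem hasDerivAt_arctan_sub_div {y t x : ℝ} (hy : y ≠ 0) :
    HasDerivAt (fun x => Real.arctan ((x - t) / y)) (y / ((x - t) ^ 2 + y ^ 2)) x := by
  have h := (((hasDerivAt_id' x).sub_const t).div_const y).arctan
  convert h using 1
  have : (x - t) ^ 2 + y ^ 2 ≠ 0 := by positivity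
  have h2 : 1 + ((x - t) / y) ^ 2 ≠ 0 := by positivity
  field_simp
  ring

theorem add_mul_I_sub_ne_zero {x y t : ℝ} (hy : y ≠ 0) : (x : ℂ) + y * I - t ≠ 0 := by
  intro h
  have := congrArg Complex.im h
  simp at this
  exact hy this

/-- Cauchy's formula for the strip between two horizontal lines. -/
theorem integral_line_sub_integral_line {f : ℂ → ℂ} (hf : Differentiable ℂ f) {y : ℝ} (hy : 0 < y)
    {B : ℝ} (hB : ∀ x v : ℝ, |v| ≤ y → ‖f (x + v * I)‖ ≤ B)
    (t : ℝ) (hi₁ : Integrable fun x : ℝ => f (x + (-y : ℝ) * I) / (x + (-y : ℝ) * I - t))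
    (hi₂ : Integrable fun x : ℝ => f (x + y * I) / (x + y * I - t)) :
    (∫ x : ℝ, f (x + (-y : ℝ) * I) / (x + (-y : ℝ) * I - t)) -
      (∫ x : ℝ, f (x + y * I) / (x + y * I - t)) = 2 * Real.pi * I * f t := by
  -- Removing the singularity gives an entire function, whose integral over rectangles is zero. The
  -- remaining part f(t)/(z - t) is integrated explicitly with arctangents and produces the factor
  -- 2πi.
  set G : ℂ → ℂ := dslope f t with hG
  have hGd : Differentiable ℂ G := by
    intro z
    have h1 : DifferentiableOn ℂ (dslope f (t : ℂ)) Set.univ :=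
      (Complex.differentiableOn_dslope univ_mem).2 hf.differentiableOn
    exact (h1 z (Set.mem_univ z)).differentiableAt univ_mem
  have hGv : ∀ x v : ℝ, (x : ℂ) + v * I - t ≠ 0 →
      G (x + v * I) = f (x + v * I) / (x + v * I - t) - f t / (x + v * I - t) := by
    intro x v h
    rw [hG, dslope_of_ne _ (sub_ne_zero.1 h), slope_def_field, sub_div]
  have hGc : Continuous G := hGd.continuous
  -- the vertical sides
  have hside : ∀ s : ℝ, s = 1 ∨ s = -1 → Tendsto (fun R : ℝ =>
      ∫ v : ℝ in (-y)..y, G ((s * R : ℝ) + v * I)) atTop (𝓝 0) := by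
    intro s hs
    have hbound : ∀ᶠ R : ℝ in atTop, ‖∫ v : ℝ in (-y)..y, G ((s * R : ℝ) + v * I)‖ ≤
        (B + ‖f t‖) * (2 * y) * (R - |t|)⁻¹ := by
      filter_upwards [eventually_gt_atTop (|t|)] with R hR
      have h1 : ∀ v ∈ Set.uIoc (-y) y, ‖G ((s * R : ℝ) + v * I)‖ ≤ (B + ‖f t‖) * (R - |t|)⁻¹ := by
        intro v hv
        rw [Set.uIoc_of_le (by linarith)] at hv
        have h2 : R - |t| ≤ ‖((s * R : ℝ) : ℂ) + v * I - t‖ := by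
          refine le_trans ?_ (Complex.abs_re_le_norm _)
          simp only [Complex.sub_re, Complex.add_re, Complex.ofReal_re, Complex.mul_re,
            Complex.I_re, Complex.ofReal_im, Complex.I_im]
          rcases abs_cases t with ⟨h3, h4⟩ | ⟨h3, h4⟩ <;> rcases hs with rfl | rfl <;>
            rw [le_abs] <;> first | (left; linarith) | (right; linarith)
        have h3 : ((s * R : ℝ) : ℂ) + v * I - t ≠ 0 := by
          rw [← norm_pos_iff]; linarith
        rw [hGv _ _ h3, ← sub_div, norm_div, div_eq_mul_inv]
        have h5 : |v| ≤ y := abs_le.2 ⟨hv.1.le, hv.2⟩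
        have h6 := hB (s * R) v h5
        have h7 : 0 ≤ B := (norm_nonneg _).trans h6
        have h8 : 0 < R - |t| := by linarith
        gcongr
        exact (norm_sub_le _ _).trans (by gcongr)
      have h2 := intervalIntegral.norm_integral_le_of_norm_le_const h1
      refine h2.trans (le_of_eq ?_)
      rw [abs_of_pos (by linarith : 0 < y - -y)]
      ring
    refine squeeze_zero_norm' hbound ?_
    have : Tendsto (fun R : ℝ => (R - |t|)⁻¹) atTop (𝓝 0) :=
      tendsto_inv_atTop_zero.comp (tendsto_atTop_add_const_right _ _ tendsto_id)
    simpa using this.const_mul ((B + ‖f t‖) * (2 * y))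
  -- the rectangle
  have hrect : ∀ R : ℝ, (∫ x : ℝ in (-R)..R, G (x + (-y : ℝ) * I)) -
      (∫ x : ℝ in (-R)..R, G (x + y * I)) =
      I * (∫ v : ℝ in (-y)..y, G (((-1) * R : ℝ) + v * I)) -
        I * (∫ v : ℝ in (-y)..y, G ((1 * R : ℝ) + v * I)) := by
    intro R
    have h := Complex.integral_boundary_rect_eq_zero_of_differentiableOn G (-R + (-y : ℝ) * I)
      (R + y * I) hGd.differentiableOn
    simp only [smul_eq_mul, add_re, neg_re, ofReal_re, mul_re, I_re, mul_zero, ofReal_im, I_im,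
      mul_one, sub_self, add_zero, add_im, neg_im, mul_im, zero_add, neg_zero] at h
    simp only [one_mul, neg_mul]
    linear_combination h
  have hlim : Tendsto (fun R : ℝ => (∫ x : ℝ in (-R)..R, G (x + (-y : ℝ) * I)) -
      (∫ x : ℝ in (-R)..R, G (x + y * I))) atTop (𝓝 0) := by
    simp_rw [hrect]
    have h1 := ((hside (-1) (Or.inr rfl)).const_mul I).sub ((hside 1 (Or.inl rfl)).const_mul I)
    simpa using h1
  have hden : ∀ v : ℝ, v ≠ 0 → Continuous fun x : ℝ => f t / ((x : ℂ) + v * I - t) := by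
    intro v hv
    exact continuous_const.div (by fun_prop) fun x => add_mul_I_sub_ne_zero hv
  have hnum : ∀ v : ℝ, v ≠ 0 → Continuous fun x : ℝ => f (x + v * I) / ((x : ℂ) + v * I - t) := by
    intro v hv
    exact (hf.continuous.comp (by fun_prop)).div (by fun_prop) fun x => add_mul_I_sub_ne_zero hv
  -- the explicit part
  have hexp : ∀ R : ℝ, (∫ x : ℝ in (-R)..R, f t / (x + (-y : ℝ) * I - t)) -
      (∫ x : ℝ in (-R)..R, f t / (x + y * I - t)) =
      2 * I * f t * ((Real.arctan ((R - t) / y) - Real.arctan ((-R - t) / y) : ℝ) : ℂ) := by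
    intro R
    rw [← intervalIntegral.integral_sub ((hden _ (by linarith)).intervalIntegrable _ _)
      ((hden _ hy.ne').intervalIntegrable _ _)]
    have h1 : ∫ x : ℝ in (-R)..R, y / ((x - t) ^ 2 + y ^ 2) =
        Real.arctan ((R - t) / y) - Real.arctan ((-R - t) / y) := by
      refine intervalIntegral.integral_eq_sub_of_hasDerivAt
        (fun x _ => hasDerivAt_arctan_sub_div hy.ne') (Continuous.intervalIntegrable ?_ _ _)
      exact continuous_const.div (by fun_prop) fun x => by positivity
    rw [← h1, ← intervalIntegral.integral_ofReal, ← intervalIntegral.integral_const_mul]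
    refine intervalIntegral.integral_congr fun x _ => ?_
    have h2 := add_mul_I_sub_ne_zero (x := x) (t := t) hy.ne'
    have h3 := add_mul_I_sub_ne_zero (x := x) (t := t) (neg_ne_zero.2 hy.ne')
    have h4 : ((x : ℂ) - t) ^ 2 + y ^ 2 = (x + y * I - t) * (x + (-y : ℝ) * I - t) := by
      push_cast
      linear_combination (y : ℂ) ^ 2 * I_sq
    push_cast at h3 h4 ⊢
    rw [neg_mul, ← sub_eq_add_neg] at h3 h4 ⊢
    rw [h4]
    field_simp
    ring
  have harc : Tendsto (fun R : ℝ => (Real.arctan ((R - t) / y) - Real.arctan ((-R - t) / y) : ℝ))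
      atTop (𝓝 Real.pi) := by
    have h1 : Tendsto (fun R : ℝ => (R - t) / y) atTop atTop :=
      (tendsto_atTop_add_const_right _ (-t) tendsto_id).atTop_div_const hy
    have h2 : Tendsto (fun R : ℝ => (-R - t) / y) atTop atBot :=
      (tendsto_atBot_add_const_right _ (-t) tendsto_neg_atTop_atBot).atBot_div_const hy
    have h3 := (tendsto_nhds_of_tendsto_nhdsWithin (Real.tendsto_arctan_atTop.comp h1)).sub
      (tendsto_nhds_of_tendsto_nhdsWithin (Real.tendsto_arctan_atBot.comp h2))
    rw [show Real.pi = Real.pi / 2 - -(Real.pi / 2) by ring]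
    exact h3
  have hsum : Tendsto (fun R : ℝ =>
      (∫ x : ℝ in (-R)..R, f (x + (-y : ℝ) * I) / (x + (-y : ℝ) * I - t)) -
      (∫ x : ℝ in (-R)..R, f (x + y * I) / (x + y * I - t))) atTop
      (𝓝 (2 * Real.pi * I * f t)) := by
    have h1 := hlim.add ((Complex.continuous_ofReal.tendsto _ |>.comp harc).const_mul (2 * I * f t))
    rw [show 2 * Real.pi * I * f t = 0 + 2 * I * f t * Real.pi by ring]
    refine h1.congr fun R => ?_
    rw [Function.comp_apply, ← hexp]
    have h2 : ∀ v : ℝ, v ≠ 0 → ∫ x : ℝ in (-R)..R, G (x + v * I) =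
        (∫ x : ℝ in (-R)..R, f (x + v * I) / (x + v * I - t)) -
          ∫ x : ℝ in (-R)..R, f t / (x + v * I - t) := by
      intro v hv
      rw [← intervalIntegral.integral_sub ((hnum v hv).intervalIntegrable _ _)
        ((hden v hv).intervalIntegrable _ _)]
      exact intervalIntegral.integral_congr fun x _ => hGv x v (add_mul_I_sub_ne_zero hv)
    rw [h2 _ (neg_ne_zero.2 hy.ne'), h2 _ hy.ne']
    ring
  refine tendsto_nhds_unique ?_ hsum
  exact (intervalIntegral_tendsto_integral hi₁ tendsto_neg_atTop_atBot tendsto_id).sub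
    (intervalIntegral_tendsto_integral hi₂ tendsto_neg_atTop_atBot tendsto_id)

end LineIntegrals

/-! ### Resultants that detect roots near a horizontal line. -/

section LineResultant

open Polynomial

/-- The monic polynomial `X ^ k + ∑ i < k, a i X ^ i`. -/
noncomputable def monicPoly {R : Type*} [CommRing R] {k : ℕ} (a : Fin k → R) : R[X] :=
  X ^ k + ∑ i, C (a i) * X ^ (i : ℕ)

theorem degree_sum_C_mul_X_pow_lt {R : Type*} [CommRing R] {k : ℕ} (a : Fin k → R) :
    (∑ i, C (a i) * X ^ (i : ℕ)).degree < (k : WithBot ℕ) :=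
  (degree_sum_le _ _).trans_lt <| (Finset.sup_lt_iff (by exact WithBot.bot_lt_coe k)).2 fun i _ =>
    (degree_C_mul_X_pow_le _ _).trans_lt (by exact_mod_cast i.2)

theorem monic_monicPoly {R : Type*} [CommRing R] {k : ℕ} (a : Fin k → R) : (monicPoly a).Monic :=
  monic_X_pow_add (degree_sum_C_mul_X_pow_lt a)

theorem natDegree_monicPoly {R : Type*} [CommRing R] [Nontrivial R] {k : ℕ} (a : Fin k → R) :
    (monicPoly a).natDegree = k :=
  natDegree_eq_of_degree_eq_some <| by
    rw [monicPoly, degree_add_eq_left_of_degree_lt] <;> rw [degree_X_pow]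
    exact degree_sum_C_mul_X_pow_lt a

theorem eval_monicPoly {R : Type*} [CommRing R] {k : ℕ} (a : Fin k → R) (z : R) :
    (monicPoly a).eval z = z ^ k + ∑ i, a i * z ^ (i : ℕ) := by
  simp [monicPoly, eval_finsetSum]

theorem map_monicPoly {R S : Type*} [CommRing R] [CommRing S] (φ : R →+* S) {k : ℕ}
    (a : Fin k → R) : (monicPoly a).map φ = monicPoly fun i => φ (a i) := by
  simp [monicPoly, Polynomial.map_sum]

/-- The resultant of `p(X)` and `p(X + w)` for the generic monic polynomial `p` of degree `k`, as a
polynomial in the coefficients of `p` and in the variable `w`, which has index `none`. -/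
noncomputable def shiftResultant (k : ℕ) : MvPolynomial (Option (Fin k)) ℂ :=
  resultant (monicPoly fun i : Fin k => (MvPolynomial.X (some i) : MvPolynomial (Option (Fin k)) ℂ))
    (taylor (MvPolynomial.X none) (monicPoly fun i : Fin k => MvPolynomial.X (some i))) k k

theorem eval_shiftResultant {k : ℕ} (a : Fin k → ℂ) (w : ℂ) :
    MvPolynomial.eval (fun o => o.elim w a) (shiftResultant k) =
      resultant (monicPoly a) (taylor w (monicPoly a)) k k := by
  rw [shiftResultant, ← resultant_map_map, Polynomial.map_taylor, map_monicPoly]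
  have h : ∀ o, MvPolynomial.eval (fun o : Option (Fin k) => o.elim w a) (MvPolynomial.X o) =
      o.elim w a := fun o => MvPolynomial.eval_X (f := fun o : Option (Fin k) => o.elim w a) o
  rw [funext fun i => h (some i), h none]
  rfl

/-- The roots are not smooth in the coefficients, but this product over pairs of roots is a
polynomial in `a` and `w`. This makes it usable in cutoffs. -/
theorem exists_roots_monicPoly {k : ℕ} (a : Fin k → ℂ) :
    ∃ r : Fin k → ℂ, (∀ z, (monicPoly a).eval z = ∏ i, (z - r i)) ∧
      ∀ w, MvPolynomial.eval (fun o => o.elim w a) (shiftResultant k) =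
        ∏ i, ∏ j, (r i + w - r j) := by
  have hs := IsAlgClosed.splits (monicPoly a)
  have hcard : Multiset.card (monicPoly a).roots = k := by
    rw [← hs.natDegree_eq_card_roots, natDegree_monicPoly]
  obtain ⟨r, hr⟩ : ∃ r : Fin k → ℂ, (monicPoly a).roots = Finset.univ.val.map r := by
    obtain ⟨l, hl⟩ := Quot.exists_rep (monicPoly a).roots
    rw [← hl] at hcard ⊢
    have hlen : l.length = k := hcard
    subst hlen
    refine ⟨l.get, ?_⟩
    change (l : Multiset ℂ) = ((List.finRange l.length).map l.get : Multiset ℂ)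
    rw [List.map_get_finRange]
  have heval : ∀ z, (monicPoly a).eval z = ∏ i, (z - r i) := by
    intro z
    rw [hs.eval_eq_prod_roots_of_monic (monic_monicPoly a), hr, Multiset.map_map]
    rfl
  refine ⟨r, heval, fun w => ?_⟩
  rw [eval_shiftResultant]
  have h := resultant_eq_prod_eval (monicPoly a) (taylor w (monicPoly a)) k
    (by rw [natDegree_taylor, natDegree_monicPoly]) hs
  rw [natDegree_monicPoly, (monic_monicPoly a).leadingCoeff, one_pow, one_mul, hr,
    Multiset.map_map] at h
  rw [h]
  refine Finset.prod_congr rfl fun i _ => ?_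
  simp only [Function.comp, taylor_eval, heval]

theorem norm_root_le {k : ℕ} {a : Fin k → ℂ} {z : ℂ} (hz : (monicPoly a).eval z = 0) :
    ‖z‖ ≤ 1 + ∑ i, ‖a i‖ := by
  by_contra! h
  have hS : 0 ≤ ∑ i, ‖a i‖ := Finset.sum_nonneg fun _ _ => norm_nonneg _
  have h1 : 1 < ‖z‖ := by linarith
  rcases k with _ | k
  · simp [eval_monicPoly] at hz
  rw [eval_monicPoly, add_eq_zero_iff_eq_neg] at hz
  have h2 : ‖z‖ ^ (k + 1) ≤ (∑ i, ‖a i‖) * ‖z‖ ^ k := by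
    rw [← norm_pow, hz, norm_neg, Finset.sum_mul]
    refine (norm_sum_le _ _).trans (Finset.sum_le_sum fun i _ => ?_)
    rw [norm_mul, norm_pow]
    gcongr
    · exact h1.le
    · exact Nat.lt_succ_iff.1 i.2
  rw [pow_succ'] at h2
  have h3 := le_of_mul_le_mul_right h2 (by positivity)
  linarith

/-- The value at `w = 2iy` of the resultant of `p(X)` and `p(X + w)`, for the monic polynomial `p`
with real coefficients `a`. It vanishes if `p` has a root with imaginary part `y`. -/
noncomputable def lineResultant {k : ℕ} (a : Fin k → ℝ) (y : ℝ) : ℂ :=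
  MvPolynomial.eval (fun o => o.elim (2 * y * Complex.I) fun i => (a i : ℂ)) (shiftResultant k)

/-- Pigeonhole: a height with a small resultant is matched with a pair of roots whose factor is
smaller than δ. There are k² + 1 heights and k² pairs, while one pair cannot serve two heights,
because the quantities 2(j + 1)δ are 2δ apart. -/
theorem exists_le_norm_lineResultant {k : ℕ} (a : Fin k → ℝ) {δ : ℝ} (hδ : 0 < δ) :
    ∃ j : Fin (k ^ 2 + 1), δ ^ (k ^ 2) ≤ ‖lineResultant a (((j : ℕ) + 1 : ℝ) * δ)‖ := by
  obtain ⟨r, -, hr⟩ := exists_roots_monicPoly fun i => (a i : ℂ)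
  by_contra! hcon
  have hbad : ∀ j : Fin (k ^ 2 + 1), ∃ p : Fin k × Fin k,
      |2 * (((j : ℕ) + 1 : ℝ) * δ) + (r p.1 - r p.2).im| < δ := by
    intro j
    by_contra! hj
    refine absurd (hcon j) (not_lt.2 ?_)
    rw [lineResultant, hr]
    have h1 : ∀ i m, δ ≤ ‖r i + 2 * (((((j : ℕ) + 1 : ℝ) * δ : ℝ)) : ℂ) * Complex.I - r m‖ := by
      intro i m
      refine (hj (i, m)).trans ((le_of_eq ?_).trans (Complex.abs_im_le_norm _))
      congr 1
      simp
      ring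
    rw [norm_prod]
    simp_rw [norm_prod]
    calc δ ^ (k ^ 2) = ∏ i : Fin k, ∏ m : Fin k, δ := by simp [sq, pow_mul]
      _ ≤ _ := Finset.prod_le_prod (fun _ _ => Finset.prod_nonneg fun _ _ => hδ.le) fun i _ =>
        Finset.prod_le_prod (fun _ _ => hδ.le) fun m _ => h1 i m
  choose p hp using hbad
  obtain ⟨j, j', hne, heq⟩ := Fintype.exists_ne_map_eq_of_card_lt p (by simp [sq])
  have h1 := hp j
  have h2 := hp j'
  rw [← heq] at h2
  rw [abs_lt] at h1 h2
  have key : ∀ m n : ℕ, m < n → 2 * ((n + 1 : ℝ) * δ) - 2 * ((m + 1 : ℝ) * δ) < 2 * δ → False := by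
    intro m n hmn h
    have : (m : ℝ) + 1 ≤ n := by exact_mod_cast hmn
    nlinarith
  rcases lt_or_gt_of_ne (fun h => hne (Fin.ext h) : (j : ℕ) ≠ j') with h | h
  · exact key _ _ h (by linarith)
  · exact key _ _ h (by linarith)

/-- Regroup the product as ∏ |p(r̄_i + 2iy)|, using that p is real. Each term contains the factor
r̄_i + 2iy - r_i of norm 2|y - Im r_i| ≤ 2|x + iy - r_i|, and these bounds multiply to 2^k |p(x +
iy)|. All other factors are at most `B`. Hence a resultant bounded below gives a bound from below
for |p| on the whole line. -/
theorem norm_lineResultant_le {k : ℕ} (a : Fin k → ℝ) (x y : ℝ) {B : ℝ}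
    (hB : 1 + 2 * (1 + ∑ i, |a i|) + 2 * |y| ≤ B) :
    ‖lineResultant a y‖ ≤
      2 ^ k * ‖(monicPoly fun i => (a i : ℂ)).eval (x + y * Complex.I)‖ * B ^ (k ^ 2) := by
  obtain ⟨r, hp, hr⟩ := exists_roots_monicPoly fun i => (a i : ℂ)
  have hroot : ∀ i, ‖r i‖ ≤ 1 + ∑ i, |a i| := by
    intro i
    have h := norm_root_le (a := fun i => (a i : ℂ)) (z := r i)
      (by rw [hp]; exact Finset.prod_eq_zero (Finset.mem_univ i) (sub_self _))
    simpa using h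
  have hS : 0 ≤ ∑ i, |a i| := Finset.sum_nonneg fun _ _ => abs_nonneg _
  have hB1 : 1 ≤ B := by have := abs_nonneg y; linarith
  have hconj : ∀ z, (starRingEnd ℂ) ((monicPoly fun i => (a i : ℂ)).eval z) =
      (monicPoly fun i => (a i : ℂ)).eval ((starRingEnd ℂ) z) := by
    intro z
    simp [eval_monicPoly]
  have h1 : ‖lineResultant a y‖ =
      ∏ i, ‖(monicPoly fun i => (a i : ℂ)).eval ((starRingEnd ℂ) (r i) + 2 * y * Complex.I)‖ := by
    rw [lineResultant, hr, norm_prod, Finset.prod_congr rfl fun i _ => norm_prod _ _,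
      Finset.prod_comm]
    refine Finset.prod_congr rfl fun m _ => ?_
    have h2 : (starRingEnd ℂ) (r m) + 2 * y * Complex.I =
        (starRingEnd ℂ) (r m - 2 * y * Complex.I) := by simp [Complex.conj_ofNat]
    rw [h2, ← hconj, RCLike.norm_conj, hp, norm_prod]
    refine Finset.prod_congr rfl fun i _ => ?_
    rw [← norm_neg]
    congr 1
    ring
  have h2 : ∀ i, ‖(monicPoly fun i => (a i : ℂ)).eval ((starRingEnd ℂ) (r i) + 2 * y * Complex.I)‖ ≤
      2 * ‖x + y * Complex.I - r i‖ * B ^ k := by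
    intro i
    rw [hp, ← Finset.mul_prod_erase _ _ (Finset.mem_univ i), norm_mul, norm_prod]
    have h3 : ‖(starRingEnd ℂ) (r i) + 2 * y * Complex.I - r i‖ ≤
        2 * ‖x + y * Complex.I - r i‖ := by
      have h4 : (starRingEnd ℂ) (r i) + 2 * y * Complex.I - r i =
          ((2 * (y - (r i).im) : ℝ) : ℂ) * Complex.I := by
        apply Complex.ext
        · simp
        · simp; ring
      rw [h4, norm_mul, Complex.norm_I, mul_one, Complex.norm_real, Real.norm_eq_abs, abs_mul,
        abs_of_pos (by norm_num : (0 : ℝ) < 2)]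
      gcongr
      refine (le_of_eq ?_).trans (Complex.abs_im_le_norm _)
      simp
    have h5 : ∏ m ∈ Finset.univ.erase i, ‖(starRingEnd ℂ) (r i) + 2 * y * Complex.I - r m‖ ≤
        B ^ k := by
      calc _ ≤ ∏ m ∈ Finset.univ.erase i, B := by
            refine Finset.prod_le_prod (fun _ _ => norm_nonneg _) fun m _ => ?_
            have h6 : ‖(starRingEnd ℂ) (r i) + 2 * y * Complex.I - r m‖ ≤
                ‖r i‖ + 2 * |y| + ‖r m‖ := by
              refine (norm_sub_le _ _).trans ?_
              gcongr
              refine (norm_add_le _ _).trans ?_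
              simp
            have := hroot i
            have := hroot m
            linarith
        _ ≤ B ^ k := by
            rw [Finset.prod_const]
            refine pow_le_pow_right₀ hB1 ((Finset.card_le_univ _).trans (by simp))
    gcongr
  calc ‖lineResultant a y‖ ≤ ∏ i, 2 * ‖x + y * Complex.I - r i‖ * B ^ k := by
        rw [h1]
        exact Finset.prod_le_prod (fun _ _ => norm_nonneg _) fun i _ => h2 i
    _ = _ := by
        rw [Finset.prod_mul_distrib, Finset.prod_mul_distrib, hp, norm_prod]
        simp [sq, pow_mul]

theorem norm_eval_monicPoly_conj {k : ℕ} (a : Fin k → ℝ) (x y : ℝ) :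
    ‖(monicPoly fun i => (a i : ℂ)).eval (x + (-y : ℝ) * Complex.I)‖ =
      ‖(monicPoly fun i => (a i : ℂ)).eval (x + y * Complex.I)‖ := by
  rw [← RCLike.norm_conj]
  congr 1
  simp [eval_monicPoly]

end LineResultant

/-! ### Divided differences of a monic polynomial. -/

section DividedDifference

/-- The coefficients of the divided difference of the monic polynomial with coefficients `a`. -/
noncomputable def dividedCoeff {R : Type*} [CommRing R] {k : ℕ} (a : Fin k → R) (z : R)
    (i : Fin k) : R :=
  z ^ (k - 1 - (i : ℕ)) + ∑ m : Fin k, if (i : ℕ) < m then a m * z ^ ((m : ℕ) - 1 - i) else 0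

/-- This turns Cauchy's formula into division: P(t)/(P(z)(z - t)) differs from 1/(z - t) by a
polynomial in t of degree less than k, which supplies the remainder. -/
theorem eval_monicPoly_sub {R : Type*} [CommRing R] {k : ℕ} (a : Fin k → R) (z t : R) :
    (monicPoly a).eval z - (monicPoly a).eval t =
      (z - t) * ∑ i, dividedCoeff a z i * t ^ (i : ℕ) := by
  have hpow : ∀ m ≤ k, z ^ m - t ^ m =
      (z - t) * ∑ i : Fin k, if (i : ℕ) < m then z ^ (m - 1 - (i : ℕ)) * t ^ (i : ℕ) else 0 := by
    intro m hm
    rw [Fin.sum_univ_eq_sum_range (fun i => if i < m then z ^ (m - 1 - i) * t ^ i else 0) k,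
      ← Finset.sum_filter]
    have h1 : (Finset.range k).filter (fun i => i < m) = Finset.range m := by
      ext i
      simp only [Finset.mem_filter, Finset.mem_range]
      lia
    have h2 := geom_sum₂_mul t z m
    rw [h1, Finset.sum_congr rfl fun i _ => mul_comm (z ^ (m - 1 - i)) (t ^ i)]
    linear_combination h2
  rw [eval_monicPoly, eval_monicPoly]
  have h1 : ∑ i, dividedCoeff a z i * t ^ (i : ℕ) =
      (∑ i : Fin k, if (i : ℕ) < k then z ^ (k - 1 - (i : ℕ)) * t ^ (i : ℕ) else 0) +
        ∑ m : Fin k, a m * ∑ i : Fin k,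
          if (i : ℕ) < m then z ^ ((m : ℕ) - 1 - (i : ℕ)) * t ^ (i : ℕ) else 0 := by
    simp_rw [Finset.mul_sum]
    rw [Finset.sum_comm, ← Finset.sum_add_distrib]
    refine Finset.sum_congr rfl fun i _ => ?_
    rw [if_pos i.2, dividedCoeff, add_mul, Finset.sum_mul]
    congr 1
    refine Finset.sum_congr rfl fun m _ => ?_
    split_ifs <;> ring
  rw [h1, mul_add, ← hpow k le_rfl, Finset.mul_sum]
  have h2 : ∀ m : Fin k, (z - t) * (a m * ∑ i : Fin k,
      if (i : ℕ) < m then z ^ ((m : ℕ) - 1 - (i : ℕ)) * t ^ (i : ℕ) else 0) =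
      a m * z ^ (m : ℕ) - a m * t ^ (m : ℕ) := by
    intro m
    rw [mul_left_comm, ← hpow m m.2.le]
    ring
  simp_rw [h2, Finset.sum_sub_distrib]
  ring

end DividedDifference

/-! ### Kernels for real division: weights of the lines, inverse of the polynomial, Cauchy kernel,
exponential. -/

section RealKernels

open Function

variable {D : Type*} [NormedAddCommGroup D] [NormedSpace ℝ D]

theorem hasTemperateGrowth_eval_mvPolynomial {ι : Type*} (p : MvPolynomial ι ℂ) {f : D → ι → ℂ}
    (hf : ∀ i, Function.HasTemperateGrowth fun x => f x i) :
    Function.HasTemperateGrowth fun x => MvPolynomial.eval (f x) p := by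
  induction p using MvPolynomial.induction_on with
  | C a => simp
  | add p q hp hq => simp only [map_add]; fun_prop
  | mul_X p i hp =>
    simp only [map_mul, MvPolynomial.eval_X]
    exact hp.mul (hf i)

theorem hasTemperateGrowth_dividedCoeff {k : ℕ} {a : D → Fin k → ℂ} {z : D → ℂ} (i : Fin k)
    (ha : ∀ i, Function.HasTemperateGrowth fun x => a x i) (hz : z.HasTemperateGrowth) :
    Function.HasTemperateGrowth fun x => dividedCoeff (a x) (z x) i := by
  unfold dividedCoeff
  refine (hz.pow _).add (Function.HasTemperateGrowth.sum fun m _ => ?_)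
  split_ifs
  · exact (ha m).mul (hz.pow _)
  · exact .zero

theorem hasTemperateGrowth_eval_monicPoly {k : ℕ} {a : D → Fin k → ℂ} {z : D → ℂ}
    (ha : ∀ i, Function.HasTemperateGrowth fun x => a x i) (hz : z.HasTemperateGrowth) :
    Function.HasTemperateGrowth fun x => (monicPoly (a x)).eval (z x) := by
  simp only [eval_monicPoly]
  exact (hz.pow _).add (Function.HasTemperateGrowth.sum fun m _ => (ha m).mul (hz.pow _))

/-- The inverse of the spacing of the heights of the lines used at frequency `τ`. -/
noncomputable def lineDensity (k : ℕ) (τ : ℝ) : ℝ := (k ^ 2 + 1 : ℕ) * (1 + τ ^ 2)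

theorem one_le_lineDensity (k : ℕ) (τ : ℝ) : 1 ≤ lineDensity k τ := by
  unfold lineDensity
  have h1 : (1 : ℝ) ≤ (k ^ 2 + 1 : ℕ) := by exact_mod_cast Nat.le_add_left 1 _
  nlinarith [sq_nonneg τ]

@[fun_prop]
theorem hasTemperateGrowth_lineDensity (k : ℕ) : Function.HasTemperateGrowth (lineDensity k) := by
  unfold lineDensity
  fun_prop

/-- The heights of the lines used at frequency `τ`. -/
noncomputable def lineHeight (k : ℕ) (j : Fin (k ^ 2 + 1)) (τ : ℝ) : ℝ :=
  ((j : ℕ) + 1 : ℝ) * (lineDensity k τ)⁻¹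

@[fun_prop]
theorem hasTemperateGrowth_lineHeight (k : ℕ) (j : Fin (k ^ 2 + 1)) :
    Function.HasTemperateGrowth (lineHeight k j) := by
  have := (hasTemperateGrowth_lineDensity k).inv_of_one_le (one_le_lineDensity k)
  unfold lineHeight
  fun_prop

theorem lineHeight_pos (k : ℕ) (j : Fin (k ^ 2 + 1)) (τ : ℝ) : 0 < lineHeight k j τ := by
  have := one_le_lineDensity k τ
  unfold lineHeight
  positivity

theorem lineHeight_mul_le (k : ℕ) (j : Fin (k ^ 2 + 1)) (τ : ℝ) :
    lineHeight k j τ * (1 + τ ^ 2) ≤ 1 := by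
  have h1 : ((j : ℕ) + 1 : ℝ) ≤ (k ^ 2 + 1 : ℕ) := by exact_mod_cast j.2
  have h2 : (0 : ℝ) < (k ^ 2 + 1 : ℕ) := by positivity
  rw [lineHeight, lineDensity]
  field_simp
  exact h1

theorem one_le_lineDensity_mul_lineHeight (k : ℕ) (j : Fin (k ^ 2 + 1)) (τ : ℝ) :
    1 ≤ lineDensity k τ * lineHeight k j τ := by
  have := one_le_lineDensity k τ
  rw [lineHeight, mul_left_comm, mul_inv_cancel₀ (by linarith), mul_one]
  linarith [(Nat.cast_nonneg (j : ℕ) : (0 : ℝ) ≤ (j : ℕ))]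

theorem lineHeight_le_one (k : ℕ) (j : Fin (k ^ 2 + 1)) (τ : ℝ) : lineHeight k j τ ≤ 1 := by
  nlinarith [lineHeight_mul_le k j τ, lineHeight_pos k j τ, sq_nonneg τ]

theorem abs_mul_lineHeight_le_one (k : ℕ) (j : Fin (k ^ 2 + 1)) (τ : ℝ) :
    |τ| * lineHeight k j τ ≤ 1 := by
  have h1 : |τ| ≤ 1 + τ ^ 2 := by nlinarith [sq_abs τ, sq_nonneg (|τ| - 1), abs_nonneg τ]
  nlinarith [lineHeight_mul_le k j τ, lineHeight_pos k j τ]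

/-- The unnormalized weight of the `j`-th line: it vanishes if the monic polynomial with
coefficients `a` has a root close to that line. -/
noncomputable def lineWeight {k : ℕ} (j : Fin (k ^ 2 + 1)) (τ : ℝ) (a : Fin k → ℝ) : ℝ :=
  smoothStep (lineDensity k τ ^ (2 * k ^ 2) * ‖lineResultant a (lineHeight k j τ)‖ ^ 2)

theorem hasTemperateGrowth_lineWeight {k : ℕ} (j : Fin (k ^ 2 + 1)) {τ : D → ℝ}
    {a : D → Fin k → ℝ} (hτ : τ.HasTemperateGrowth)
    (ha : ∀ i, Function.HasTemperateGrowth fun x => a x i) :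
    Function.HasTemperateGrowth fun x => lineWeight j (τ x) (a x) := by
  unfold lineWeight lineResultant
  have h1 : Function.HasTemperateGrowth fun x => MvPolynomial.eval
      (fun o : Option (Fin k) => o.elim (2 * (lineHeight k j (τ x) : ℂ) * Complex.I)
        fun i => (a x i : ℂ)) (shiftResultant k) := by
    refine hasTemperateGrowth_eval_mvPolynomial _ fun o => ?_
    rcases o with _ | i
    · simp only [Option.elim_none]
      have h2 : Function.HasTemperateGrowth fun x => ((lineHeight k j (τ x) : ℝ) : ℂ) :=
        Complex.hasTemperateGrowth_ofReal.comp_fun (by fun_prop)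
      fun_prop
    · simp only [Option.elim_some]
      exact Complex.hasTemperateGrowth_ofReal.comp_fun (ha i)
  have h2 := (hasTemperateGrowth_norm_sq ℂ).comp_fun h1
  exact hasTemperateGrowth_smoothStep.comp_fun
    (((hasTemperateGrowth_lineDensity k).comp_fun hτ |>.pow _).mul h2)

/-- With δ the inverse of the density, some height has a resultant of norm at least δ^(k²), and the
normalization in `lineWeight` makes its weight equal to 1. The weights can therefore be normalized
to a partition of unity. -/
theorem one_le_sum_lineWeight {k : ℕ} (τ : ℝ) (a : Fin k → ℝ) : 1 ≤ ∑ j, lineWeight j τ a := by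
  have hℓ := one_le_lineDensity k τ
  obtain ⟨j, hj⟩ := exists_le_norm_lineResultant a (δ := (lineDensity k τ)⁻¹) (by positivity)
  have h1 : lineWeight j τ a = 1 := by
    refine smoothStep_eq_one (le_trans ?_ (le_abs_self _))
    have h2 : 1 ≤ lineDensity k τ ^ (k ^ 2) * ‖lineResultant a (lineHeight k j τ)‖ := by
      refine le_trans (le_of_eq ?_) (mul_le_mul_of_nonneg_left hj (by positivity))
      rw [inv_pow, mul_inv_cancel₀ (by positivity)]
    calc (1 : ℝ) ≤ (lineDensity k τ ^ (k ^ 2) * ‖lineResultant a (lineHeight k j τ)‖) ^ 2 :=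
          one_le_pow₀ h2
      _ = _ := by rw [mul_pow, ← pow_mul, mul_comm (k ^ 2) 2]
  rw [← h1]
  exact Finset.single_le_sum (f := fun j => lineWeight j τ a) (fun _ _ => smoothStep_nonneg _)
    (Finset.mem_univ j)

/-- A majorant of `1 / ‖P‖ ^ 2` on the lines that have a nonzero weight. -/
noncomputable def lineMajorant {k : ℕ} (τ : ℝ) (a : Fin k → ℝ) : ℝ :=
  2 * 4 ^ k * (5 + 2 * ∑ i, (1 + a i ^ 2)) ^ (2 * k ^ 2) * lineDensity k τ ^ (2 * k ^ 2)

theorem hasTemperateGrowth_lineMajorant {k : ℕ} {τ : D → ℝ}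
    {a : D → Fin k → ℝ} (hτ : τ.HasTemperateGrowth)
    (ha : ∀ i, Function.HasTemperateGrowth fun x => a x i) :
    Function.HasTemperateGrowth fun x => lineMajorant (τ x) (a x) := by
  unfold lineMajorant
  have h1 : Function.HasTemperateGrowth fun x => ∑ i, (1 + a x i ^ 2) :=
    Function.HasTemperateGrowth.sum fun i _ => (Function.HasTemperateGrowth.const 1).add
      ((ha i).pow 2)
  fun_prop

/-- A nonzero weight forces the argument of the step function to be at least 1/2. Squaring
`norm_lineResultant_le` then bounds |P| below on the line, uniformly in x; the factors 2 and 4^k of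
the majorant come from the 1/2 and from (2^k)². -/
theorem one_le_lineMajorant_mul {k : ℕ} (j : Fin (k ^ 2 + 1)) {τ : ℝ} {a : Fin k → ℝ}
    (h : lineWeight j τ a ≠ 0) (x : ℝ) : 1 ≤ lineMajorant τ a *
      ‖(monicPoly fun i => (a i : ℂ)).eval (x + lineHeight k j τ * Complex.I)‖ ^ 2 := by
  have hℓ := one_le_lineDensity k τ
  have h1 := half_le_of_smoothStep_ne_zero h
  rw [abs_of_nonneg (by positivity)] at h1
  have hB : 1 + 2 * (1 + ∑ i, |a i|) + 2 * |lineHeight k j τ| ≤ 5 + 2 * ∑ i, (1 + a i ^ 2) := by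
    have h2 : ∑ i, |a i| ≤ ∑ i, (1 + a i ^ 2) := Finset.sum_le_sum fun i _ => by
      nlinarith [sq_abs (a i), sq_nonneg (|a i| - 1), abs_nonneg (a i)]
    rw [abs_of_pos (lineHeight_pos k j τ)]
    linarith [lineHeight_le_one k j τ]
  have h2 := norm_lineResultant_le a x (lineHeight k j τ) hB
  have h3 := pow_le_pow_left₀ (norm_nonneg _) h2 2
  set N := ‖(monicPoly fun i => (a i : ℂ)).eval (x + lineHeight k j τ * Complex.I)‖
  set B := 5 + 2 * ∑ i, (1 + a i ^ 2) with hBdef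
  have h4 : lineMajorant τ a * N ^ 2 =
      2 * (lineDensity k τ ^ (2 * k ^ 2) * (2 ^ k * N * B ^ (k ^ 2)) ^ 2) := by
    rw [lineMajorant, ← hBdef, mul_pow, mul_pow, ← pow_mul B, mul_comm (k ^ 2) 2,
      ← pow_mul 2 k 2, mul_comm k 2, pow_mul 2 2 k]
    norm_num
    ring
  rw [h4]
  have h5 : lineDensity k τ ^ (2 * k ^ 2) * ‖lineResultant a (lineHeight k j τ)‖ ^ 2 ≤
      lineDensity k τ ^ (2 * k ^ 2) * (2 ^ k * N * B ^ (k ^ 2)) ^ 2 := by gcongr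
  linarith

/-- The weight of the `j`-th line divided by the value of the polynomial on this line (for `s = 1`)
or on its conjugate (for `s = -1`). -/
noncomputable def weightedInv {k : ℕ} (j : Fin (k ^ 2 + 1)) (s τ x : ℝ) (a : Fin k → ℝ) : ℂ :=
  (lineWeight j τ a * (∑ j, lineWeight j τ a)⁻¹ * lineMajorant τ a *
    smoothInv (lineMajorant τ a *
      ‖(monicPoly fun i => (a i : ℂ)).eval (x + lineHeight k j τ * Complex.I)‖ ^ 2) : ℝ) *
  (monicPoly fun i => (a i : ℂ)).eval (x + (-s * lineHeight k j τ : ℝ) * Complex.I)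

theorem hasTemperateGrowth_weightedInv {k : ℕ} (j : Fin (k ^ 2 + 1)) (s : ℝ) {τ x : D → ℝ}
    {a : D → Fin k → ℝ} (hτ : τ.HasTemperateGrowth) (hx : x.HasTemperateGrowth)
    (ha : ∀ i, Function.HasTemperateGrowth fun p => a p i) :
    Function.HasTemperateGrowth fun p => weightedInv j s (τ p) (x p) (a p) := by
  unfold weightedInv
  have haC : ∀ i, Function.HasTemperateGrowth fun p => (a p i : ℂ) := fun i =>
    Complex.hasTemperateGrowth_ofReal.comp_fun (ha i)
  have hxC := Complex.hasTemperateGrowth_ofReal.comp_fun hx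
  have h1 : ∀ c : ℝ, Function.HasTemperateGrowth fun p => (monicPoly fun i => (a p i : ℂ)).eval
      (x p + (c * lineHeight k j (τ p) : ℝ) * Complex.I) := fun c => by
    have h2 : Function.HasTemperateGrowth fun p => ((c * lineHeight k j (τ p) : ℝ) : ℂ) :=
      Complex.hasTemperateGrowth_ofReal.comp_fun (by fun_prop)
    exact hasTemperateGrowth_eval_monicPoly haC (by fun_prop)
  have h2 := (hasTemperateGrowth_norm_sq ℂ).comp_fun (h1 1)
  simp only [one_mul] at h2
  have h3 : Function.HasTemperateGrowth fun p => (∑ j, lineWeight j (τ p) (a p))⁻¹ :=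
    Function.HasTemperateGrowth.inv_of_one_le
      (Function.HasTemperateGrowth.sum fun j _ => hasTemperateGrowth_lineWeight j hτ ha)
      fun p => one_le_sum_lineWeight _ _
  have h4 := hasTemperateGrowth_lineMajorant hτ ha
  have h5 := hasTemperateGrowth_lineWeight j hτ ha
  have h6 := hasTemperateGrowth_smoothInv.comp_fun (h4.mul h2)
  exact (Complex.hasTemperateGrowth_ofReal.comp_fun (((h5.mul h3).mul h4).mul h6)).mul (h1 (-s))

/-- The inverse is written as 1/P = P̄/|P|². As P is real, P̄ is the value on the conjugate line.
Where the weight is nonzero the argument of `smoothInv` is at least 1, so it is the true inverse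
there. -/
theorem weightedInv_mul_eval {k : ℕ} (j : Fin (k ^ 2 + 1)) {s : ℝ} (hs : s = 1 ∨ s = -1) (τ x : ℝ)
    (a : Fin k → ℝ) : weightedInv j s τ x a *
      (monicPoly fun i => (a i : ℂ)).eval (x + (s * lineHeight k j τ : ℝ) * Complex.I) =
      (lineWeight j τ a * (∑ j, lineWeight j τ a)⁻¹ : ℝ) := by
  by_cases h : lineWeight j τ a = 0
  · simp [weightedInv, h]
  have h1 := one_le_lineMajorant_mul j h x
  have hprod : (monicPoly fun i => (a i : ℂ)).eval (x + (-s * lineHeight k j τ : ℝ) * Complex.I) *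
      (monicPoly fun i => (a i : ℂ)).eval (x + (s * lineHeight k j τ : ℝ) * Complex.I) =
      ((‖(monicPoly fun i => (a i : ℂ)).eval (x + lineHeight k j τ * Complex.I)‖ ^ 2 : ℝ) : ℂ) := by
    have h2 : (monicPoly fun i => (a i : ℂ)).eval (x + (-s * lineHeight k j τ : ℝ) * Complex.I) =
        (starRingEnd ℂ) ((monicPoly fun i => (a i : ℂ)).eval
          (x + (s * lineHeight k j τ : ℝ) * Complex.I)) := by
      simp [eval_monicPoly]
    rw [h2, RCLike.conj_mul]
    have h3 : ‖(monicPoly fun i => (a i : ℂ)).eval (x + (s * lineHeight k j τ : ℝ) * Complex.I)‖ =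
        ‖(monicPoly fun i => (a i : ℂ)).eval (x + lineHeight k j τ * Complex.I)‖ := by
      rcases hs with rfl | rfl
      · rw [one_mul]
      · rw [neg_one_mul, norm_eval_monicPoly_conj]
    rw [h3]
    push_cast
    rfl
  rw [weightedInv, mul_assoc, hprod, ← Complex.ofReal_mul, smoothInv_eq (by rwa [abs_of_nonneg
    (by linarith)])]
  congr 1
  have h2 : lineMajorant τ a *
      ‖(monicPoly fun i => (a i : ℂ)).eval (x + lineHeight k j τ * Complex.I)‖ ^ 2 ≠ 0 := by
    linarith
  rw [mul_assoc, mul_assoc _ (lineMajorant τ a)]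
  have h3 := inv_mul_cancel₀ h2
  linear_combination (lineWeight j τ a * (∑ j, lineWeight j τ a)⁻¹) * h3

/-- The Cauchy kernel on the `j`-th line. -/
noncomputable def lineCauchy (k : ℕ) (j : Fin (k ^ 2 + 1)) (s τ x t : ℝ) : ℂ :=
  (lineDensity k τ ^ 2 *
    (lineDensity k τ ^ 2 * ((x - t) ^ 2 + lineHeight k j τ ^ 2))⁻¹ : ℝ) *
    ((x - t : ℝ) - (s * lineHeight k j τ : ℝ) * Complex.I)

/-- The factor ℓ² in `lineCauchy` serves to make the inverted quantity at least 1, which gives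
temperate growth although the heights tend to 0 at high frequency. -/
theorem one_le_lineCauchy_aux (k : ℕ) (j : Fin (k ^ 2 + 1)) (τ x t : ℝ) :
    1 ≤ lineDensity k τ ^ 2 * ((x - t) ^ 2 + lineHeight k j τ ^ 2) := by
  have h1 := one_le_pow₀ (one_le_lineDensity_mul_lineHeight k j τ) (n := 2)
  rw [mul_pow] at h1
  nlinarith [sq_nonneg (lineDensity k τ * (x - t))]

theorem hasTemperateGrowth_lineCauchy (k : ℕ) (j : Fin (k ^ 2 + 1)) (s : ℝ) {τ x t : D → ℝ}
    (hτ : τ.HasTemperateGrowth) (hx : x.HasTemperateGrowth) (ht : t.HasTemperateGrowth) :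
    Function.HasTemperateGrowth fun p => lineCauchy k j s (τ p) (x p) (t p) := by
  unfold lineCauchy
  have h1 : Function.HasTemperateGrowth fun p =>
      (lineDensity k (τ p) ^ 2 * ((x p - t p) ^ 2 + lineHeight k j (τ p) ^ 2))⁻¹ :=
    Function.HasTemperateGrowth.inv_of_one_le (by fun_prop) fun p => one_le_lineCauchy_aux _ _ _ _ _
  have h2 : Function.HasTemperateGrowth fun p => (((x p - t p : ℝ)) : ℂ) :=
    Complex.hasTemperateGrowth_ofReal.comp_fun (by fun_prop)
  have h3 : Function.HasTemperateGrowth fun p => ((s * lineHeight k j (τ p) : ℝ) : ℂ) :=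
    Complex.hasTemperateGrowth_ofReal.comp_fun (by fun_prop)
  refine (Complex.hasTemperateGrowth_ofReal.comp_fun ?_).mul ?_
  · fun_prop
  · fun_prop

theorem lineCauchy_eq (k : ℕ) (j : Fin (k ^ 2 + 1)) {s : ℝ} (hs : s = 1 ∨ s = -1) (τ x t : ℝ) :
    lineCauchy k j s τ x t = 1 / (x + (s * lineHeight k j τ : ℝ) * Complex.I - t) := by
  have hh := lineHeight_pos k j τ
  have hℓ := one_le_lineDensity k τ
  have hs2 : s ^ 2 = 1 := by rcases hs with rfl | rfl <;> norm_num
  have h0 : s * lineHeight k j τ ≠ 0 := by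
    rcases hs with rfl | rfl
    · simpa using hh.ne'
    · simpa using hh.ne'
  rw [eq_div_iff (add_mul_I_sub_ne_zero h0), lineCauchy]
  have h1 : lineDensity k τ ^ 2 *
      (lineDensity k τ ^ 2 * ((x - t) ^ 2 + lineHeight k j τ ^ 2))⁻¹ =
      ((x - t) ^ 2 + lineHeight k j τ ^ 2)⁻¹ := by
    have : (x - t) ^ 2 + lineHeight k j τ ^ 2 ≠ 0 := by positivity
    field_simp
  rw [h1]
  have h2 : (((x - t : ℝ) : ℂ) - (s * lineHeight k j τ : ℝ) * Complex.I) *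
      (x + (s * lineHeight k j τ : ℝ) * Complex.I - t) =
      (((x - t) ^ 2 + lineHeight k j τ ^ 2 : ℝ) : ℂ) := by
    push_cast
    have hs3 : (s : ℂ) ^ 2 = 1 := by exact_mod_cast hs2
    linear_combination (-(s : ℂ) ^ 2 * (lineHeight k j τ) ^ 2) * Complex.I_sq +
      (lineHeight k j τ : ℂ) ^ 2 * hs3
  rw [mul_assoc, h2, ← Complex.ofReal_mul, inv_mul_cancel₀ (by positivity), Complex.ofReal_one]

/-- The factor of `exp (2πiτζ - ζ²)` on the `j`-th line other than `exp (-x²)`. -/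
noncomputable def lineExp (k : ℕ) (j : Fin (k ^ 2 + 1)) (s τ x : ℝ) : ℂ :=
  Complex.exp ((2 * Real.pi * τ * x - 2 * s * lineHeight k j τ * x : ℝ) * Complex.I) *
    (cutExp (-2 * Real.pi * τ * s * lineHeight k j τ) * cutExp (lineHeight k j τ ^ 2) : ℝ)

theorem hasTemperateGrowth_lineExp (k : ℕ) (j : Fin (k ^ 2 + 1)) (s : ℝ) {τ x : D → ℝ}
    (hτ : τ.HasTemperateGrowth) (hx : x.HasTemperateGrowth) :
    Function.HasTemperateGrowth fun p => lineExp k j s (τ p) (x p) := by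
  unfold lineExp
  refine (hasTemperateGrowth_cexp_ofReal_mul_I.comp_fun
    (f := fun p => 2 * Real.pi * τ p * x p - 2 * s * lineHeight k j (τ p) * x p) (by fun_prop)).mul
    (Complex.hasTemperateGrowth_ofReal.comp_fun (by fun_prop))

/-- The heights shrink like 1/(1 + τ²), so the real exponent 2πτy stays below 2π < 7 in absolute
value. The cutoff inside `cutExp` is then invisible, while it ensures temperate growth. -/
theorem exp_mul_lineExp (k : ℕ) (j : Fin (k ^ 2 + 1)) {s : ℝ} (hs : s = 1 ∨ s = -1) (τ x : ℝ) :
    (Real.exp (-x ^ 2) : ℂ) * lineExp k j s τ x =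
      Complex.exp (2 * Real.pi * Complex.I * τ * (x + (s * lineHeight k j τ : ℝ) * Complex.I) -
        (x + (s * lineHeight k j τ : ℝ) * Complex.I) ^ 2) := by
  have hh := lineHeight_pos k j τ
  have hs2 : (s : ℂ) ^ 2 = 1 := by rcases hs with rfl | rfl <;> norm_num
  have h1 : |-2 * Real.pi * τ * s * lineHeight k j τ| ≤ 7 := by
    have h2 : |s| = 1 := by rcases hs with rfl | rfl <;> norm_num
    have h3 : |-2 * Real.pi * τ * s * lineHeight k j τ| =
        2 * Real.pi * (|τ| * lineHeight k j τ) := by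
      rw [abs_mul, abs_mul, abs_mul, abs_mul, h2, abs_of_pos hh, abs_of_pos Real.pi_pos]
      norm_num
      ring
    rw [h3]
    have h4 := abs_mul_lineHeight_le_one k j τ
    nlinarith [Real.pi_lt_d2, Real.pi_pos]
  have h2 : |lineHeight k j τ ^ 2| ≤ 7 := by
    rw [abs_of_nonneg (by positivity)]
    nlinarith [lineHeight_le_one k j τ]
  rw [lineExp, cutExp_eq h1, cutExp_eq h2]
  push_cast
  rw [← Complex.exp_add, ← Complex.exp_add, ← Complex.exp_add]
  congr 1
  linear_combination (-2 * Real.pi * τ * s * lineHeight k j τ +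
      s ^ 2 * (lineHeight k j τ : ℂ) ^ 2) * Complex.I_sq -
    (lineHeight k j τ : ℂ) ^ 2 * hs2

end RealKernels

/-! ### Division of Schwartz functions with a Gaussian factor. -/

section RealDivision

open MeasureTheory Function FourierTransform

theorem integrable_exp_neg_sq_mul_one_add_norm_pow (N : ℕ) :
    Integrable fun x : ℝ => Real.exp (-x ^ 2) * (1 + ‖x‖) ^ N := by
  have h : ∀ n : ℕ, Integrable fun x : ℝ => Real.exp (-x ^ 2) * ‖x‖ ^ n := by
    intro n
    have h1 := (integrable_rpow_mul_exp_neg_mul_sq (b := 1) one_pos (s := n)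
      (by have := (Nat.cast_nonneg n : (0 : ℝ) ≤ n); linarith)).norm
    refine h1.congr (ae_of_all _ fun x => ?_)
    simp only [norm_mul, Real.rpow_natCast, norm_pow, Real.norm_eq_abs, Real.abs_exp]
    rw [neg_one_mul, mul_comm]
  refine ((h 0).add (h N)).const_mul (2 ^ (N - 1)) |>.mono'
    (by fun_prop) (ae_of_all _ fun x => ?_)
  rw [Real.norm_of_nonneg (by positivity)]
  have h1 := add_pow_le zero_le_one (norm_nonneg x) N
  rw [one_pow] at h1
  calc _ ≤ Real.exp (-x ^ 2) * (2 ^ (N - 1) * (1 + ‖x‖ ^ N)) := by gcongr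
    _ = _ := by simp only [Pi.add_apply]; ring

theorem SchwartzMap.integrable_norm_mul_one_add_norm_pow {V : Type*} [NormedAddCommGroup V]
    [NormedSpace ℝ V] [MeasurableSpace V] [BorelSpace V] [SecondCountableTopology V]
    {μ : Measure V} [μ.HasTemperateGrowth] (ψ : SchwartzMap V ℂ) (N : ℕ) :
    Integrable (fun v => ‖ψ v‖ * (1 + ‖v‖) ^ N) μ := by
  refine ((ψ.integrable_pow_mul μ 0).add (ψ.integrable_pow_mul μ N)).const_mul (2 ^ (N - 1))
    |>.mono' ?_ (ae_of_all _ fun v => ?_)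
  · exact (ψ.continuous.norm.mul (by fun_prop)).aestronglyMeasurable
  · rw [Real.norm_of_nonneg (by positivity)]
    have h1 := add_pow_le zero_le_one (norm_nonneg v) N
    rw [one_pow] at h1
    calc _ ≤ ‖ψ v‖ * (2 ^ (N - 1) * (1 + ‖v‖ ^ N)) := by gcongr
      _ = _ := by simp only [Pi.add_apply]; ring

/-- The weight `ψ(v) exp(-x²)`. -/
noncomputable def gaussWeight {V : Type*} (ψ : V → ℂ) (w : V × ℝ) : ℂ :=
  ψ w.1 * (Real.exp (-w.2 ^ 2) : ℂ)

theorem integrable_gaussWeight_mul {V : Type*} [NormedAddCommGroup V]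
    [NormedSpace ℝ V] [MeasurableSpace V] [BorelSpace V] [SecondCountableTopology V]
    {μ : Measure V} [SFinite μ] [μ.HasTemperateGrowth] (ψ : SchwartzMap V ℂ) (N : ℕ) :
    Integrable (fun w : V × ℝ => ‖gaussWeight ψ w‖ * (1 + ‖w‖) ^ N) (μ.prod volume) := by
  have h := (ψ.integrable_norm_mul_one_add_norm_pow (μ := μ) N).mul_prod
    (integrable_exp_neg_sq_mul_one_add_norm_pow N)
  refine h.mono' ?_ (ae_of_all _ fun w => ?_)
  · have hψ := ψ.continuous
    refine Continuous.aestronglyMeasurable ?_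
    unfold gaussWeight
    fun_prop
  · rw [Real.norm_of_nonneg (by positivity), gaussWeight, norm_mul, Complex.norm_real,
      Real.norm_of_nonneg (Real.exp_pos _).le]
    have h1 : 1 + ‖w‖ ≤ (1 + ‖w.1‖) * (1 + ‖w.2‖) := by
      have : ‖w‖ ≤ ‖w.1‖ + ‖w.2‖ := by
        rw [Prod.norm_def]
        exact max_le_add_of_nonneg (norm_nonneg _) (norm_nonneg _)
      nlinarith [mul_nonneg (norm_nonneg w.1) (norm_nonneg w.2)]
    calc _ ≤ ‖ψ w.1‖ * Real.exp (-w.2 ^ 2) * ((1 + ‖w.1‖) * (1 + ‖w.2‖)) ^ N := by gcongr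
      _ = _ := by rw [mul_pow]; ring

theorem integrable_exp_mul_lineExp_mul_lineCauchy (k : ℕ) (j : Fin (k ^ 2 + 1)) (s τ t : ℝ) :
    Integrable fun x : ℝ => (Real.exp (-x ^ 2) : ℂ) * (lineExp k j s τ x * lineCauchy k j s τ x t) := by
  have h := integrable_smul_temperate (W := ℝ) (E := ℝ) (μ := volume)
    (g := fun x : ℝ => (Real.exp (-x ^ 2) : ℂ))
    (Φ := fun p : ℝ × ℝ => lineExp k j s τ p.1 * lineCauchy k j s τ p.1 t) (by fun_prop)
    (fun N => ?_) ?_ 0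
  · exact h
  · simpa [-Complex.ofReal_exp, abs_of_pos (Real.exp_pos _)] using
      integrable_exp_neg_sq_mul_one_add_norm_pow N
  · have h1 : Function.HasTemperateGrowth fun p : ℝ × ℝ => p.1 :=
      (ContinuousLinearMap.fst ℝ ℝ ℝ).hasTemperateGrowth
    exact (hasTemperateGrowth_lineExp k j s (.const τ) h1).mul
      (hasTemperateGrowth_lineCauchy k j s (.const τ) h1 (.const t))

/-- The value is independent of the line `j`, so it survives averaging with weights of sum 1. -/
theorem integral_lineExp_sub_integral_lineExp (k : ℕ) (j : Fin (k ^ 2 + 1)) (τ t : ℝ) :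
    (∫ x : ℝ, (Real.exp (-x ^ 2) : ℂ) * (lineExp k j (-1) τ x * lineCauchy k j (-1) τ x t)) -
      (∫ x : ℝ, (Real.exp (-x ^ 2) : ℂ) * (lineExp k j 1 τ x * lineCauchy k j 1 τ x t)) =
    2 * Real.pi * Complex.I * Complex.exp (2 * Real.pi * Complex.I * τ * t - t ^ 2) := by
  have hy := lineHeight_pos k j τ
  set f : ℂ → ℂ := fun z => Complex.exp (2 * Real.pi * Complex.I * τ * z - z ^ 2) with hf
  have hfd : Differentiable ℂ f := by fun_prop
  have heq : ∀ s : ℝ, s = 1 ∨ s = -1 →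
      (fun x : ℝ => (Real.exp (-x ^ 2) : ℂ) * (lineExp k j s τ x * lineCauchy k j s τ x t)) =
      fun x : ℝ => f (x + (s * lineHeight k j τ : ℝ) * Complex.I) /
        (x + (s * lineHeight k j τ : ℝ) * Complex.I - t) := by
    intro s hs
    funext x
    rw [← mul_assoc, exp_mul_lineExp k j hs, lineCauchy_eq k j hs, mul_one_div]
  have hi := fun s => integrable_exp_mul_lineExp_mul_lineCauchy k j s τ t
  have hi1 := hi 1
  have hi2 := hi (-1)
  rw [heq 1 (Or.inl rfl)] at hi1 ⊢
  rw [heq (-1) (Or.inr rfl)] at hi2 ⊢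
  simp only [one_mul, neg_one_mul] at hi1 hi2 ⊢
  refine integral_line_sub_integral_line hfd hy
    (B := Real.exp (2 * Real.pi * |τ| * lineHeight k j τ + lineHeight k j τ ^ 2)) ?_ t hi2 hi1
  intro x v hv
  rw [hf, Complex.norm_exp]
  refine Real.exp_le_exp.2 ?_
  have h1 : (2 * Real.pi * Complex.I * τ * (x + v * Complex.I) - (x + v * Complex.I) ^ 2 : ℂ).re =
      2 * Real.pi * -(τ * v) + v ^ 2 - x ^ 2 := by
    simp [sq]
    ring
  rw [h1]
  have h2 : -(τ * v) ≤ |τ| * lineHeight k j τ := by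
    refine (neg_le_abs _).trans ?_
    rw [abs_mul]
    gcongr
  have h3 : v ^ 2 ≤ lineHeight k j τ ^ 2 := sq_le_sq.2 (hv.trans (le_abs_self _))
  nlinarith [Real.pi_pos, sq_nonneg x, mul_le_mul_of_nonneg_left h2 Real.pi_pos.le]

/-- The factor `exp(2πi ∑ v_{i+1} u_i)` of `exp(2πi ⟨v, (t, u)⟩)`. -/
noncomputable def tailPhase {d : ℕ} (v : EuclideanSpace ℝ (Fin (d + 1))) (u : Fin d → ℝ) : ℂ :=
  Complex.exp ((2 * Real.pi * ∑ i : Fin d, v i.succ * u i : ℝ) * Complex.I)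

/-- By Fourier inversion the left side is a superposition of the entire functions exp(2πiτζ - ζ²) at
ζ = t. Each of them is divided by P through Cauchy's formula on weighted lines, and all kernels have
temperate growth in the frequency, the line variable and (t, u) together. Integrating them against
the Schwartz function 𝓕 φ and the Gaussian gives smooth quotient and remainder. -/
theorem exists_division_schwartz {k d : ℕ} (c : Fin k → ((Fin d → ℝ) →L[ℝ] ℝ))
    (φ : SchwartzMap (EuclideanSpace ℝ (Fin (d + 1))) ℂ) :
    ∃ (q : ℝ × (Fin d → ℝ) → ℂ) (r : Fin k → (Fin d → ℝ) → ℂ), ContDiff ℝ ∞ q ∧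
      (∀ i, ContDiff ℝ ∞ (r i)) ∧ ∀ (t : ℝ) (u : Fin d → ℝ),
        φ (WithLp.toLp 2 (Fin.cons t u)) * Real.exp (-t ^ 2) =
          q (t, u) * (t ^ k + ∑ i, c i u * t ^ (i : ℕ) : ℝ) + ∑ i, r i u * (t : ℂ) ^ (i : ℕ) := by
  set V := EuclideanSpace ℝ (Fin (d + 1)) with hV
  set ψ : SchwartzMap V ℂ := 𝓕 φ with hψ
  let D := (V × ℝ) × (ℝ × (Fin d → ℝ))
  -- the coordinates
  have hv : ∀ i, Function.HasTemperateGrowth fun p : D => p.1.1 i := fun i =>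
    ((EuclideanSpace.proj (𝕜 := ℝ) i).comp ((ContinuousLinearMap.fst ℝ V ℝ).comp
      (ContinuousLinearMap.fst ℝ (V × ℝ) (ℝ × (Fin d → ℝ))))).hasTemperateGrowth
  have hx : Function.HasTemperateGrowth fun p : D => p.1.2 :=
    ((ContinuousLinearMap.snd ℝ V ℝ).comp
      (ContinuousLinearMap.fst ℝ (V × ℝ) (ℝ × (Fin d → ℝ)))).hasTemperateGrowth
  have ht : Function.HasTemperateGrowth fun p : D => p.2.1 :=
    ((ContinuousLinearMap.fst ℝ ℝ (Fin d → ℝ)).comp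
      (ContinuousLinearMap.snd ℝ (V × ℝ) (ℝ × (Fin d → ℝ)))).hasTemperateGrowth
  have hu' : Function.HasTemperateGrowth fun p : D => p.2.2 :=
    ((ContinuousLinearMap.snd ℝ ℝ (Fin d → ℝ)).comp
      (ContinuousLinearMap.snd ℝ (V × ℝ) (ℝ × (Fin d → ℝ)))).hasTemperateGrowth
  have hu : ∀ i, Function.HasTemperateGrowth fun p : D => p.2.2 i := fun i =>
    (ContinuousLinearMap.proj (R := ℝ) (φ := fun _ : Fin d => ℝ) i).hasTemperateGrowth.comp_fun hu'
  have hc : ∀ i, Function.HasTemperateGrowth fun p : D => c i p.2.2 := fun i =>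
    (c i).hasTemperateGrowth.comp_fun hu'
  have hphase : Function.HasTemperateGrowth fun p : D => tailPhase p.1.1 p.2.2 := by
    unfold tailPhase
    refine hasTemperateGrowth_cexp_ofReal_mul_I.comp_fun ((Function.HasTemperateGrowth.const _).mul
      (Function.HasTemperateGrowth.sum fun i _ => (hv i.succ).mul (hu i)))
  -- the kernels
  let z : Fin (k ^ 2 + 1) → ℝ → D → ℂ := fun j s p =>
    p.1.2 + (s * lineHeight k j (p.1.1 0) : ℝ) * Complex.I
  let kQ : Fin (k ^ 2 + 1) → ℝ → D → ℂ := fun j s p => tailPhase p.1.1 p.2.2 *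
    (lineExp k j s (p.1.1 0) p.1.2 * (weightedInv j s (p.1.1 0) p.1.2 (fun i => c i p.2.2) *
      lineCauchy k j s (p.1.1 0) p.1.2 p.2.1))
  let kR : Fin k → Fin (k ^ 2 + 1) → ℝ → D → ℂ := fun i j s p => tailPhase p.1.1 p.2.2 *
    (lineExp k j s (p.1.1 0) p.1.2 * (weightedInv j s (p.1.1 0) p.1.2 (fun i => c i p.2.2) *
      dividedCoeff (fun i => (c i p.2.2 : ℂ)) (z j s p) i))
  have hkQ : ∀ j s, Function.HasTemperateGrowth (kQ j s) := fun j s =>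
    hphase.mul ((hasTemperateGrowth_lineExp k j s (hv 0) hx).mul
      ((hasTemperateGrowth_weightedInv j s (hv 0) hx hc).mul
        (hasTemperateGrowth_lineCauchy k j s (hv 0) hx ht)))
  have hz : ∀ j s, Function.HasTemperateGrowth (z j s) := fun j s => by
    have h1 := Complex.hasTemperateGrowth_ofReal.comp_fun hx
    have h2 := Complex.hasTemperateGrowth_ofReal.comp_fun
      ((Function.HasTemperateGrowth.const s).mul
        ((hasTemperateGrowth_lineHeight k j).comp_fun (hv 0)))
    exact h1.add (h2.mul (.const _))
  have hkR : ∀ i j s, Function.HasTemperateGrowth (kR i j s) := fun i j s =>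
    hphase.mul ((hasTemperateGrowth_lineExp k j s (hv 0) hx).mul
      ((hasTemperateGrowth_weightedInv j s (hv 0) hx hc).mul
        (hasTemperateGrowth_dividedCoeff i
          (fun i => Complex.hasTemperateGrowth_ofReal.comp_fun (hc i)) (hz j s))))
  -- Lower line minus upper line is the positively oriented boundary of the strip.
  let KQ : D → ℂ := fun p => (2 * Real.pi * Complex.I)⁻¹ * ∑ j, (kQ j (-1) p - kQ j 1 p)
  let KR : Fin k → D → ℂ := fun i p =>
    (2 * Real.pi * Complex.I)⁻¹ * ∑ j, (kR i j (-1) p - kR i j 1 p)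
  have hKQ : KQ.HasTemperateGrowth := (Function.HasTemperateGrowth.const _).mul
    (Function.HasTemperateGrowth.sum fun j _ => (hkQ j (-1)).sub (hkQ j 1))
  have hKR : ∀ i, (KR i).HasTemperateGrowth := fun i => (Function.HasTemperateGrowth.const _).mul
    (Function.HasTemperateGrowth.sum fun j _ => (hkR i j (-1)).sub (hkR i j 1))
  let μ : Measure (V × ℝ) := (volume : Measure V).prod volume
  have hgm : AEStronglyMeasurable (gaussWeight ψ) μ := by
    have := ψ.continuous
    refine Continuous.aestronglyMeasurable ?_
    unfold gaussWeight
    fun_prop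
  have hgi : ∀ N : ℕ, Integrable (fun w => ‖gaussWeight ψ w‖ * (1 + ‖w‖) ^ N) μ :=
    fun N => integrable_gaussWeight_mul ψ N
  -- The remainder kernels do not involve t, so they may be evaluated at t = 0.
  refine ⟨fun e => ∫ w, gaussWeight ψ w • KQ (w, e) ∂μ,
    fun i u => ∫ w, gaussWeight ψ w • KR i (w, (0, u)) ∂μ,
    contDiff_integral_smul_temperate hgm hgi hKQ,
    fun i => (contDiff_integral_smul_temperate hgm hgi (hKR i)).comp (by fun_prop),
    fun t u => ?_⟩
  -- the kernels add up
  have hsum : ∀ w : V × ℝ, KQ (w, (t, u)) * (t ^ k + ∑ i, c i u * t ^ (i : ℕ) : ℝ) +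
      ∑ i, KR i (w, (0, u)) * (t : ℂ) ^ (i : ℕ) = (2 * Real.pi * Complex.I)⁻¹ *
        (tailPhase w.1 u * ∑ j : Fin (k ^ 2 + 1),
          ((lineWeight j (w.1 0) (fun i => c i u) *
            (∑ j, lineWeight j (w.1 0) (fun i => c i u))⁻¹ : ℝ) : ℂ) *
          (lineExp k j (-1) (w.1 0) w.2 * lineCauchy k j (-1) (w.1 0) w.2 t -
            lineExp k j 1 (w.1 0) w.2 * lineCauchy k j 1 (w.1 0) w.2 t)) := by
    intro w
    have hpt : ((t ^ k + ∑ i, c i u * t ^ (i : ℕ) : ℝ) : ℂ) =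
        (monicPoly fun i => (c i u : ℂ)).eval (t : ℂ) := by
      rw [eval_monicPoly]; push_cast; rfl
    have h1 : ∀ j s, s = 1 ∨ s = -1 → kQ j s (w, (t, u)) *
        (t ^ k + ∑ i, c i u * t ^ (i : ℕ) : ℝ) + ∑ i, kR i j s (w, (0, u)) * (t : ℂ) ^ (i : ℕ) =
        tailPhase w.1 u * (((lineWeight j (w.1 0) (fun i => c i u) *
            (∑ j, lineWeight j (w.1 0) (fun i => c i u))⁻¹ : ℝ) : ℂ) *
          (lineExp k j s (w.1 0) w.2 * lineCauchy k j s (w.1 0) w.2 t)) := by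
      intro j s hs
      have h2 := weightedInv_mul_eval j hs (w.1 0) w.2 (fun i => c i u)
      have h3 := eval_monicPoly_sub (fun i => (c i u : ℂ))
        (w.2 + (s * lineHeight k j (w.1 0) : ℝ) * Complex.I) t
      have h4 : lineCauchy k j s (w.1 0) w.2 t *
          (w.2 + (s * lineHeight k j (w.1 0) : ℝ) * Complex.I - t) = 1 := by
        rw [lineCauchy_eq k j hs, one_div, inv_mul_cancel₀]
        refine add_mul_I_sub_ne_zero (mul_ne_zero ?_ (lineHeight_pos k j _).ne')
        rcases hs with rfl | rfl <;> norm_num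
      have h5 : ∑ i, kR i j s (w, (0, u)) * (t : ℂ) ^ (i : ℕ) = tailPhase w.1 u *
          (lineExp k j s (w.1 0) w.2 * (weightedInv j s (w.1 0) w.2 (fun i => c i u) *
            ∑ i, dividedCoeff (fun i => (c i u : ℂ))
              (w.2 + (s * lineHeight k j (w.1 0) : ℝ) * Complex.I) i * (t : ℂ) ^ (i : ℕ))) := by
        simp_rw [Finset.mul_sum]
        refine Finset.sum_congr rfl fun i _ => ?_
        simp only [kR, z]
        ring
      rw [h5, hpt, ← h2]
      simp only [kQ]
      set S := ∑ i, dividedCoeff (fun i => (c i u : ℂ))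
              (w.2 + (s * lineHeight k j (w.1 0) : ℝ) * Complex.I) i * (t : ℂ) ^ (i : ℕ)
      linear_combination (-tailPhase w.1 u * (lineExp k j s (w.1 0) w.2 *
        (weightedInv j s (w.1 0) w.2 (fun i => c i u) * lineCauchy k j s (w.1 0) w.2 t))) * h3 -
        (tailPhase w.1 u * (lineExp k j s (w.1 0) w.2 *
        (weightedInv j s (w.1 0) w.2 (fun i => c i u)))) * S * h4
    have h6 : ∑ i, KR i (w, (0, u)) * (t : ℂ) ^ (i : ℕ) = (2 * Real.pi * Complex.I)⁻¹ *
        ∑ j, (∑ i, kR i j (-1) (w, (0, u)) * (t : ℂ) ^ (i : ℕ) -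
          ∑ i, kR i j 1 (w, (0, u)) * (t : ℂ) ^ (i : ℕ)) := by
      simp_rw [← Finset.sum_sub_distrib]
      rw [Finset.sum_comm, Finset.mul_sum]
      refine Finset.sum_congr rfl fun i _ => ?_
      simp only [KR]
      rw [mul_assoc, Finset.sum_mul]
      simp_rw [sub_mul]
    rw [h6]
    simp only [KQ]
    rw [mul_assoc, Finset.sum_mul, ← mul_add, ← Finset.sum_add_distrib,
      Finset.mul_sum _ _ (tailPhase w.1 u)]
    refine congrArg (fun S => (2 * Real.pi * Complex.I : ℂ)⁻¹ * S)
      (Finset.sum_congr rfl fun j _ => ?_)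
    linear_combination h1 j (-1) (Or.inr rfl) - h1 j 1 (Or.inl rfl)
  have hint : (∫ w, gaussWeight ψ w • KQ (w, (t, u)) ∂μ) *
      (t ^ k + ∑ i, c i u * t ^ (i : ℕ) : ℝ) +
      ∑ i, (∫ w, gaussWeight ψ w • KR i (w, (0, u)) ∂μ) * (t : ℂ) ^ (i : ℕ) =
      ∫ w, gaussWeight ψ w • (KQ (w, (t, u)) * (t ^ k + ∑ i, c i u * t ^ (i : ℕ) : ℝ) +
        ∑ i, KR i (w, (0, u)) * (t : ℂ) ^ (i : ℕ)) ∂μ := by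
    have h1 := integrable_smul_temperate hgm hgi hKQ (t, u)
    have h2 := fun i => integrable_smul_temperate hgm hgi (hKR i) (0, u)
    have h3 : ∀ i ∈ Finset.univ, Integrable (fun w => gaussWeight ψ w • KR i (w, (0, u)) *
        (t : ℂ) ^ ((i : Fin k) : ℕ)) μ := fun i _ => (h2 i).mul_const _
    simp_rw [← integral_mul_const]
    rw [← integral_finsetSum _ h3, ← integral_add (h1.mul_const _) (integrable_finsetSum _ h3)]
    refine integral_congr_ae (ae_of_all _ fun w => ?_)
    simp only [smul_eq_mul, mul_add, Finset.mul_sum, mul_assoc]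
  have hintegrable : Integrable (fun w => gaussWeight ψ w • (KQ (w, (t, u)) *
      (t ^ k + ∑ i, c i u * t ^ (i : ℕ) : ℝ) + ∑ i, KR i (w, (0, u)) * (t : ℂ) ^ (i : ℕ))) μ := by
    have h1 := integrable_smul_temperate hgm hgi hKQ (t, u)
    have h2 := fun i => integrable_smul_temperate hgm hgi (hKR i) (0, u)
    have h3 : ∀ i ∈ Finset.univ, Integrable (fun w => gaussWeight ψ w • KR i (w, (0, u)) *
        (t : ℂ) ^ ((i : Fin k) : ℕ)) μ := fun i _ => (h2 i).mul_const _
    refine ((h1.mul_const ((t ^ k + ∑ i, c i u * t ^ (i : ℕ) : ℝ) : ℂ)).add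
      (integrable_finsetSum _ h3)).congr (ae_of_all _ fun w => ?_)
    simp only [Pi.add_apply, smul_eq_mul, mul_add, Finset.mul_sum, mul_assoc]
  rw [hint]
  simp_rw [hsum] at hintegrable ⊢
  rw [integral_prod _ hintegrable]
  -- For a fixed frequency the normalized weights are constants in x. Cauchy's formula gives the
  -- same value for every `j`, the weights sum to 1, and the integrand of the inverse Fourier
  -- transform is left.
  have hinner : ∀ v : V, (∫ x : ℝ, gaussWeight ψ (v, x) • ((2 * Real.pi * Complex.I)⁻¹ *
        (tailPhase v u * ∑ j : Fin (k ^ 2 + 1),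
          ((lineWeight j (v 0) (fun i => c i u) *
            (∑ j, lineWeight j (v 0) (fun i => c i u))⁻¹ : ℝ) : ℂ) *
          (lineExp k j (-1) (v 0) x * lineCauchy k j (-1) (v 0) x t -
            lineExp k j 1 (v 0) x * lineCauchy k j 1 (v 0) x t)))) =
      Complex.exp ((2 * Real.pi * inner ℝ v (WithLp.toLp 2 (Fin.cons t u) : V) : ℝ) * Complex.I) *
        ψ v * Real.exp (-t ^ 2) := by
    intro v
    have h1 : ∀ x : ℝ, gaussWeight ψ (v, x) • ((2 * Real.pi * Complex.I)⁻¹ *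
        (tailPhase v u * ∑ j : Fin (k ^ 2 + 1),
          ((lineWeight j (v 0) (fun i => c i u) *
            (∑ j, lineWeight j (v 0) (fun i => c i u))⁻¹ : ℝ) : ℂ) *
          (lineExp k j (-1) (v 0) x * lineCauchy k j (-1) (v 0) x t -
            lineExp k j 1 (v 0) x * lineCauchy k j 1 (v 0) x t))) =
        (ψ v * (2 * Real.pi * Complex.I)⁻¹ * tailPhase v u) * ∑ j : Fin (k ^ 2 + 1),
          ((lineWeight j (v 0) (fun i => c i u) *
            (∑ j, lineWeight j (v 0) (fun i => c i u))⁻¹ : ℝ) : ℂ) *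
          ((Real.exp (-x ^ 2) : ℂ) * (lineExp k j (-1) (v 0) x * lineCauchy k j (-1) (v 0) x t) -
            (Real.exp (-x ^ 2) : ℂ) * (lineExp k j 1 (v 0) x * lineCauchy k j 1 (v 0) x t)) := by
      intro x
      rw [gaussWeight, smul_eq_mul]
      simp_rw [← mul_sub, Finset.mul_sum]
      refine Finset.sum_congr rfl fun j _ => ?_
      ring
    have hi := fun j s => integrable_exp_mul_lineExp_mul_lineCauchy k j s (v 0) t
    have hij : ∀ j, Integrable fun x : ℝ =>
        (Real.exp (-x ^ 2) : ℂ) * (lineExp k j (-1) (v 0) x * lineCauchy k j (-1) (v 0) x t) -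
          (Real.exp (-x ^ 2) : ℂ) * (lineExp k j 1 (v 0) x * lineCauchy k j 1 (v 0) x t) :=
      fun j => (hi j (-1)).sub (hi j 1)
    simp_rw [h1]
    rw [integral_const_mul, integral_finsetSum _ fun j _ => (hij j).const_mul _]
    have h2 : ∀ j, ∫ x : ℝ, ((lineWeight j (v 0) (fun i => c i u) *
            (∑ j, lineWeight j (v 0) (fun i => c i u))⁻¹ : ℝ) : ℂ) *
          ((Real.exp (-x ^ 2) : ℂ) * (lineExp k j (-1) (v 0) x * lineCauchy k j (-1) (v 0) x t) -
            (Real.exp (-x ^ 2) : ℂ) * (lineExp k j 1 (v 0) x * lineCauchy k j 1 (v 0) x t)) =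
        ((lineWeight j (v 0) (fun i => c i u) *
            (∑ j, lineWeight j (v 0) (fun i => c i u))⁻¹ : ℝ) : ℂ) *
          (2 * Real.pi * Complex.I *
            Complex.exp (2 * Real.pi * Complex.I * (v 0 : ℝ) * t - t ^ 2)) := by
      intro j
      rw [integral_const_mul, integral_sub (hi j (-1)) (hi j 1),
        integral_lineExp_sub_integral_lineExp]
    simp_rw [h2]
    rw [← Finset.sum_mul]
    have h3 : ∑ j, ((lineWeight j (v 0) (fun i => c i u) *
        (∑ j, lineWeight j (v 0) (fun i => c i u))⁻¹ : ℝ) : ℂ) = 1 := by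
      rw [← Complex.ofReal_sum, ← Finset.sum_mul, mul_inv_cancel₀, Complex.ofReal_one]
      exact (lt_of_lt_of_le one_pos (one_le_sum_lineWeight _ _)).ne'
    rw [h3, one_mul]
    have h4 : Complex.exp ((2 * Real.pi * inner ℝ v (WithLp.toLp 2 (Fin.cons t u) : V) : ℝ) *
        Complex.I) * (Real.exp (-t ^ 2) : ℂ) = tailPhase v u *
          Complex.exp (2 * Real.pi * Complex.I * (v 0 : ℝ) * t - t ^ 2) := by
      rw [tailPhase, Complex.ofReal_exp, ← Complex.exp_add, ← Complex.exp_add]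
      congr 1
      rw [PiLp.inner_apply, Fin.sum_univ_succ]
      simp only [Fin.cons_zero, Fin.cons_succ, RCLike.inner_apply, conj_trivial]
      push_cast
      simp_rw [mul_comm (u _ : ℂ)]
      ring
    have h5 : (2 * Real.pi * Complex.I : ℂ) ≠ 0 := by
      simp [Real.pi_ne_zero, Complex.I_ne_zero]
    rw [mul_right_comm _ (ψ v), h4]
    field_simp
  simp_rw [hinner]
  rw [integral_mul_const]
  congr 1
  have h1 : φ (WithLp.toLp 2 (Fin.cons t u)) = 𝓕⁻ (ψ : V → ℂ) (WithLp.toLp 2 (Fin.cons t u)) := by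
    rw [← SchwartzMap.fourierInv_coe, hψ, fourierInv_fourier_eq]
  rw [h1, Real.fourierInv_eq']
  rfl

end RealDivision

/-! ### Malgrange and Weierstrass division for germs. -/

section LocalDivision

/-- Division with remainder of germs `h(t, u)` by the monic polynomial in `t` whose coefficients
are given linear functions of `u`. -/
def HasLocalDivision (𝕜 : Type*) [NontriviallyNormedField 𝕜] : Prop :=
  ∀ (k d : ℕ) (c : Fin k → ((Fin d → 𝕜) →L[𝕜] 𝕜)) (h : 𝕜 × (Fin d → 𝕜) → 𝕜),
    (∀ᶠ p in 𝓝 0, ContDiffAt 𝕜 ∞ h p) →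
    ∃ (q : 𝕜 × (Fin d → 𝕜) → 𝕜) (r : Fin k → (Fin d → 𝕜) → 𝕜),
      (∀ᶠ p in 𝓝 0, ContDiffAt 𝕜 ∞ q p) ∧ (∀ i, ∀ᶠ u in 𝓝 0, ContDiffAt 𝕜 ∞ (r i) u) ∧
      ∀ᶠ p in 𝓝 0, h p = q p * (p.1 ^ k + ∑ i, c i p.2 * p.1 ^ (i : ℕ)) +
        ∑ i, r i p.2 * p.1 ^ (i : ℕ)

/-- The Malgrange division theorem. -/
theorem hasLocalDivision_real : HasLocalDivision ℝ := by
  intro k d c h hh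
  let V := EuclideanSpace ℝ (Fin (d + 1))
  let e : V →L[ℝ] ℝ × (Fin d → ℝ) := (EuclideanSpace.proj (𝕜 := ℝ) (0 : Fin (d + 1))).prod
    (ContinuousLinearMap.pi fun i : Fin d => EuclideanSpace.proj (𝕜 := ℝ) i.succ)
  have he : ∀ t u, e (WithLp.toLp 2 (Fin.cons t u)) = (t, u) := fun t u => rfl
  have h1 : ∀ᶠ v in 𝓝 (0 : V), ContDiffAt ℝ ∞ h (e v) := by
    have := e.continuous.tendsto 0
    rw [map_zero] at this
    exact this.eventually hh
  obtain ⟨ε, hε, hball⟩ := Metric.eventually_nhds_iff.1 h1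
  let b : ContDiffBump (0 : V) := ⟨ε / 4, ε / 2, by positivity, by linarith⟩
  -- The factor exp(t²) compensates the Gaussian in `exists_division_schwartz`; the bump makes the
  -- function globally defined with compact support and equal to 1 near the origin.
  let φ : V → ℂ := fun v => (b v * (h (e v) * Real.exp ((v 0) ^ 2)) : ℝ)
  have hsupp : HasCompactSupport φ := by
    refine b.hasCompactSupport.mono fun v hv => ?_
    rw [Function.mem_support] at hv ⊢
    intro h0
    exact hv (by simp only [φ, h0, zero_mul, Complex.ofReal_zero])
  have hsm : ContDiff ℝ ∞ φ := by
    refine contDiff_iff_contDiffAt.2 fun v => ?_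
    by_cases hv : v ∈ tsupport φ
    swap
    · exact contDiffAt_const.congr_of_eventuallyEq (notMem_tsupport_iff_eventuallyEq.1 hv)
    have hv' : v ∈ tsupport b := by
      refine closure_mono (fun w hw => ?_) hv
      rw [Function.mem_support] at hw ⊢
      intro h0
      exact hw (by simp only [φ, h0, zero_mul, Complex.ofReal_zero])
    rw [b.tsupport_eq, Metric.mem_closedBall] at hv'
    have hv2 : dist v 0 < ε := lt_of_le_of_lt hv' (by change ε / 2 < ε; linarith)
    have h2 : ContDiffAt ℝ ∞ (fun v => h (e v)) v := (hball hv2).comp v e.contDiff.contDiffAt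
    have h3 : ContDiffAt ℝ ∞ (fun v : V => Real.exp ((v 0) ^ 2)) v := by
      have : ContDiff ℝ ∞ fun v : V => v 0 :=
        (EuclideanSpace.proj 0 : EuclideanSpace ℝ (Fin (d + 1)) →L[ℝ] ℝ).contDiff
      exact (this.pow 2).exp.contDiffAt
    exact Complex.ofRealCLM.contDiff.contDiffAt.comp v (b.contDiff.contDiffAt.mul (h2.mul h3))
  obtain ⟨q, r, hq, hr, hqr⟩ := exists_division_schwartz c (hsupp.toSchwartzMap hsm)
  -- The divisor and the powers of t are real, so taking real parts preserves the identity.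
  refine ⟨fun p => (q p).re, fun i u => (r i u).re,
    Eventually.of_forall fun p => (Complex.reCLM.contDiff.comp hq).contDiffAt,
    fun i => Eventually.of_forall fun u => (Complex.reCLM.contDiff.comp (hr i)).contDiffAt, ?_⟩
  have hcont : Continuous fun p : ℝ × (Fin d → ℝ) => (WithLp.toLp 2 (Fin.cons p.1 p.2) : V) := by
    refine (PiLp.continuous_toLp 2 _).comp (continuous_pi fun i => ?_)
    refine Fin.cases ?_ (fun i => ?_) i
    · simpa using continuous_fst
    · exact (continuous_apply i).comp continuous_snd
  have h0 : (WithLp.toLp 2 (Fin.cons 0 0) : V) = 0 := by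
    ext i
    refine Fin.cases ?_ (fun i => ?_) i <;> simp
  have htend := hcont.tendsto (0, 0)
  simp only [h0] at htend
  filter_upwards [htend.eventually (Metric.closedBall_mem_nhds (0 : V) b.rIn_pos)] with p hp
  obtain ⟨t, u⟩ := p
  have h4 := hqr t u
  have h5 : (hsupp.toSchwartzMap hsm) (WithLp.toLp 2 (Fin.cons t u)) =
      ((h (t, u) * Real.exp (t ^ 2) : ℝ) : ℂ) := by
    change φ _ = _
    simp only [φ, he]
    rw [b.one_of_mem_closedBall hp, one_mul]
    rfl
  rw [h5, ← Complex.ofReal_mul, mul_assoc, ← Real.exp_add, add_neg_cancel, Real.exp_zero,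
    mul_one] at h4
  have h6 := congrArg Complex.re h4
  simp only [← Complex.ofReal_pow, Complex.add_re, Complex.re_sum, Complex.re_mul_ofReal,
    Complex.ofReal_re] at h6
  exact h6

section ParametricIntegral

open MeasureTheory

universe u

variable {E F : Type u} [NormedAddCommGroup E] [NormedSpace ℂ E] [ProperSpace E]
  [NormedAddCommGroup F] [NormedSpace ℂ F] {γ w : ℝ → ℂ} {U : Set E} {a b : ℝ}

theorem hasFDerivAt_intervalIntegral_curve (hγ : Continuous γ) (hw : Continuous w) (hU : IsOpen U)
    {G : ℂ × E → F} (hG : ∀ θ, ∀ e ∈ U, ContDiffAt ℂ ∞ G (γ θ, e)) {e : E} (he : e ∈ U) :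
    HasFDerivAt (fun e => ∫ θ in a..b, w θ • G (γ θ, e))
      (∫ θ in a..b, w θ • (fderiv ℂ G (γ θ, e)).comp (ContinuousLinearMap.inr ℂ ℂ E)) e := by
  obtain ⟨ε, hε, hball⟩ := Metric.isOpen_iff.1 hU e he
  have hsub : Metric.closedBall e (ε / 2) ⊆ U := fun x hx =>
    hball (lt_of_le_of_lt hx (half_lt_self hε))
  have hGc : ∀ x ∈ U, Continuous fun θ => w θ • G (γ θ, x) := fun x hx =>
    hw.smul (continuous_iff_continuousAt.2 fun θ =>
      ContinuousAt.comp (g := G) (f := fun θ => (γ θ, x)) (hG θ x hx).continuousAt (by fun_prop))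
  have hG'a : ∀ θ, ∀ x ∈ U, ContinuousAt
      (fun p => (fderiv ℂ G p).comp (ContinuousLinearMap.inr ℂ ℂ E)) (γ θ, x) := fun θ x hx =>
    (((ContinuousLinearMap.compL ℂ E (ℂ × E) F).flip
      (ContinuousLinearMap.inr ℂ ℂ E)).continuous.continuousAt).comp
        ((hG θ x hx).fderiv_right (m := 0) (by simp)).continuousAt
  have hG'c : ∀ x ∈ U, Continuous fun θ =>
      w θ • (fderiv ℂ G (γ θ, x)).comp (ContinuousLinearMap.inr ℂ ℂ E) := fun x hx =>
    hw.smul (continuous_iff_continuousAt.2 fun θ => ContinuousAt.comp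
      (g := fun p => (fderiv ℂ G p).comp (ContinuousLinearMap.inr ℂ ℂ E))
      (f := fun θ => (γ θ, x)) (hG'a θ x hx) (by fun_prop))
  have hcomp : IsCompact (Set.uIcc a b ×ˢ Metric.closedBall e (ε / 2)) :=
    isCompact_uIcc.prod (isCompact_closedBall _ _)
  have hcont : ContinuousOn (fun p : ℝ × E => w p.1 •
      (fderiv ℂ G (γ p.1, p.2)).comp (ContinuousLinearMap.inr ℂ ℂ E))
      (Set.uIcc a b ×ˢ Metric.closedBall e (ε / 2)) := fun p hp => by
    refine ContinuousAt.continuousWithinAt (ContinuousAt.smul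
      (f := fun p : ℝ × E => w p.1) (hw.comp continuous_fst).continuousAt ?_)
    exact ContinuousAt.comp (g := fun p => (fderiv ℂ G p).comp (ContinuousLinearMap.inr ℂ ℂ E))
      (f := fun p : ℝ × E => (γ p.1, p.2)) (hG'a p.1 p.2 (hsub hp.2)) (by fun_prop)
  obtain ⟨C, hC⟩ := hcomp.exists_bound_of_continuousOn hcont
  refine (intervalIntegral.hasFDerivAt_integral_of_dominated_of_fderiv_le (𝕜 := ℂ)
    (F := fun e θ => w θ • G (γ θ, e)) (F' := fun e θ =>
      w θ • (fderiv ℂ G (γ θ, e)).comp (ContinuousLinearMap.inr ℂ ℂ E))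
    (bound := fun _ => C) (Metric.ball_mem_nhds e (half_pos hε)) ?_
    ((hGc e he).intervalIntegrable _ _) (hG'c e he).aestronglyMeasurable ?_
    intervalIntegrable_const ?_)
  · filter_upwards [hU.mem_nhds he] with x hx using (hGc x hx).aestronglyMeasurable
  · exact ae_of_all _ fun θ hθ x hx =>
      hC (θ, x) ⟨Set.uIoc_subset_uIcc hθ, Metric.ball_subset_closedBall hx⟩
  · refine ae_of_all _ fun θ _ x hx => ?_
    have h1 : HasFDerivAt G (fderiv ℂ G (γ θ, x)) (γ θ, x) :=
      ((hG θ x (hsub (Metric.ball_subset_closedBall hx))).differentiableAt (by simp)).hasFDerivAt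
    exact (h1.comp x (hasFDerivAt_prodMk_right (γ θ) x)).const_smul (w θ)

/-- As for temperate kernels, the parameter derivative is a curve integral of the same kind, so
induction on the order works; domination comes from compactness of the interval times a closed ball.
-/
theorem contDiffAt_intervalIntegral_curve (hγ : Continuous γ) (hw : Continuous w) (hU : IsOpen U)
    {G : ℂ × E → F} (hG : ∀ θ, ∀ e ∈ U, ContDiffAt ℂ ∞ G (γ θ, e)) {e : E} (he : e ∈ U) :
    ContDiffAt ℂ ∞ (fun e => ∫ θ in a..b, w θ • G (γ θ, e)) e := by
  rw [contDiffAt_infty]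
  intro n
  induction n generalizing F e with
  | zero =>
    rw [Nat.cast_zero, contDiffAt_zero]
    exact ⟨U, hU.mem_nhds he, fun x hx =>
      (hasFDerivAt_intervalIntegral_curve hγ hw hU hG hx).continuousAt.continuousWithinAt⟩
  | succ n ih =>
    push_cast
    rw [contDiffAt_succ_iff_hasFDerivAt]
    have h1 : ∀ θ, ∀ x ∈ U, ContDiffAt ℂ ∞
        (fun p => (fderiv ℂ G p).comp (ContinuousLinearMap.inr ℂ ℂ E)) (γ θ, x) := fun θ x hx => by
      have h2 : ContDiffAt ℂ ∞ (fderiv ℂ G) (γ θ, x) := (hG θ x hx).fderiv_right (by simp)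
      exact h2.clm_comp contDiffAt_const
    exact ⟨_, ⟨U, hU.mem_nhds he, fun x hx =>
      hasFDerivAt_intervalIntegral_curve hγ hw hU hG hx⟩, ih h1 he⟩

end ParametricIntegral

/-- The Weierstrass division theorem. -/
theorem hasLocalDivision_complex : HasLocalDivision ℂ := by
  intro k d c h hh
  obtain ⟨δ, hδ, hball⟩ := Metric.eventually_nhds_iff.1 hh
  set ρ := δ / 2 with hρ
  have hρ0 : 0 < ρ := by positivity
  let P : ℂ × (Fin d → ℂ) → ℂ := fun p => (monicPoly fun i => c i p.2).eval p.1
  have hP : ∀ p, P p = p.1 ^ k + ∑ i, c i p.2 * p.1 ^ (i : ℕ) := fun p => eval_monicPoly _ _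
  have hPs : ContDiff ℂ ∞ P := by
    rw [funext hP]
    fun_prop
  -- the polynomial does not vanish on the circle
  have hsmall : ∀ᶠ u : Fin d → ℂ in 𝓝 0, ∑ i, ‖c i u‖ * ρ ^ (i : ℕ) < ρ ^ k := by
    have h1 : Continuous fun u : Fin d → ℂ => ∑ i, ‖c i u‖ * ρ ^ (i : ℕ) := by fun_prop
    have h2 := h1.tendsto 0
    simp only [map_zero, norm_zero, zero_mul, Finset.sum_const_zero] at h2
    exact h2.eventually (gt_mem_nhds (by positivity))
  obtain ⟨ε, hε, hεball⟩ := Metric.eventually_nhds_iff.1 hsmall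
  let γ : ℝ → ℂ := circleMap 0 ρ
  have hγn : ∀ θ, ‖γ θ‖ = ρ := fun θ => by simp [γ, abs_of_pos hρ0]
  have hγ : Continuous γ := continuous_circleMap _ _
  have hw : Continuous fun θ => deriv γ θ := by
    simp only [γ, deriv_circleMap]
    fun_prop
  have hPne : ∀ z : ℂ, ‖z‖ = ρ → ∀ u : Fin d → ℂ, dist u 0 < ε → P (z, u) ≠ 0 := by
    intro z hz u hu h0
    rw [hP, add_eq_zero_iff_eq_neg] at h0
    have h1 : ‖z ^ k‖ ≤ ∑ i, ‖c i u‖ * ρ ^ (i : ℕ) := by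
      rw [h0, norm_neg]
      refine (norm_sum_le _ _).trans (Finset.sum_le_sum fun i _ => ?_)
      rw [norm_mul, norm_pow, hz]
    rw [norm_pow, hz] at h1
    exact absurd (hεball hu) (not_lt.2 h1)
  -- smoothness on the circle
  have hhs : ∀ θ, ∀ u : Fin d → ℂ, dist u 0 < δ → ContDiffAt ℂ ∞ h (γ θ, u) := by
    intro θ u hu
    refine hball ?_
    rw [dist_zero_right] at hu ⊢
    rw [Prod.norm_mk, max_lt_iff, hγn]
    exact ⟨by linarith, hu⟩
  let U : Set (ℂ × (Fin d → ℂ)) := Metric.ball 0 ρ ×ˢ Metric.ball 0 (min δ ε)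
  have hU : IsOpen U := Metric.isOpen_ball.prod Metric.isOpen_ball
  have hU0 : U ∈ 𝓝 (0 : ℂ × (Fin d → ℂ)) := hU.mem_nhds
    ⟨Metric.mem_ball_self hρ0, Metric.mem_ball_self (lt_min hδ hε)⟩
  let U' : Set (Fin d → ℂ) := Metric.ball 0 (min δ ε)
  have hU'0 : U' ∈ 𝓝 (0 : Fin d → ℂ) := Metric.ball_mem_nhds _ (lt_min hδ hε)
  -- Cauchy's formula for h(t, u), with 1/(z - t) split through the divided difference of P: this
  -- integrand yields the quotient, the next one the remainder coefficients.
  let GQ : ℂ × (ℂ × (Fin d → ℂ)) → ℂ := fun p => h (p.1, p.2.2) / P (p.1, p.2.2) * (p.1 - p.2.1)⁻¹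
  let GR : Fin k → ℂ × (Fin d → ℂ) → ℂ := fun i p =>
    h p / P p * dividedCoeff (fun i => c i p.2) p.1 i
  have hdc : ∀ i, ContDiff ℂ ∞ fun p : ℂ × (Fin d → ℂ) =>
      dividedCoeff (fun i => c i p.2) p.1 i := by
    intro i
    unfold dividedCoeff
    refine ContDiff.add (by fun_prop) (ContDiff.sum fun m _ => ?_)
    split_ifs
    · fun_prop
    · exact contDiff_const
  have hne : ∀ θ, ∀ t ∈ Metric.ball (0 : ℂ) ρ, γ θ - t ≠ 0 := by
    intro θ t ht h0
    rw [Metric.mem_ball, dist_zero_right, ← sub_eq_zero.1 h0, hγn] at ht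
    exact lt_irrefl _ ht
  have hGQ : ∀ θ, ∀ e ∈ U, ContDiffAt ℂ ∞ GQ (γ θ, e) := by
    rintro θ ⟨t, u⟩ ⟨ht, hu⟩
    have hu1 : dist u 0 < δ := lt_of_lt_of_le hu (min_le_left _ _)
    have hu2 : dist u 0 < ε := lt_of_lt_of_le hu (min_le_right _ _)
    have hproj : ContDiff ℂ ∞ fun p : ℂ × (ℂ × (Fin d → ℂ)) => (p.1, p.2.2) := by fun_prop
    refine ContDiffAt.mul (ContDiffAt.div ?_ ?_ (hPne _ (hγn θ) u hu2)) (ContDiffAt.inv ?_ ?_)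
    · exact ContDiffAt.comp (γ θ, (t, u)) (g := h) (f := fun p : ℂ × (ℂ × (Fin d → ℂ)) =>
        (p.1, p.2.2)) (hhs θ u hu1) hproj.contDiffAt
    · exact (hPs.comp hproj).contDiffAt
    · fun_prop
    · exact hne θ t ht
  have hGR : ∀ i θ, ∀ e ∈ U', ContDiffAt ℂ ∞ (GR i) (γ θ, e) := by
    intro i θ u hu
    have hu1 : dist u 0 < δ := lt_of_lt_of_le hu (min_le_left _ _)
    have hu2 : dist u 0 < ε := lt_of_lt_of_le hu (min_le_right _ _)
    exact ((hhs θ u hu1).div hPs.contDiffAt (hPne _ (hγn θ) u hu2)).mul (hdc i).contDiffAt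
  refine ⟨fun e => (2 * Real.pi * Complex.I)⁻¹ * ∮ z in C(0, ρ), GQ (z, e),
    fun i u => (2 * Real.pi * Complex.I)⁻¹ * ∮ z in C(0, ρ), GR i (z, u), ?_, fun i => ?_, ?_⟩
  · filter_upwards [hU0] with e he
    exact contDiffAt_const.mul (contDiffAt_intervalIntegral_curve hγ hw hU hGQ he)
  · filter_upwards [hU'0] with u hu
    exact contDiffAt_const.mul
      (contDiffAt_intervalIntegral_curve hγ hw Metric.isOpen_ball (hGR i) hu)
  · filter_upwards [hU0] with e he
    obtain ⟨t, u⟩ := e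
    obtain ⟨ht, hu⟩ := he
    have hu1 : dist u 0 < δ := lt_of_lt_of_le hu (min_le_left _ _)
    have hu2 : dist u 0 < ε := lt_of_lt_of_le hu (min_le_right _ _)
    have hcauchy : (∮ z in C(0, ρ), (z - t)⁻¹ • h (z, u)) = (2 * Real.pi * Complex.I : ℂ) • h (t, u) := by
      refine DiffContOnCl.circleIntegral_sub_inv_smul (f := fun z => h (z, u)) ?_ ht
      refine DifferentiableOn.diffContOnCl fun z hz => ?_
      have hz' : ‖z‖ ≤ ρ := by
        simpa using Metric.closure_ball_subset_closedBall hz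
      have h1 : ContDiffAt ℂ ∞ h (z, u) := by
        refine hball ?_
        rw [dist_zero_right] at hu1 ⊢
        rw [Prod.norm_mk, max_lt_iff]
        exact ⟨by linarith, hu1⟩
      have h2 : ContDiffAt ℂ ∞ (fun z => h (z, u)) z :=
        ContDiffAt.comp z (g := h) (f := fun z => (z, u)) h1 (by fun_prop)
      exact (h2.differentiableAt (by simp)).differentiableWithinAt
    have hiQ : CircleIntegrable (fun z => GQ (z, (t, u)) * P (t, u)) 0 ρ := by
      refine ContinuousOn.circleIntegrable hρ0.le fun z hz => ?_
      obtain ⟨θ, rfl⟩ : ∃ θ, γ θ = z := by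
        have := range_circleMap (0 : ℂ) ρ
        rw [abs_of_pos hρ0] at this
        rw [← this] at hz
        exact hz
      refine ContinuousAt.continuousWithinAt (ContinuousAt.mul ?_ continuousAt_const)
      exact ContinuousAt.comp (g := GQ) (f := fun z => (z, (t, u)))
        (hGQ θ (t, u) ⟨ht, hu⟩).continuousAt (by fun_prop)
    have hiR : ∀ i ∈ Finset.univ, CircleIntegrable (fun z => GR i (z, u) * t ^ (i : ℕ)) 0 ρ := by
      intro i _
      refine ContinuousOn.circleIntegrable hρ0.le fun z hz => ?_
      obtain ⟨θ, rfl⟩ : ∃ θ, γ θ = z := by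
        have := range_circleMap (0 : ℂ) ρ
        rw [abs_of_pos hρ0] at this
        rw [← this] at hz
        exact hz
      refine ContinuousAt.continuousWithinAt (ContinuousAt.mul ?_ continuousAt_const)
      exact ContinuousAt.comp (g := GR i) (f := fun z => (z, u))
        (hGR i θ u hu).continuousAt (by fun_prop)
    have hsum : (∮ z in C(0, ρ), (z - t)⁻¹ • h (z, u)) =
        (∮ z in C(0, ρ), GQ (z, (t, u))) * P (t, u) +
          ∑ i, (∮ z in C(0, ρ), GR i (z, u)) * t ^ (i : ℕ) := by
      have hmul : ∀ (f : ℂ → ℂ) (a : ℂ), (∮ z in C(0, ρ), f z) * a = ∮ z in C(0, ρ), f z * a := by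
        intro f a
        simp only [circleIntegral, smul_eq_mul, ← intervalIntegral.integral_mul_const, mul_assoc]
      simp_rw [hmul]
      rw [← circleIntegral.integral_fun_sum hiR, ← circleIntegral.integral_add hiQ
        (CircleIntegrable.fun_sum _ hiR)]
      refine circleIntegral.integral_congr hρ0.le fun z hz => ?_
      have hz' : ‖z‖ = ρ := by simpa using hz
      have h1 := hPne z hz' u hu2
      have h2 : z - t ≠ 0 := by
        intro h0
        rw [Metric.mem_ball, dist_zero_right, ← sub_eq_zero.1 h0, hz'] at ht
        exact lt_irrefl _ ht
      have h3 := eval_monicPoly_sub (fun i => c i u) z t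
      have h4 : ∑ i, GR i (z, u) * t ^ (i : ℕ) =
          h (z, u) / P (z, u) * ∑ i, dividedCoeff (fun i => c i u) z i * t ^ (i : ℕ) := by
        rw [Finset.mul_sum]
        refine Finset.sum_congr rfl fun i _ => ?_
        simp only [GR]
        ring
      simp only [smul_eq_mul]
      rw [h4]
      simp only [GQ]
      have h5 : P (z, u) - P (t, u) =
          (z - t) * ∑ i, dividedCoeff (fun i => c i u) z i * t ^ (i : ℕ) := h3
      field_simp
      linear_combination h (z, u) * h5
    rw [hcauchy] at hsum
    have h2pi : (2 * Real.pi * Complex.I : ℂ) ≠ 0 := by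
      simp [Real.pi_ne_zero, Complex.I_ne_zero]
    rw [← hP (t, u)]
    simp_rw [mul_assoc (2 * Real.pi * Complex.I : ℂ)⁻¹]
    rw [← Finset.mul_sum, ← mul_add, ← hsum, smul_eq_mul, inv_mul_cancel_left₀ h2pi]

end LocalDivision

/-! ### Transfer of division from ℝ and ℂ to every `RCLike` field. -/

section Transfer

/-- Smoothness is preserved by an isometric change of the scalar field. -/
theorem ContDiffAt.of_ringEquiv {𝕜 𝕂 : Type*} [NontriviallyNormedField 𝕜]
    [NontriviallyNormedField 𝕂] (σ : 𝕜 ≃+* 𝕂) (hσ : ∀ x, ‖σ x‖ = ‖x‖)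
    {E E' : Type*} [NormedAddCommGroup E] [NormedSpace 𝕜 E] [NormedAddCommGroup E']
    [NormedSpace 𝕂 E'] (e : E' → E) (hadd : ∀ x y, e (x + y) = e x + e y)
    (hsmul : ∀ (a : 𝕂) x, e (a • x) = σ.symm a • e x) (hcont : Continuous e)
    {f : E → 𝕜} {x : E'} {n : WithTop ℕ∞} (h : ContDiffAt 𝕜 n f (e x)) :
    ContDiffAt 𝕂 n (fun y => σ (f (e y))) x := by
  let : Algebra 𝕂 𝕜 := σ.symm.toRingHom.toAlgebra
  have hs : ∀ (a : 𝕂) (b : 𝕜), a • b = σ.symm a * b := fun a b => rfl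
  let : NormedAlgebra 𝕂 𝕜 :=
    { norm_smul_le := fun a b => by
        rw [hs, norm_mul, ← hσ (σ.symm a), RingEquiv.apply_symm_apply] }
  let : NormedSpace 𝕂 E := NormedSpace.restrictScalars 𝕂 𝕜 E
  have : IsScalarTower 𝕂 𝕜 E := ⟨fun a b v => by
    rw [hs, mul_smul]
    rfl⟩
  let eL : E' →L[𝕂] E :=
    { toFun := e
      map_add' := hadd
      map_smul' := fun a v => hsmul a v
      cont := hcont }
  have hσc : Continuous σ := (AddMonoidHomClass.isometry_of_norm σ hσ).continuous
  let sL : 𝕜 →L[𝕂] 𝕂 :=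
    { toFun := σ
      map_add' := map_add σ
      map_smul' := fun a v => by
        rw [hs, map_mul, RingEquiv.apply_symm_apply]
        rfl
      cont := hσc }
  have h1 : ContDiffAt 𝕂 n f (eL x) := h.restrict_scalars 𝕂
  exact sL.contDiff.contDiffAt.comp x (h1.comp x eL.contDiff.contDiffAt)

/-- Local division is invariant under an isometric change of the scalar field. -/
theorem HasLocalDivision.of_ringEquiv {𝕜 𝕂 : Type*} [NontriviallyNormedField 𝕜]
    [NontriviallyNormedField 𝕂] (σ : 𝕜 ≃+* 𝕂) (hσ : ∀ x, ‖σ x‖ = ‖x‖)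
    (H : HasLocalDivision 𝕂) : HasLocalDivision 𝕜 := by
  have hσs : ∀ x, ‖σ.symm x‖ = ‖x‖ := fun x => by rw [← hσ, RingEquiv.apply_symm_apply]
  have c1 : Continuous σ := (AddMonoidHomClass.isometry_of_norm σ hσ).continuous
  have c2 : Continuous σ.symm := (AddMonoidHomClass.isometry_of_norm σ.symm hσs).continuous
  intro k d c h hh
  let e : (Fin d → 𝕜) → (Fin d → 𝕂) := fun u i => σ (u i)
  let e' : (Fin d → 𝕂) → (Fin d → 𝕜) := fun u i => σ.symm (u i)
  have ee : ∀ u, e (e' u) = u := fun u => by funext i; simp [e, e']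
  have ee' : ∀ u, e' (e u) = u := fun u => by funext i; simp [e, e']
  have ec : Continuous e := by fun_prop
  have ec' : Continuous e' := by fun_prop
  let E : 𝕜 × (Fin d → 𝕜) → 𝕂 × (Fin d → 𝕂) := fun p => (σ p.1, e p.2)
  let E' : 𝕂 × (Fin d → 𝕂) → 𝕜 × (Fin d → 𝕜) := fun p => (σ.symm p.1, e' p.2)
  have Ec : Continuous E := by fun_prop
  have Ec' : Continuous E' := by fun_prop
  have EE' : ∀ u, E' (E u) = u := fun u => by simp [E, E', ee']
  have E0 : E 0 = 0 := by
    apply Prod.ext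
    · simp [E]
    · funext i; simp [E, e]
  have E0' : E' 0 = 0 := by
    apply Prod.ext
    · simp [E']
    · funext i; simp [E', e']
  have e0 : e 0 = 0 := by funext i; simp [e]
  have tE : Tendsto E (𝓝 0) (𝓝 0) := by simpa [E0] using Ec.tendsto 0
  have tE' : Tendsto E' (𝓝 0) (𝓝 0) := by simpa [E0'] using Ec'.tendsto 0
  have te : Tendsto e (𝓝 0) (𝓝 0) := by simpa [e0] using ec.tendsto 0
  let C : Fin k → ((Fin d → 𝕂) →L[𝕂] 𝕂) := fun i =>
    { toFun := fun u => σ (c i (e' u))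
      map_add' := fun u v => by
        rw [show e' (u + v) = e' u + e' v from by funext j; simp [e']]
        simp
      map_smul' := fun a v => by
        rw [show e' (a • v) = σ.symm a • e' v from by funext j; simp [e']]
        simp
      cont := by fun_prop }
  obtain ⟨q, r, hq, hr, hd⟩ := H k d C (fun p => σ (h (E' p))) (by
    filter_upwards [tE'.eventually hh] with p hp
    refine ContDiffAt.of_ringEquiv σ hσ E' ?_ ?_ Ec' hp
    · intro x y
      apply Prod.ext
      · simp [E']
      · funext i; simp [E', e']
    · intro a x
      apply Prod.ext
      · simp [E']
      · funext i; simp [E', e'])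
  refine ⟨fun p => σ.symm (q (E p)), fun i u => σ.symm (r i (e u)), ?_, ?_, ?_⟩
  · filter_upwards [tE.eventually hq] with p hp
    refine ContDiffAt.of_ringEquiv σ.symm hσs E ?_ ?_ Ec hp
    · intro x y
      apply Prod.ext
      · simp [E]
      · funext i; simp [E, e]
    · intro a x
      apply Prod.ext
      · simp [E]
      · funext i; simp [E, e]
  · intro i
    filter_upwards [te.eventually (hr i)] with p hp
    refine ContDiffAt.of_ringEquiv σ.symm hσs e ?_ ?_ ec hp
    · intro x y
      funext i; simp [e]
    · intro a x
      funext i; simp [e]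
  · filter_upwards [tE.eventually hd] with p hp
    have := congrArg σ.symm hp
    simp only [EE', RingEquiv.symm_apply_apply] at this
    rw [this]
    simp only [map_add, map_mul, map_sum, map_pow]
    simp [E, C, ee']

/-- An `RCLike` field is isometrically isomorphic, as a ring, to ℝ or to ℂ, according to whether its
imaginary unit vanishes. -/
theorem hasLocalDivision_rclike (𝕜 : Type*) [RCLike 𝕜] : HasLocalDivision 𝕜 := by
  rcases RCLike.I_eq_zero_or_im_I_eq_one (K := 𝕜) with h | h
  · exact hasLocalDivision_real.of_ringEquiv (RCLike.realRingEquiv h)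
      (RCLike.realLinearIsometryEquiv h).norm_map
  · exact hasLocalDivision_complex.of_ringEquiv (RCLike.complexRingEquiv h)
      (RCLike.complexLinearIsometryEquiv h).norm_map

end Transfer

/-! ### Calculus of smooth germs, division in one coordinate, Hadamard's lemma. -/

section SmoothNearCalculus

variable {𝕜 : Type*} [RCLike 𝕜]

theorem ContDiff.smoothNear {E V : Type*} [NormedAddCommGroup E] [NormedSpace 𝕜 E]
    [NormedAddCommGroup V] [NormedSpace 𝕜 V] {h : E → V} (hh : ContDiff 𝕜 ∞ h) (x : E) :
    SmoothNear 𝕜 h x :=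
  Eventually.of_forall fun _ => hh.contDiffAt

namespace SmoothNear

variable {E V W : Type*} [NormedAddCommGroup E] [NormedSpace 𝕜 E] [NormedAddCommGroup V]
  [NormedSpace 𝕜 V] [NormedAddCommGroup W] [NormedSpace 𝕜 W] {x : E}

theorem contDiffAt {h : E → V} (hh : SmoothNear 𝕜 h x) : ContDiffAt 𝕜 ∞ h x :=
  hh.self_of_nhds

theorem continuousAt {h : E → V} (hh : SmoothNear 𝕜 h x) : ContinuousAt h x :=
  hh.contDiffAt.continuousAt

theorem comp_of_eq {g : V → W} {h : E → V} {y : V} (hg : SmoothNear 𝕜 g y)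
    (hh : SmoothNear 𝕜 h x) (hxy : h x = y) : SmoothNear 𝕜 (fun u => g (h u)) x := by
  have ht : Tendsto h (𝓝 x) (𝓝 y) := hxy ▸ hh.continuousAt.tendsto
  filter_upwards [hh, ht.eventually hg] with u h1 h2 using h2.comp u h1

theorem add {g h : E → V} (hg : SmoothNear 𝕜 g x) (hh : SmoothNear 𝕜 h x) :
    SmoothNear 𝕜 (fun u => g u + h u) x := by
  filter_upwards [hg, hh] with u h1 h2 using h1.add h2

theorem sub {g h : E → V} (hg : SmoothNear 𝕜 g x) (hh : SmoothNear 𝕜 h x) :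
    SmoothNear 𝕜 (fun u => g u - h u) x := by
  filter_upwards [hg, hh] with u h1 h2 using h1.sub h2

theorem neg {h : E → V} (hh : SmoothNear 𝕜 h x) : SmoothNear 𝕜 (fun u => -h u) x := by
  filter_upwards [hh] with u h2 using h2.neg

theorem mul {g h : E → 𝕜} (hg : SmoothNear 𝕜 g x) (hh : SmoothNear 𝕜 h x) :
    SmoothNear 𝕜 (fun u => g u * h u) x := by
  filter_upwards [hg, hh] with u h1 h2 using h1.mul h2

theorem inv {h : E → 𝕜} (hh : SmoothNear 𝕜 h x) (h0 : h x ≠ 0) :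
    SmoothNear 𝕜 (fun u => (h u)⁻¹) x := by
  filter_upwards [hh, hh.continuousAt.eventually_ne h0] with u h1 h2 using h1.inv h2

theorem sum {ι : Type*} {s : Finset ι} {h : ι → E → V} (hh : ∀ i ∈ s, SmoothNear 𝕜 (h i) x) :
    SmoothNear 𝕜 (fun u => ∑ i ∈ s, h i u) x := by
  have : ∀ᶠ u in 𝓝 x, ∀ i ∈ s, ContDiffAt 𝕜 ∞ (h i) u := (Filter.eventually_all_finset s).2 hh
  filter_upwards [this] with u h1 using ContDiffAt.sum h1

theorem pi {k : ℕ} {h : E → Fin k → 𝕜} (hh : ∀ i, SmoothNear 𝕜 (fun u => h u i) x) :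
    SmoothNear 𝕜 h x := by
  filter_upwards [Filter.eventually_all.2 hh] with u h1 using contDiffAt_pi.2 h1

theorem apply {k : ℕ} {h : E → Fin k → 𝕜} (hh : SmoothNear 𝕜 h x) (i : Fin k) :
    SmoothNear 𝕜 (fun u => h u i) x := by
  filter_upwards [hh] with u h1 using contDiffAt_pi.1 h1 i

end SmoothNear

theorem contDiff_removeNth {d : ℕ} (p : Fin (d + 1)) :
    ContDiff 𝕜 ∞ (fun x : Fin (d + 1) → 𝕜 => p.removeNth x) := by
  rw [contDiff_pi]
  intro i
  simp only [Fin.removeNth]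
  fun_prop

/-- Division of a smooth germ by a monic polynomial in the coordinate `p` whose coefficients are
linear in the other coordinates. -/
theorem exists_coord_division {d : ℕ} (p : Fin (d + 1)) (k : ℕ)
    (c : Fin k → ((Fin d → 𝕜) →L[𝕜] 𝕜)) {h : (Fin (d + 1) → 𝕜) → 𝕜} (hh : SmoothNear 𝕜 h 0) :
    ∃ (q : (Fin (d + 1) → 𝕜) → 𝕜) (r : Fin k → (Fin d → 𝕜) → 𝕜),
      SmoothNear 𝕜 q 0 ∧ (∀ i, SmoothNear 𝕜 (r i) 0) ∧
      ∀ᶠ x in 𝓝 0, h x = q x * (x p ^ k + ∑ i, c i (p.removeNth x) * x p ^ (i : ℕ))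
        + ∑ i, r i (p.removeNth x) * x p ^ (i : ℕ) := by
  have hins : ContDiff 𝕜 ∞ (fun P : 𝕜 × (Fin d → 𝕜) => (p.insertNth P.1 P.2 : Fin (d + 1) → 𝕜)) := by
    rw [contDiff_pi]
    intro i
    induction i using Fin.succAboveCases p with
    | x => simp only [Fin.insertNth_apply_same]; fun_prop
    | p i => simp only [Fin.insertNth_apply_succAbove]; fun_prop
  have hins0 : (p.insertNth (0 : 𝕜 × (Fin d → 𝕜)).1 (0 : 𝕜 × (Fin d → 𝕜)).2 : Fin (d + 1) → 𝕜)
      = 0 := by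
    funext i
    induction i using Fin.succAboveCases p with
    | x => simp
    | p i => simp
  obtain ⟨q, r, hq, hr, hd⟩ := hasLocalDivision_rclike 𝕜 k d c
    (fun P => h (p.insertNth P.1 P.2)) (hh.comp_of_eq (hins.smoothNear 0) hins0)
  have hsp : ContDiff 𝕜 ∞ (fun x : Fin (d + 1) → 𝕜 => (x p, p.removeNth x)) :=
    ContDiff.prodMk (by fun_prop) (contDiff_removeNth p)
  have hsp0 : ((fun x : Fin (d + 1) → 𝕜 => (x p, p.removeNth x)) 0) = 0 := rfl
  refine ⟨fun x => q (x p, p.removeNth x), r,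
    SmoothNear.comp_of_eq hq (hsp.smoothNear 0) hsp0, hr, ?_⟩
  have ht : Tendsto (fun x : Fin (d + 1) → 𝕜 => (x p, p.removeNth x)) (𝓝 0) (𝓝 0) := by
    simpa only [hsp0] using hsp.continuous.tendsto 0
  filter_upwards [ht.eventually hd] with x hx
  simpa using hx

/-- Hadamard's lemma. -/
theorem SmoothNear.exists_hadamard {d : ℕ} {f : (Fin d → 𝕜) → 𝕜} (hf : SmoothNear 𝕜 f 0) :
    ∃ g : Fin d → (Fin d → 𝕜) → 𝕜, (∀ i, SmoothNear 𝕜 (g i) 0) ∧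
      ∀ᶠ x in 𝓝 0, f x = f 0 + ∑ i, x i * g i x := by
  induction d with
  | zero =>
    refine ⟨fun i => i.elim0, fun i => i.elim0, Eventually.of_forall fun x => ?_⟩
    simp [Subsingleton.elim x 0]
  | succ d ih =>
    -- Dividing by the coordinate itself leaves a remainder in the other variables, to which
    -- induction applies.
    obtain ⟨q, r, hq, hr, hd⟩ := exists_coord_division (0 : Fin (d + 1)) 1 (fun _ => 0) hf
    obtain ⟨g, hg, hgr⟩ := ih (hr 0)
    have ht : Tendsto (fun x : Fin (d + 1) → 𝕜 => (0 : Fin (d + 1)).removeNth x) (𝓝 0) (𝓝 0) := by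
      have := (contDiff_removeNth (𝕜 := 𝕜) (0 : Fin (d + 1))).continuous.tendsto 0
      exact this
    refine ⟨Fin.cons q fun i x => g i ((0 : Fin (d + 1)).removeNth x), ?_, ?_⟩
    · intro i
      refine Fin.cases hq (fun i => ?_) i
      exact (hg i).comp_of_eq ((contDiff_removeNth (0 : Fin (d + 1))).smoothNear 0) rfl
    · have h0 : f 0 = r 0 0 := by
        have := hd.self_of_nhds
        simp only [Fin.sum_univ_one] at this
        simp only [Pi.zero_apply, pow_one, zero_apply, add_zero,
          mul_zero, zero_add, Fin.val_zero, pow_zero, mul_one] at this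
        exact this
      filter_upwards [hd, ht.eventually hgr] with x h1 h2
      rw [h1, h0, Fin.sum_univ_one, Fin.sum_univ_one, Fin.sum_univ_succ, h2]
      simp [Fin.removeNth]
      ring

end SmoothNearCalculus

/-! ### Membership in the image of the tangent map, in terms of representatives. -/

namespace MultiGerm

variable {𝕜 : Type*} [RCLike 𝕜] {ι κ : Type*} {n p : ℕ}

theorem mem_range_tf {f : MultiGerm 𝕜 ι n p} {β : ι → SmoothGerms 𝕜 n (Fin p → 𝕜)} :
    β ∈ LinearMap.range f.tf ↔ ∀ i, ∃ h : (Fin n → 𝕜) → (Fin n → 𝕜), SmoothNear 𝕜 h 0 ∧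
      (β i).1 = ((fun x => fderiv 𝕜 (f.branch i) x (h x) : (Fin n → 𝕜) → (Fin p → 𝕜)) :
        Germ (𝓝 (0 : Fin n → 𝕜)) (Fin p → 𝕜)) := by
  constructor
  · rintro ⟨χ, rfl⟩ i
    obtain ⟨h, hh, he⟩ := (χ i).2
    refine ⟨h, hh, ?_⟩
    simp only [tf, LinearMap.coe_mk, AddHom.coe_mk, he, Germ.map₂_coe]
  · intro H
    choose h hh he using H
    refine ⟨fun i => ⟨(h i : Germ (𝓝 (0 : Fin n → 𝕜)) _), h i, hh i, rfl⟩, ?_⟩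
    funext i
    apply Subtype.ext
    rw [he i]
    simp only [tf, LinearMap.coe_mk, AddHom.coe_mk, Germ.map₂_coe]

theorem coe_wf_apply (f : MultiGerm 𝕜 ι n p) {η : SmoothGerms 𝕜 p (Fin p → 𝕜)}
    {h : (Fin p → 𝕜) → (Fin p → 𝕜)} (he : η.1 = (h : Germ (𝓝 (0 : Fin p → 𝕜)) _)) (i : ι) :
    (f.wf η i).1 = ((fun x => h (f.branch i x) : (Fin n → 𝕜) → (Fin p → 𝕜)) :
      Germ (𝓝 (0 : Fin n → 𝕜)) (Fin p → 𝕜)) := by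
  simp only [wf, LinearMap.coe_mk, AddHom.coe_mk, he]
  rfl

end MultiGerm

/-! ### The A_n germ: tangent map, division by P_t, stability. -/

section TypeA

variable {𝕜 : Type*} [RCLike 𝕜] {m : ℕ}

/-- The derivative of the first component of `typeAMap 𝕜 (m + 2) (m + 3)` with respect to the first
variable. -/
def typeADeriv (m : ℕ) (x : Fin (m + 2) → 𝕜) : 𝕜 :=
  ((m + 3 : ℕ) : 𝕜) * x 0 ^ (m + 2)
    + ∑ j : Fin (m + 1), (((j : ℕ) + 1 : ℕ) : 𝕜) * x j.succ * x 0 ^ (j : ℕ)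

theorem typeAMap_apply_zero (N : ℕ) (x : Fin (m + 2) → 𝕜) :
    typeAMap 𝕜 (m + 2) N x 0 = x 0 ^ N + ∑ j : Fin (m + 1), x j.succ * x 0 ^ ((j : ℕ) + 1) := by
  simp only [typeAMap, Fin.val_zero, if_true]
  congr 1
  rw [Finset.sum_erase_eq_sub (Finset.mem_univ _), Fin.sum_univ_succ]
  simp

theorem typeAMap_apply_succ (N : ℕ) (x : Fin (m + 2) → 𝕜) (j : Fin (m + 1)) :
    typeAMap 𝕜 (m + 2) N x j.succ = x j.succ := by
  simp [typeAMap]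

theorem fderiv_typeAMap_apply_succ (N : ℕ) (x v : Fin (m + 2) → 𝕜) (j : Fin (m + 1)) :
    fderiv 𝕜 (typeAMap 𝕜 (m + 2) N) x v j.succ = v j.succ := by
  have hd : DifferentiableAt 𝕜 (typeAMap 𝕜 (m + 2) N) x :=
    (contDiff_typeAMap 𝕜 _ _).differentiable (by simp) x
  have h1 := hasFDerivAt_pi'.1 hd.hasFDerivAt j.succ
  simp only [typeAMap_apply_succ] at h1
  have h2 := h1.unique (hasFDerivAt_apply (𝕜 := 𝕜) j.succ x)
  exact DFunLike.congr_fun h2 v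

theorem fderiv_typeAMap_apply_zero (x v : Fin (m + 2) → 𝕜) :
    fderiv 𝕜 (typeAMap 𝕜 (m + 2) (m + 2 + 1)) x v 0
      = typeADeriv m x * v 0 + ∑ j : Fin (m + 1), x 0 ^ ((j : ℕ) + 1) * v j.succ := by
  have hd : DifferentiableAt 𝕜 (typeAMap 𝕜 (m + 2) (m + 2 + 1)) x :=
    (contDiff_typeAMap 𝕜 _ _).differentiable (by simp) x
  have h1 := hasFDerivAt_pi'.1 hd.hasFDerivAt 0
  simp only [typeAMap_apply_zero] at h1
  have h0 : HasFDerivAt (fun y : Fin (m + 2) → 𝕜 => y 0) (ContinuousLinearMap.proj 0) x :=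
    hasFDerivAt_apply (𝕜 := 𝕜) 0 x
  have h2 := h1.unique ((h0.pow (m + 2 + 1)).add (HasFDerivAt.fun_sum (u := Finset.univ)
    fun (j : Fin (m + 1)) _ =>
      (hasFDerivAt_apply (𝕜 := 𝕜) j.succ x).mul (h0.pow ((j : ℕ) + 1))))
  have h3 := DFunLike.congr_fun h2 v
  simp only [ContinuousLinearMap.comp_apply, ContinuousLinearMap.proj_apply] at h3
  rw [h3]
  simp only [typeADeriv, add_apply, sum_apply,
    FunLike.coe_smul, Pi.smul_apply, ContinuousLinearMap.proj_apply, smul_eq_mul,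
    nsmul_eq_mul, Nat.add_sub_cancel, add_mul, Finset.sum_mul, add_assoc]
  congr 1
  rw [← Finset.sum_add_distrib]
  refine Finset.sum_congr rfl fun j _ => ?_
  push_cast
  ring

/-- A vector field along `typeAMap` is in the image of the tangent map if and only if the
combination of its components eliminating the identity part is a multiple of `typeADeriv`. -/
theorem exists_fderiv_typeAMap_iff {b : (Fin (m + 2) → 𝕜) → Fin (m + 2) → 𝕜}
    (hb : SmoothNear 𝕜 b 0) :
    (∃ h : (Fin (m + 2) → 𝕜) → (Fin (m + 2) → 𝕜), SmoothNear 𝕜 h 0 ∧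
      (b : Germ (𝓝 (0 : Fin (m + 2) → 𝕜)) (Fin (m + 2) → 𝕜))
        = ((fun x => fderiv 𝕜 (typeAMap 𝕜 (m + 2) (m + 2 + 1)) x (h x) :
          (Fin (m + 2) → 𝕜) → (Fin (m + 2) → 𝕜)) :
            Germ (𝓝 (0 : Fin (m + 2) → 𝕜)) (Fin (m + 2) → 𝕜))) ↔
    ∃ χ : (Fin (m + 2) → 𝕜) → 𝕜, SmoothNear 𝕜 χ 0 ∧ ∀ᶠ x in 𝓝 0,
      b x 0 - ∑ j : Fin (m + 1), x 0 ^ ((j : ℕ) + 1) * b x j.succ = typeADeriv m x * χ x := by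
  constructor
  · rintro ⟨h, hh, he⟩
    refine ⟨fun x => h x 0, hh.apply 0, ?_⟩
    filter_upwards [Germ.coe_eq.1 he] with x hx
    simp only [hx, fderiv_typeAMap_apply_zero, fderiv_typeAMap_apply_succ]
    ring
  · rintro ⟨χ, hχ, he⟩
    -- F is the identity in all coordinates but the first, so the other components of the lift are
    -- forced.
    refine ⟨fun x => Fin.cons (χ x) fun j => b x j.succ, SmoothNear.pi fun i => ?_, ?_⟩
    · refine Fin.cases hχ (fun j => ?_) i
      exact hb.apply j.succ
    · apply Germ.coe_eq.2
      filter_upwards [he] with x hx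
      funext i
      refine Fin.cases ?_ (fun j => ?_) i
      · rw [fderiv_typeAMap_apply_zero]
        simp only [Fin.cons_zero, Fin.cons_succ]
        rw [← hx]
        ring
      · rw [fderiv_typeAMap_apply_succ, Fin.cons_succ]

/-- Division by `typeADeriv` with a remainder that is a polynomial of degree at most `m + 1` in the
first variable. -/
theorem exists_division_typeADeriv {h : (Fin (m + 2) → 𝕜) → 𝕜} (hh : SmoothNear 𝕜 h 0) :
    ∃ (q : (Fin (m + 2) → 𝕜) → 𝕜) (r : Fin (m + 2) → (Fin (m + 1) → 𝕜) → 𝕜),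
      SmoothNear 𝕜 q 0 ∧ (∀ i, SmoothNear 𝕜 (r i) 0) ∧
      ∀ᶠ x in 𝓝 0, h x = typeADeriv m x * q x
        + ∑ i, r i (fun j => x j.succ) * x 0 ^ (i : ℕ) := by
  have hN : ((m + 3 : ℕ) : 𝕜) ≠ 0 := Nat.cast_ne_zero.2 (by omega)
  -- P_t / (m + 3) is monic of degree m + 2 with linear coefficients and no term of degree m + 1,
  -- hence the final 0.
  let c : Fin (m + 2) → ((Fin (m + 1) → 𝕜) →L[𝕜] 𝕜) := Fin.snoc
    (fun j : Fin (m + 1) => ((((j : ℕ) + 1 : ℕ) : 𝕜) / ((m + 3 : ℕ) : 𝕜)) •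
      ContinuousLinearMap.proj (R := 𝕜) (φ := fun _ : Fin (m + 1) => 𝕜) j) 0
  obtain ⟨q, r, hq, hr, hd⟩ := exists_coord_division (0 : Fin (m + 2)) (m + 2) c hh
  refine ⟨fun x => ((m + 3 : ℕ) : 𝕜)⁻¹ * q x, r,
    SmoothNear.mul (contDiff_const.smoothNear 0) hq, hr, ?_⟩
  filter_upwards [hd] with x hx
  have hrem : (0 : Fin (m + 2)).removeNth x = fun j => x j.succ := by
    funext j
    simp [Fin.removeNth]
  rw [hx, hrem]
  congr 1
  rw [Fin.sum_univ_castSucc]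
  simp only [c, Fin.snoc_castSucc, Fin.snoc_last, zero_apply, zero_mul,
    add_zero, FunLike.coe_smul, Pi.smul_apply, ContinuousLinearMap.proj_apply,
    smul_eq_mul, Fin.val_castSucc, typeADeriv]
  have : ∀ j : Fin (m + 1), (((j : ℕ) + 1 : ℕ) : 𝕜) / ((m + 3 : ℕ) : 𝕜) * x j.succ * x 0 ^ (j : ℕ)
      = ((m + 3 : ℕ) : 𝕜)⁻¹ * ((((j : ℕ) + 1 : ℕ) : 𝕜) * x j.succ * x 0 ^ (j : ℕ)) := fun j => by
    rw [div_eq_inv_mul]; ring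
  simp only [this]
  rw [← Finset.mul_sum]
  field_simp

/-- The `A_n` germ is infinitesimally stable. -/
theorem exists_typeAMap_stable {b : (Fin (m + 2) → 𝕜) → Fin (m + 2) → 𝕜}
    (hb : SmoothNear 𝕜 b 0) :
    ∃ e : (Fin (m + 2) → 𝕜) → Fin (m + 2) → 𝕜, SmoothNear 𝕜 e 0 ∧
      ∃ χ : (Fin (m + 2) → 𝕜) → 𝕜, SmoothNear 𝕜 χ 0 ∧ ∀ᶠ x in 𝓝 0,
        (b x 0 - e (typeAMap 𝕜 (m + 2) (m + 2 + 1) x) 0)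
          - ∑ j : Fin (m + 1), x 0 ^ ((j : ℕ) + 1) *
            (b x j.succ - e (typeAMap 𝕜 (m + 2) (m + 2 + 1) x) j.succ) = typeADeriv m x * χ x := by
  obtain ⟨q, r, hq, hr, hd⟩ := exists_division_typeADeriv
    (h := fun x => b x 0 - ∑ j : Fin (m + 1), x 0 ^ ((j : ℕ) + 1) * b x j.succ)
    ((hb.apply 0).sub (SmoothNear.sum fun j _ => SmoothNear.mul
      (ContDiff.smoothNear (by fun_prop) 0) (hb.apply _)))
  have htail : SmoothNear 𝕜 (fun X : Fin (m + 2) → 𝕜 => fun j : Fin (m + 1) => X j.succ) 0 :=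
    ContDiff.smoothNear (by fun_prop) 0
  -- The remainder coefficients depend only on coordinates that F preserves, so they are functions
  -- of the target. The signs match those in the combination b₀ - ∑ t^j b_j.
  refine ⟨fun X => Fin.cons (r 0 fun j => X j.succ) fun i => -r i.succ fun j => X j.succ,
    SmoothNear.pi fun i => ?_, q, hq, ?_⟩
  · refine Fin.cases ?_ (fun i => ?_) i
    · exact (hr 0).comp_of_eq htail rfl
    · exact ((hr i.succ).comp_of_eq htail rfl).neg
  · filter_upwards [hd] with x hx
    rw [Fin.sum_univ_succ (fun i => r i (fun j => x j.succ) * x 0 ^ (i : ℕ))] at hx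
    simp only [Fin.cons_zero, Fin.cons_succ, typeAMap_apply_succ, mul_sub, mul_neg,
      Finset.sum_sub_distrib, Finset.sum_neg_distrib, Fin.val_zero, pow_zero, mul_one,
      Fin.val_succ] at hx ⊢
    have : ∀ i : Fin (m + 1), x 0 ^ ((i : ℕ) + 1) * r i.succ (fun j => x j.succ)
        = r i.succ (fun j => x j.succ) * x 0 ^ ((i : ℕ) + 1) := fun i => mul_comm _ _
    simp only [this]
    linear_combination hx

theorem isStable_germF : (germF 𝕜 m).IsStable := by
  rw [MultiGerm.IsStable, eq_top_iff]
  intro β _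
  obtain ⟨b, hb, hbe⟩ := (β ()).2
  obtain ⟨e, he, hχ⟩ := exists_typeAMap_stable hb
  let η : SmoothGerms 𝕜 (m + 2) (Fin (m + 2) → 𝕜) := 
    ⟨(e : Germ (𝓝 (0 : Fin (m + 2) → 𝕜)) (Fin (m + 2) → 𝕜)), e, he, rfl⟩
  have hF : SmoothNear 𝕜 (typeAMap 𝕜 (m + 2) (m + 2 + 1)) 0 :=
    (contDiff_typeAMap 𝕜 _ _).smoothNear 0
  have h1 : β - (germF 𝕜 m).wf η ∈ LinearMap.range (germF 𝕜 m).tf := by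
    rw [MultiGerm.mem_range_tf]
    rintro ⟨⟩
    have hbs : SmoothNear 𝕜 (fun x => b x - e (typeAMap 𝕜 (m + 2) (m + 2 + 1) x)) 0 :=
      hb.sub (he.comp_of_eq hF (typeAMap_zero 𝕜 _ _))
    obtain ⟨h, hh, hhe⟩ := (exists_fderiv_typeAMap_iff hbs).2 hχ
    refine ⟨h, hh, ?_⟩
    rw [Pi.sub_apply, Submodule.coe_sub, hbe, (germF 𝕜 m).coe_wf_apply (h := e) rfl]
    exact hhe
  have h2 := Submodule.add_mem_sup h1 (LinearMap.mem_range_self (germF 𝕜 m).wf η)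
  rwa [sub_add_cancel] at h2

theorem isStableUnfolding_germF (hm : 1 ≤ m) :
    (germf 𝕜 m).IsStableUnfolding₂ (germF 𝕜 m) := by
  refine ⟨fun _ => Eventually.of_forall fun x j => ?_, fun _ => Eventually.of_forall fun x j => ?_,
    isStable_germF⟩
  · have h0 : m + (j : ℕ) ≠ 0 := by omega
    simp only [germF, MultiGerm.mono, typeAMap, Fin.val_natAdd, h0, if_false]
  · simp only [germF, germf, MultiGerm.mono, typeAMap, Fin.val_castAdd, Fin.append_left]
    split_ifs with hj
    · rw [Finset.sum_erase_eq_sub (Finset.mem_univ _), Finset.sum_erase_eq_sub (Finset.mem_univ _),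
        Fin.sum_univ_add]
      simp
    · rfl

end TypeA

/-! ### The cuspidal edge: critical set and image of the tangent map. -/

section Cusp

variable {𝕜 : Type*} [RCLike 𝕜] {m : ℕ}

/-- The parametrisation `(x₁, …, x_m, z) ↦ (x₁, …, x_m, -3z², z)` of the critical set of
`cuspMap`. -/
def cuspCritical (u : Fin (m + 1) → 𝕜) : Fin (m + 2) → 𝕜 :=
  Fin.snoc (Fin.snoc (fun i : Fin m => u i.castSucc) (-3 * u (Fin.last m) ^ 2) :
    Fin (m + 1) → 𝕜) (u (Fin.last m))

/-- The projection `(x₁, …, x_m, y, z) ↦ (x₁, …, x_m, z)`. -/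
def dropY (x : Fin (m + 2) → 𝕜) : Fin (m + 1) → 𝕜 :=
  Fin.snoc (fun i : Fin m => x i.castSucc.castSucc) (x (idxZ m))

@[simp] theorem dropY_last (x : Fin (m + 2) → 𝕜) : dropY x (Fin.last m) = x (idxZ m) := by
  simp [dropY]

@[simp] theorem dropY_castSucc (x : Fin (m + 2) → 𝕜) (i : Fin m) :
    dropY x i.castSucc = x i.castSucc.castSucc := by
  simp [dropY]

@[simp] theorem cuspCritical_idxZ (u : Fin (m + 1) → 𝕜) :
    cuspCritical u (idxZ m) = u (Fin.last m) := by
  simp [cuspCritical]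

@[simp] theorem cuspCritical_idxY (u : Fin (m + 1) → 𝕜) :
    cuspCritical u (idxY m) = -3 * u (Fin.last m) ^ 2 := by
  simp [cuspCritical]

@[simp] theorem cuspCritical_castSucc (u : Fin (m + 1) → 𝕜) (i : Fin m) :
    cuspCritical u i.castSucc.castSucc = u i.castSucc := by
  simp [cuspCritical]

@[simp] theorem cuspParam_idxZ (u : Fin (m + 1) → 𝕜) :
    cuspParam 𝕜 m u (idxZ m) = -2 * u (Fin.last m) ^ 3 := by
  simp [cuspParam]

@[simp] theorem cuspParam_idxY (u : Fin (m + 1) → 𝕜) :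
    cuspParam 𝕜 m u (idxY m) = -3 * u (Fin.last m) ^ 2 := by
  simp [cuspParam]

@[simp] theorem cuspParam_castSucc (u : Fin (m + 1) → 𝕜) (i : Fin m) :
    cuspParam 𝕜 m u i.castSucc.castSucc = u i.castSucc := by
  simp [cuspParam]

theorem dropY_cuspCritical (u : Fin (m + 1) → 𝕜) : dropY (cuspCritical u) = u := by
  funext i
  induction i using Fin.lastCases with
  | last => simp
  | cast i => simp

theorem idxY_ne_idxZ : idxY m ≠ idxZ m := (Fin.castSucc_lt_last _).ne

theorem cuspMap_cuspCritical (u : Fin (m + 1) → 𝕜) :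
    cuspMap 𝕜 m (cuspCritical u) = cuspParam 𝕜 m u := by
  funext i
  induction i using Fin.lastCases with
  | last =>
    simp only [cuspMap, if_true, cuspCritical_idxZ, cuspCritical_idxY]
    rw [cuspParam_idxZ]
    ring
  | cast i =>
    simp only [cuspMap, (Fin.castSucc_lt_last i).ne, if_false]
    induction i using Fin.lastCases with
    | last => rw [cuspParam_idxY, cuspCritical_idxY]
    | cast i => simp

theorem contDiff_cuspCritical : ContDiff 𝕜 ∞ (cuspCritical (𝕜 := 𝕜) (m := m)) := by
  rw [contDiff_pi]
  intro i
  induction i using Fin.lastCases with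
  | last => simp only [cuspCritical_idxZ]; fun_prop
  | cast i =>
    induction i using Fin.lastCases with
    | last => simp only [cuspCritical_idxY]; fun_prop
    | cast i => simp only [cuspCritical_castSucc]; fun_prop

theorem contDiff_dropY : ContDiff 𝕜 ∞ (dropY (𝕜 := 𝕜) (m := m)) := by
  rw [contDiff_pi]
  intro i
  induction i using Fin.lastCases with
  | last => simp only [dropY_last]; fun_prop
  | cast i => simp only [dropY_castSucc]; fun_prop

theorem cuspCritical_zero : cuspCritical (0 : Fin (m + 1) → 𝕜) = 0 := by
  funext i
  induction i using Fin.lastCases with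
  | last => simp
  | cast i =>
    induction i using Fin.lastCases with
    | last => simp
    | cast i => simp

theorem dropY_zero : dropY (0 : Fin (m + 2) → 𝕜) = 0 := by
  funext i
  induction i using Fin.lastCases with
  | last => simp
  | cast i => simp

theorem tendsto_dropY : Tendsto (dropY (𝕜 := 𝕜) (m := m)) (𝓝 0) (𝓝 0) := by
  have h := (contDiff_dropY (𝕜 := 𝕜) (m := m)).continuous.tendsto 0
  rwa [dropY_zero] at h

theorem tendsto_cuspCritical : Tendsto (cuspCritical (𝕜 := 𝕜) (m := m)) (𝓝 0) (𝓝 0) := by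
  have h := (contDiff_cuspCritical (𝕜 := 𝕜) (m := m)).continuous.tendsto 0
  rwa [cuspCritical_zero] at h

theorem removeNth_idxY (x : Fin (m + 2) → 𝕜) : (idxY m).removeNth x = dropY x := by
  funext i
  induction i using Fin.lastCases with
  | last => simp [Fin.removeNth]
  | cast i =>
    have h : (idxY m).succAbove i.castSucc = i.castSucc.castSucc :=
      Fin.succAbove_of_castSucc_lt _ _ (by simp [Fin.lt_def])
    simp only [Fin.removeNth, h, dropY_castSucc]

/-- A smooth germ is divisible by `3z² + y` if and only if it vanishes on its zero set. -/
theorem exists_eq_mul_cusp_iff {h : (Fin (m + 2) → 𝕜) → 𝕜} (hh : SmoothNear 𝕜 h 0) :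
    (∃ χ : (Fin (m + 2) → 𝕜) → 𝕜, SmoothNear 𝕜 χ 0 ∧
      ∀ᶠ x in 𝓝 0, h x = (3 * x (idxZ m) ^ 2 + x (idxY m)) * χ x) ↔
    ∀ᶠ u in 𝓝 0, h (cuspCritical u) = 0 := by
  constructor
  · rintro ⟨χ, -, he⟩
    filter_upwards [tendsto_cuspCritical.eventually he] with u hu
    rw [hu]
    simp
  · intro H
    -- A shear in y that straightens the critical set y = -3z² to y = 0, where division by the
    -- coordinate y suffices; the remainder is the restriction to the critical set.
    let S : 𝕜 → (Fin (m + 2) → 𝕜) → Fin (m + 2) → 𝕜 := fun a x i =>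
      if i = idxY m then x (idxY m) + a * x (idxZ m) ^ 2 else x i
    have hSY : ∀ a x, S a x (idxY m) = x (idxY m) + a * x (idxZ m) ^ 2 := fun a x => if_pos rfl
    have hSZ : ∀ a x, S a x (idxZ m) = x (idxZ m) := fun a x => if_neg idxY_ne_idxZ.symm
    have hS : ∀ a, ContDiff 𝕜 ∞ (S a) := fun a => by
      rw [contDiff_pi]
      intro i
      by_cases hi : i = idxY m
      · simp only [S, hi, if_true]; fun_prop
      · simp only [S, hi, if_false]; fun_prop
    have hS0 : ∀ a, S a 0 = 0 := fun a => by
      funext i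
      by_cases hi : i = idxY m <;> simp [S, hi]
    have hSS : ∀ a x, S (-a) (S a x) = x := fun a x => by
      funext i
      by_cases hi : i = idxY m
      · subst hi
        rw [hSY, hSY, hSZ]; ring
      · simp [S, hi]
    have hdS : ∀ a x, dropY (S a x) = dropY x := fun a x => by
      funext i
      induction i using Fin.lastCases with
      | last => simp [hSZ]
      | cast i =>
        simp only [dropY_castSucc, S]
        rw [if_neg]
        exact fun h => (Fin.castSucc_lt_last i).ne (Fin.castSucc_injective _ h)
    obtain ⟨q, r, hq, -, hd⟩ := exists_coord_division (idxY m) 1 (fun _ => 0)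
      (hh.comp_of_eq ((hS (-3)).smoothNear 0) (hS0 (-3)))
    have ht : Tendsto (S 3) (𝓝 0) (𝓝 0) := by
      simpa only [hS0] using (hS 3).continuous.tendsto 0
    have hd' : ∀ᶠ x in 𝓝 0, h x = (3 * x (idxZ m) ^ 2 + x (idxY m)) * q (S 3 x)
        + r 0 (dropY x) := by
      filter_upwards [ht.eventually hd] with x hx
      rw [hSS] at hx
      simp only [Fin.sum_univ_one, removeNth_idxY, hdS, hSY, zero_apply, Fin.val_zero, pow_zero,
        mul_one, add_zero, pow_one] at hx
      rw [hx]
      ring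
    have hr : ∀ᶠ u in 𝓝 0, r 0 u = 0 := by
      filter_upwards [tendsto_cuspCritical.eventually hd', H] with u h1 h2
      rw [h2, dropY_cuspCritical] at h1
      simp only [cuspCritical_idxY, cuspCritical_idxZ] at h1
      linear_combination -h1
    refine ⟨fun x => q (S 3 x), hq.comp_of_eq ((hS 3).smoothNear 0) (hS0 3), ?_⟩
    filter_upwards [hd', tendsto_dropY.eventually hr] with x h1 h2
    rw [h1, h2, add_zero]

theorem fderiv_cuspMap_apply_of_ne (x v : Fin (m + 2) → 𝕜) {i : Fin (m + 2)} (hi : i ≠ idxZ m) :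
    fderiv 𝕜 (cuspMap 𝕜 m) x v i = v i := by
  have hd : DifferentiableAt 𝕜 (cuspMap 𝕜 m) x :=
    (contDiff_cuspMap 𝕜 _).differentiable (by simp) x
  have h1 := hasFDerivAt_pi'.1 hd.hasFDerivAt i
  simp only [cuspMap, hi, if_false] at h1
  exact DFunLike.congr_fun (h1.unique (hasFDerivAt_apply (𝕜 := 𝕜) i x)) v

theorem fderiv_cuspMap_apply_idxZ (x v : Fin (m + 2) → 𝕜) :
    fderiv 𝕜 (cuspMap 𝕜 m) x v (idxZ m)
      = (3 * x (idxZ m) ^ 2 + x (idxY m)) * v (idxZ m) + x (idxZ m) * v (idxY m) := by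
  have hd : DifferentiableAt 𝕜 (cuspMap 𝕜 m) x :=
    (contDiff_cuspMap 𝕜 _).differentiable (by simp) x
  have h1 := hasFDerivAt_pi'.1 hd.hasFDerivAt (idxZ m)
  simp only [cuspMap, if_true] at h1
  have hz : HasFDerivAt (fun y : Fin (m + 2) → 𝕜 => y (idxZ m))
    (ContinuousLinearMap.proj (idxZ m)) x := hasFDerivAt_apply (𝕜 := 𝕜) (idxZ m) x
  have hy : HasFDerivAt (fun y : Fin (m + 2) → 𝕜 => y (idxY m))
    (ContinuousLinearMap.proj (idxY m)) x := hasFDerivAt_apply (𝕜 := 𝕜) (idxY m) x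
  have h3 := DFunLike.congr_fun (h1.unique ((hz.pow 3).add (hy.mul hz))) v
  simp only [ContinuousLinearMap.comp_apply, ContinuousLinearMap.proj_apply] at h3
  rw [h3]
  simp only [add_apply, FunLike.coe_smul, Pi.smul_apply, ContinuousLinearMap.proj_apply,
    smul_eq_mul, nsmul_eq_mul]
  push_cast
  ring

/-- All components of the lift except the Z one are forced. The last one is the quotient of b_Z - z
b_Y by 3z² + y, and divisibility is tested on the critical set. -/
theorem exists_fderiv_cuspMap_iff {b : (Fin (m + 2) → 𝕜) → Fin (m + 2) → 𝕜}
    (hb : SmoothNear 𝕜 b 0) :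
    (∃ h : (Fin (m + 2) → 𝕜) → (Fin (m + 2) → 𝕜), SmoothNear 𝕜 h 0 ∧
      (b : Germ (𝓝 (0 : Fin (m + 2) → 𝕜)) (Fin (m + 2) → 𝕜))
        = ((fun x => fderiv 𝕜 (cuspMap 𝕜 m) x (h x) :
          (Fin (m + 2) → 𝕜) → (Fin (m + 2) → 𝕜)) :
            Germ (𝓝 (0 : Fin (m + 2) → 𝕜)) (Fin (m + 2) → 𝕜))) ↔
    ∀ᶠ u in 𝓝 (0 : Fin (m + 1) → 𝕜),
      b (cuspCritical u) (idxZ m) - u (Fin.last m) * b (cuspCritical u) (idxY m) = 0 := by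
  have hz : SmoothNear 𝕜 (fun x : Fin (m + 2) → 𝕜 => x (idxZ m)) 0 :=
    ContDiff.smoothNear (by fun_prop) 0
  have hs : SmoothNear 𝕜 (fun x => b x (idxZ m) - x (idxZ m) * b x (idxY m)) 0 :=
    (hb.apply _).sub (hz.mul (hb.apply _))
  have hiff := exists_eq_mul_cusp_iff hs
  simp only [cuspCritical_idxZ] at hiff
  rw [← hiff]
  constructor
  · rintro ⟨h, hh, he⟩
    refine ⟨fun x => h x (idxZ m), hh.apply _, ?_⟩
    filter_upwards [Germ.coe_eq.1 he] with x hx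
    simp only [hx, fderiv_cuspMap_apply_idxZ, fderiv_cuspMap_apply_of_ne _ _ idxY_ne_idxZ]
    ring
  · rintro ⟨χ, hχ, he⟩
    refine ⟨fun x i => if i = idxZ m then χ x else b x i, SmoothNear.pi fun i => ?_, ?_⟩
    · by_cases hi : i = idxZ m
      · simpa only [hi, if_true] using hχ
      · simpa only [hi, if_false] using hb.apply i
    · apply Germ.coe_eq.2
      filter_upwards [he] with x hx
      funext i
      by_cases hi : i = idxZ m
      · subst hi
        rw [fderiv_cuspMap_apply_idxZ, if_pos rfl, if_neg idxY_ne_idxZ, ← hx]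
        ring
      · rw [fderiv_cuspMap_apply_of_ne _ _ hi, if_neg hi]

end Cusp

namespace MultiGerm

variable {𝕜 : Type*} [RCLike 𝕜] {ι κ : Type*} {n p : ℕ}

theorem mem_range_tf_concat {f : MultiGerm 𝕜 ι n p} {g : MultiGerm 𝕜 κ n p}
    {β : ι ⊕ κ → SmoothGerms 𝕜 n (Fin p → 𝕜)} :
    β ∈ LinearMap.range (f.concat g).tf ↔
      (fun i => β (Sum.inl i)) ∈ LinearMap.range f.tf ∧
      (fun i => β (Sum.inr i)) ∈ LinearMap.range g.tf := by
  simp only [mem_range_tf, Sum.forall]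
  rfl

end MultiGerm

/-! ### Identification of the normal space of {F, g} with the quotient by T_Σ. -/

section CuspidalConcat

variable {𝕜 : Type*} [RCLike 𝕜] {m : ℕ}

theorem mem_range_tf_germg {β : Unit → SmoothGerms 𝕜 (m + 2) (Fin (m + 2) → 𝕜)}
    {b : (Fin (m + 2) → 𝕜) → Fin (m + 2) → 𝕜} (hb : SmoothNear 𝕜 b 0)
    (hbe : (β ()).1 = (b : Germ (𝓝 (0 : Fin (m + 2) → 𝕜)) (Fin (m + 2) → 𝕜))) :
    β ∈ LinearMap.range (germg 𝕜 m).tf ↔ ∀ᶠ u in 𝓝 (0 : Fin (m + 1) → 𝕜),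
      b (cuspCritical u) (idxZ m) - u (Fin.last m) * b (cuspCritical u) (idxY m) = 0 := by
  rw [MultiGerm.mem_range_tf, ← exists_fderiv_cuspMap_iff hb]
  simp only [Unique.forall_iff, PUnit.default_eq_unit, hbe]
  rfl

theorem mem_range_tf_germF {β : Unit → SmoothGerms 𝕜 (m + 2) (Fin (m + 2) → 𝕜)}
    {b : (Fin (m + 2) → 𝕜) → Fin (m + 2) → 𝕜} (hb : SmoothNear 𝕜 b 0)
    (hbe : (β ()).1 = (b : Germ (𝓝 (0 : Fin (m + 2) → 𝕜)) (Fin (m + 2) → 𝕜))) :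
    β ∈ LinearMap.range (germF 𝕜 m).tf ↔
    ∃ χ : (Fin (m + 2) → 𝕜) → 𝕜, SmoothNear 𝕜 χ 0 ∧ ∀ᶠ x in 𝓝 0,
      b x 0 - ∑ j : Fin (m + 1), x 0 ^ ((j : ℕ) + 1) * b x j.succ = typeADeriv m x * χ x := by
  rw [MultiGerm.mem_range_tf, ← exists_fderiv_typeAMap_iff hb]
  simp only [Unique.forall_iff, PUnit.default_eq_unit, hbe]
  rfl

/-- The germ of `-z η_{n-1}(x, -3z², -2z³) + η_n(x, -3z², -2z³)` for a representative. -/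
theorem coe_cuspRestrict {η : SmoothGerms 𝕜 (m + 2) (Fin (m + 2) → 𝕜)}
    {e : (Fin (m + 2) → 𝕜) → Fin (m + 2) → 𝕜}
    (he : η.1 = (e : Germ (𝓝 (0 : Fin (m + 2) → 𝕜)) (Fin (m + 2) → 𝕜))) :
    (cuspRestrict 𝕜 m η).1 = ((fun u => -u (Fin.last m) * e (cuspParam 𝕜 m u) (idxY m)
      + e (cuspParam 𝕜 m u) (idxZ m) : (Fin (m + 1) → 𝕜) → 𝕜) :
        Germ (𝓝 (0 : Fin (m + 1) → 𝕜)) 𝕜) := by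
  simp only [cuspRestrict, LinearMap.coe_mk, AddHom.coe_mk, he]
  rfl

/-- The map `ξ(x, z) ↦ (0, ξ ∂/∂Z)`. -/
def lastField (𝕜 : Type*) [RCLike 𝕜] (m : ℕ) :
    SmoothGerms 𝕜 (m + 1) 𝕜 →ₗ[𝕜] (Unit ⊕ Unit → SmoothGerms 𝕜 (m + 2) (Fin (m + 2) → 𝕜)) where
  toFun ξ := Sum.elim 0 fun _ => ⟨(ξ.1.compTendsto dropY tendsto_dropY).map
      (Pi.single (M := fun _ : Fin (m + 2) => 𝕜) (idxZ m)), by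
    obtain ⟨h, hh, he⟩ := ξ.2
    rw [he]
    refine ⟨fun x => Pi.single (idxZ m) (h (dropY x)), SmoothNear.pi fun i => ?_, rfl⟩
    by_cases hi : i = idxZ m
    · subst hi
      simpa only [Pi.single_eq_same] using hh.comp_of_eq (contDiff_dropY.smoothNear 0) dropY_zero
    · simpa only [Pi.single_eq_of_ne hi] using contDiff_const.smoothNear 0⟩
  map_add' ξ ξ' := by
    funext i
    rcases i with i | i
    · simp
    · apply Subtype.ext
      obtain ⟨h, -, he⟩ := ξ.2
      obtain ⟨h', -, he'⟩ := ξ'.2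
      simp only [Submodule.coe_add, he, he', Sum.elim_inr, Pi.add_apply, ← Germ.coe_add,
        Germ.coe_compTendsto, Germ.map_coe]
      congr 1
      funext x
      simp [Function.comp, Pi.single_add]
  map_smul' c ξ := by
    funext i
    rcases i with i | i
    · simp
    · apply Subtype.ext
      obtain ⟨h, -, he⟩ := ξ.2
      simp only [Submodule.coe_smul, he, Sum.elim_inr, Pi.smul_apply, ← Germ.coe_smul,
        Germ.coe_compTendsto, Germ.map_coe, RingHom.id_apply]
      congr 1
      funext x
      simp only [Function.comp, Pi.smul_apply]
      exact Pi.single_smul (idxZ m) c _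

theorem lastField_inl (ξ : SmoothGerms 𝕜 (m + 1) 𝕜) (i : Unit) :
    lastField 𝕜 m ξ (Sum.inl i) = 0 := rfl

theorem coe_lastField_inr {ξ : SmoothGerms 𝕜 (m + 1) 𝕜} {h : (Fin (m + 1) → 𝕜) → 𝕜}
    (he : ξ.1 = (h : Germ (𝓝 (0 : Fin (m + 1) → 𝕜)) 𝕜)) (i : Unit) :
    (lastField 𝕜 m ξ (Sum.inr i)).1 = ((fun x => Pi.single (idxZ m) (h (dropY x)) :
      (Fin (m + 2) → 𝕜) → Fin (m + 2) → 𝕜) :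
        Germ (𝓝 (0 : Fin (m + 2) → 𝕜)) (Fin (m + 2) → 𝕜)) := by
  simp only [lastField, LinearMap.coe_mk, AddHom.coe_mk, he, Sum.elim_inr]
  rfl

theorem lastField_monomialGerm (a : Fin (m + 2)) :
    lastField 𝕜 m (monomialGerm 𝕜 m a) = monomialField 𝕜 m a := by
  funext i
  rcases i with i | i
  · rfl
  · apply Subtype.ext
    rw [coe_lastField_inr (h := fun u => basisMonomial (fun i => u i.castSucc) (u (Fin.last m)) a)
      rfl]
    simp only [dropY_castSucc, dropY_last]
    rfl

/-- The branch of `ξ ∂/∂Z - η ∘ g` over `g` is tangent exactly when `ξ` is the restriction of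
`η`. -/
theorem lastField_sub_wf_mem_iff {F : MultiGerm 𝕜 Unit (m + 2) (m + 2)}
    (ξ : SmoothGerms 𝕜 (m + 1) 𝕜) (η : SmoothGerms 𝕜 (m + 2) (Fin (m + 2) → 𝕜)) :
    (fun i => (lastField 𝕜 m ξ - (cuspidalConcat F).wf η) (Sum.inr i))
      ∈ LinearMap.range (germg 𝕜 m).tf ↔ cuspRestrict 𝕜 m η = ξ := by
  obtain ⟨h, hh, hhe⟩ := ξ.2
  obtain ⟨e, he, hee⟩ := η.2
  have hs1 : SmoothNear 𝕜 (fun x : Fin (m + 2) → 𝕜 =>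
      (Pi.single (idxZ m) (h (dropY x)) : Fin (m + 2) → 𝕜)) 0 :=
    ((ContinuousLinearMap.single 𝕜 (fun _ : Fin (m + 2) => 𝕜)
      (idxZ m)).contDiff.smoothNear _).comp_of_eq
      (hh.comp_of_eq (contDiff_dropY.smoothNear 0) dropY_zero) rfl
  have hs2 : SmoothNear 𝕜 (fun x : Fin (m + 2) → 𝕜 => e (cuspMap 𝕜 m x)) 0 :=
    he.comp_of_eq ((contDiff_cuspMap 𝕜 m).smoothNear 0) ((germg 𝕜 m).map_zero ())
  rw [mem_range_tf_germg (hs1.sub hs2) (by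
    rw [Pi.sub_apply, Submodule.coe_sub, coe_lastField_inr hhe,
      (cuspidalConcat F).coe_wf_apply hee]
    rfl)]
  rw [Subtype.ext_iff, coe_cuspRestrict hee, hhe, Germ.coe_eq]
  refine eventually_congr (Eventually.of_forall fun u => ?_)
  simp only [Pi.sub_apply, Pi.single_eq_same, Pi.single_eq_of_ne idxY_ne_idxZ, dropY_cuspCritical,
    cuspMap_cuspCritical]
  constructor <;> intro H <;> linear_combination -H

/-- The same η serves both branches: on F, whose component is zero, it must be liftable, and on g it
must restrict to ξ along the critical set. -/
theorem lastField_mem_tangentAe_iff {F : MultiGerm 𝕜 Unit (m + 2) (m + 2)}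
    (ξ : SmoothGerms 𝕜 (m + 1) 𝕜) :
    lastField 𝕜 m ξ ∈ (cuspidalConcat F).tangentAe ↔ ξ ∈ TSigma F := by
  have hF : ∀ η, (fun i => (lastField 𝕜 m ξ - (cuspidalConcat F).wf η) (Sum.inl i))
      ∈ LinearMap.range F.tf ↔ η ∈ F.Lift := fun η => by
    have : (fun i => (lastField 𝕜 m ξ - (cuspidalConcat F).wf η) (Sum.inl i)) = -F.wf η := by
      funext i
      rw [Pi.sub_apply, lastField_inl, zero_sub]
      rfl
    rw [this, neg_mem_iff]
    rfl
  have key : ∀ η, lastField 𝕜 m ξ - (cuspidalConcat F).wf η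
      ∈ LinearMap.range (cuspidalConcat F).tf ↔ η ∈ F.Lift ∧ cuspRestrict 𝕜 m η = ξ := fun η => by
    rw [← hF η, ← lastField_sub_wf_mem_iff (F := F) ξ η]
    exact MultiGerm.mem_range_tf_concat
  constructor
  · intro H
    obtain ⟨y, hy, w, ⟨η, rfl⟩, hyw⟩ := Submodule.mem_sup.1 H
    exact ⟨η, (key η).1 (by rwa [← hyw, add_sub_cancel_right])⟩
  · rintro ⟨η, h1, h2⟩
    have := Submodule.add_mem_sup ((key η).2 ⟨h1, h2⟩)
      (LinearMap.mem_range_self (cuspidalConcat F).wf η)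
    rwa [sub_add_cancel] at this

/-- Every class in `N𝒜ₑ({F, g})` is represented by some `(0, ξ ∂/∂Z)` when `F` is stable. -/
theorem exists_sub_lastField_mem {F : MultiGerm 𝕜 Unit (m + 2) (m + 2)} (hF : F.IsStable)
    (β : Unit ⊕ Unit → SmoothGerms 𝕜 (m + 2) (Fin (m + 2) → 𝕜)) :
    ∃ ξ, β - lastField 𝕜 m ξ ∈ (cuspidalConcat F).tangentAe := by
  have h1 : (fun i => β (Sum.inl i)) ∈ F.tangentAe := by
    rw [hF]
    trivial
  -- Stability gives an η that clears the F-branch; subtracting it alters the g-branch, whose class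
  -- is then read off on the critical set as b_Z - z b_Y.
  obtain ⟨y, hy, w, ⟨η, rfl⟩, hyw⟩ := Submodule.mem_sup.1 h1
  obtain ⟨b, hb, hbe⟩ := ((β - (cuspidalConcat F).wf η) (Sum.inr ())).2
  let h : (Fin (m + 1) → 𝕜) → 𝕜 := fun u =>
    b (cuspCritical u) (idxZ m) - u (Fin.last m) * b (cuspCritical u) (idxY m)
  have hbc := hb.comp_of_eq (contDiff_cuspCritical.smoothNear 0) cuspCritical_zero
  have hh : SmoothNear 𝕜 h 0 := (hbc.apply (idxZ m)).sub
    (SmoothNear.mul (ContDiff.smoothNear (by fun_prop) 0) (hbc.apply (idxY m)))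
  let ξ : SmoothGerms 𝕜 (m + 1) 𝕜 := ⟨(h : Germ (𝓝 (0 : Fin (m + 1) → 𝕜)) 𝕜), h, hh, rfl⟩
  have hs1 : SmoothNear 𝕜 (fun x : Fin (m + 2) → 𝕜 =>
      (Pi.single (idxZ m) (h (dropY x)) : Fin (m + 2) → 𝕜)) 0 :=
    ((ContinuousLinearMap.single 𝕜 (fun _ : Fin (m + 2) => 𝕜)
      (idxZ m)).contDiff.smoothNear _).comp_of_eq
      (hh.comp_of_eq (contDiff_dropY.smoothNear 0) dropY_zero) rfl
  refine ⟨ξ, ?_⟩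
  have h2 : β - lastField 𝕜 m ξ - (cuspidalConcat F).wf η
      ∈ LinearMap.range (cuspidalConcat F).tf := by
    refine MultiGerm.mem_range_tf_concat.2 ⟨?_, ?_⟩
    · convert hy using 1
      rw [← eq_sub_iff_add_eq] at hyw
      rw [hyw]
      funext i
      rw [Pi.sub_apply, Pi.sub_apply, lastField_inl, sub_zero]
      rfl
    · rw [mem_range_tf_germg (hb.sub hs1) (by
        rw [sub_right_comm, Pi.sub_apply, Submodule.coe_sub, coe_lastField_inr (h := h) rfl, hbe]
        rfl)]
      refine Eventually.of_forall fun u => ?_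
      simp only [Pi.sub_apply, Pi.single_eq_same, Pi.single_eq_of_ne idxY_ne_idxZ,
        dropY_cuspCritical, h]
      ring
  have := Submodule.add_mem_sup h2 (LinearMap.mem_range_self (cuspidalConcat F).wf η)
  rwa [sub_add_cancel] at this

/-- `ξ ↦ (0, ξ ∂/∂Z)` identifies `𝒪_{n-1} / T_Σ` with `N𝒜ₑ({F, g})` when `F` is stable. -/
theorem exists_quotient_TSigma_equiv {F : MultiGerm 𝕜 Unit (m + 2) (m + 2)} (hF : F.IsStable) :
    ∃ E : (SmoothGerms 𝕜 (m + 1) 𝕜 ⧸ TSigma F) ≃ₗ[𝕜] (cuspidalConcat F).NAe,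
      ∀ ξ, E ((TSigma F).mkQ ξ) = (cuspidalConcat F).tangentAe.mkQ (lastField 𝕜 m ξ) := by
  let L := (cuspidalConcat F).tangentAe.mkQ ∘ₗ lastField 𝕜 m
  have hker : LinearMap.ker L = TSigma F := by
    ext ξ
    rw [← lastField_mem_tangentAe_iff]
    simp [L]
  have hsurj : Function.Surjective L := by
    intro y
    obtain ⟨β, rfl⟩ := Submodule.mkQ_surjective _ y
    obtain ⟨ξ, hξ⟩ := exists_sub_lastField_mem hF β
    refine ⟨ξ, ?_⟩
    exact ((Submodule.Quotient.eq _).2 hξ).symm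
  exact ⟨(Submodule.quotEquivOfEq _ _ hker.symm).trans (L.quotKerEquivOfSurjective hsurj),
    fun ξ => rfl⟩

end CuspidalConcat

/-! ### The Nakayama argument, in abstract form. -/

section CuspAlgebra

variable {K A : Type*} [Field K] [CommRing A] [Algebra K A] {R : Subalgebra K A}
  {T : Submodule R A} {B : ℕ → R} {z : A} {m : ℕ} {c d : ℕ → K}

theorem smul_smul_span_le {I : Ideal R} (hI : I = Ideal.span (B '' Set.Iic (m + 2)))
    {Q : Submodule R A} (h1 : ∀ i ≤ m + 2, ∀ j ≤ m + 2, (B i * B j : A) ∈ Q)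
    (h2 : ∀ i ≤ m + 2, ∀ j ≤ m + 2, (z * B i * B j : A) ∈ Q) :
    I • I • Submodule.span R {1, z} ≤ Q := by
  rw [hI, Submodule.span_smul_span, Submodule.span_smul_span, Submodule.span_le]
  intro x hx
  obtain ⟨_, ⟨i, hi, rfl⟩, _, ⟨_, ⟨j, hj, rfl⟩, t, ht, rfl⟩, rfl⟩ := hx
  rw [SetLike.mem_coe]
  rcases ht with rfl | rfl
  · convert h1 i hi j hj using 1
    simp [Algebra.smul_def]
  · convert h2 i hi j hj using 1
    simp only [Algebra.smul_def, Subalgebra.algebraMap_apply]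
    ring

/-- Modulo `Q` a relation makes its two terms proportional, so membership of one passes to the
other; this lemma and its mirror image are the moves of the induction below. -/
theorem mem_of_smul_sub_smul {Q : Submodule R A} {c d : K} (hd : d ≠ 0) {x y : A}
    (h : c • x - d • y ∈ Q) (hx : x ∈ Q) : y ∈ Q := by
  have h1 : d • y ∈ Q := by
    have := Q.sub_mem (Q.smul_of_tower_mem c hx) h
    rwa [sub_sub_cancel] at this
  have := Q.smul_of_tower_mem d⁻¹ h1
  rwa [smul_smul, inv_mul_cancel₀ hd, one_smul] at this

theorem mem_of_smul_sub_smul' {Q : Submodule R A} {c d : K} (hc : c ≠ 0) {x y : A}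
    (h : c • x - d • y ∈ Q) (hy : y ∈ Q) : x ∈ Q :=
  mem_of_smul_sub_smul (c := d) hc (by rw [← neg_sub]; exact Q.neg_mem h) hy

variable [CharZero K]

/-- The quadratic part of the module generated by `1` and `z` is contained in `T`. -/
theorem smul_smul_span_le_of_relations {I : Ideal R}
    (hI : I = Ideal.span (B '' Set.Iic (m + 2))) (hjac : I ≤ (⊥ : Ideal R).jacobson)
    (hc : ∀ l ≤ m + 1, c l ≠ 0) (hd : ∀ l ≤ m + 1, d l ≠ 0)
    (h0 : B 0 = 0) (hY : (B (m + 1) : A) = -3 * z ^ 2) (hZ : (B (m + 2) : A) = -2 * z ^ 3)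
    (hT : z ^ 3 ∈ T)
    (hs : ∀ l ≤ m + 1, c l • (B (l + 1) : A) - d l • (z * B l) ∈
      T ⊔ I • I • Submodule.span R {1, z}) :
    I • I • Submodule.span R {1, z} ≤ T := by
  set M : Submodule R A := Submodule.span R {1, z} with hM
  -- The target is I²M ≤ T + I³M. The relations hold modulo T + I²M, so after multiplication by any
  -- B_i they hold modulo `Q`.
  set Q : Submodule R A := T ⊔ I • I • I • M with hQ
  have hBI : ∀ i ≤ m + 2, B i ∈ I := fun i hi => by
    rw [hI]
    exact Ideal.subset_span ⟨i, hi, rfl⟩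
  have h1M : (1 : A) ∈ M := Submodule.subset_span (by simp)
  have hTQ : T ≤ Q := le_sup_left
  have hmul : ∀ i ≤ m + 2, ∀ y ∈ T ⊔ I • I • M, B i • y ∈ Q := fun i hi y hy => by
    obtain ⟨t, ht, w, hw, rfl⟩ := Submodule.mem_sup.1 hy
    rw [smul_add]
    exact Submodule.add_mem_sup (T.smul_mem _ ht) (Submodule.smul_mem_smul (hBI i hi) hw)
  have hE : ∀ i ≤ m + 2, ∀ l ≤ m + 1,
      c l • (B i * B (l + 1) : A) - d l • (z * B i * B l) ∈ Q := fun i hi l hl => by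
    convert hmul i hi _ (hs l hl) using 1
    simp only [Algebra.smul_def, Subalgebra.algebraMap_apply]
    ring
  have hmulT : ∀ i, (B i * z ^ 3 : A) ∈ Q := fun i => hTQ (T.smul_mem (B i) hT)
  have hPlast : ∀ i, (B i * B (m + 2) : A) ∈ Q := fun i => by
    convert Q.smul_of_tower_mem (-2 : K) (hmulT i) using 1
    rw [hZ, neg_smul, Algebra.smul_def, map_ofNat]
    ring
  have hC1 : ∀ i, (z * B i * B (m + 1) : A) ∈ Q := fun i => by
    convert Q.smul_of_tower_mem (-3 : K) (hmulT i) using 1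
    rw [hY, neg_smul, Algebra.smul_def, map_ofNat]
    ring
  -- Here z⁴ = B_{m+1}² / 9, so the product is cubic in the generators.
  have hC2 : ∀ i ≤ m + 2, (z * B i * B (m + 2) : A) ∈ Q := fun i hi => by
    have h : B i • B (m + 1) • B (m + 1) • (1 : A) ∈ Q :=
      (le_sup_right : _ ≤ Q) (Submodule.smul_mem_smul (hBI i hi)
        (Submodule.smul_mem_smul (hBI _ (by omega))
          (Submodule.smul_mem_smul (hBI _ (by omega)) h1M)))
    convert Q.smul_of_tower_mem (-2 / 9 : K) h using 1
    have h9 : algebraMap K A (-2 / 9) * 9 = -2 := by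
      rw [← map_ofNat (algebraMap K A) 9, ← map_mul, show (-2 / 9 * 9 : K) = -2 by norm_num,
        map_neg, map_ofNat]
    simp only [Algebra.smul_def, Subalgebra.algebraMap_apply, hZ]
    rw [show algebraMap K A (-2 / 9) * ((B i : A) * ((B (m + 1) : A) * ((B (m + 1) : A) * 1)))
      = (algebraMap K A (-2 / 9) * 9) * ((B i : A) * z ^ 4) by rw [hY]; ring, h9]
    ring
  -- The relation multiplied by B_l exchanges B_l B_{i+1} for z B_l B_i.
  have hstep : ∀ l ≤ m + 2, (∀ i ≤ m + 2, (z * B i * B l : A) ∈ Q) →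
      ∀ i ≤ m + 2, (B l * B i : A) ∈ Q := fun l hl H i hi => by
    cases i with
    | zero => simp [h0]
    | succ i =>
      refine mem_of_smul_sub_smul' (hc i (by omega)) (hE l hl i (by omega)) ?_
      convert H i (by omega) using 1
      ring
  -- Descent on the index, starting from z B_{m+1} = -3z³: from z B_i B_l for all i one gets B_i
  -- B_l, and the relation times B_i then turns this into z B_i B_{l-1}.
  have hC : ∀ k ≤ m + 1, ∀ i ≤ m + 2, (z * B i * B (m + 1 - k) : A) ∈ Q := by
    intro k
    induction k with
    | zero => exact fun _ i _ => hC1 i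
    | succ k ih =>
      intro hk i hi
      refine mem_of_smul_sub_smul (hd _ (by omega)) (hE i hi (m + 1 - (k + 1)) (by omega)) ?_
      have := hstep (m + 1 - k) (by omega) (ih (by omega)) i hi
      rw [show m + 1 - (k + 1) + 1 = m + 1 - k by omega]
      rwa [mul_comm]
  have hCall : ∀ l ≤ m + 2, ∀ i ≤ m + 2, (z * B i * B l : A) ∈ Q := fun l hl i hi => by
    rcases Nat.lt_or_ge l (m + 2) with h | h
    · have := hC (m + 1 - l) (by omega) i hi
      rwa [show m + 1 - (m + 1 - l) = l by omega] at this
    · obtain rfl : l = m + 2 := by omega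
      exact hC2 i hi
  -- Nakayama's lemma for the finitely generated module I²M.
  refine Submodule.le_of_le_smul_of_le_jacobson_bot (I := I) ?_ hjac
    (smul_smul_span_le hI (fun i hi j hj => hstep i hi (hCall i hi) j hj)
      fun i hi j hj => hCall j hj i hi)
  rw [hM, hI, Submodule.span_smul_span, Submodule.span_smul_span]
  have hf := (Set.finite_Iic (m + 2)).image B
  exact Submodule.fg_span (hf.smul (hf.smul (by simp)))

/-- The module generated by `1` and `z` is spanned over `K`, modulo `T`, by `1`, `z` and the
products `z * B l`. -/
theorem mem_sup_span_of_mem_span {I : Ideal R}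
    (hI : I = Ideal.span (B '' Set.Iic (m + 2))) (hjac : I ≤ (⊥ : Ideal R).jacobson)
    (hR : ∀ r : R, ∃ k : K, r - algebraMap K R k ∈ I)
    (hc : ∀ l ≤ m + 1, c l ≠ 0) (hd : ∀ l ≤ m + 1, d l ≠ 0)
    (h0 : B 0 = 0) (hY : (B (m + 1) : A) = -3 * z ^ 2) (hZ : (B (m + 2) : A) = -2 * z ^ 3)
    (hT : z ^ 3 ∈ T)
    (hs : ∀ l ≤ m + 1, c l • (B (l + 1) : A) - d l • (z * B l) ∈
      T ⊔ I • I • Submodule.span R {1, z}) {x : A} (hx : x ∈ Submodule.span R {1, z}) :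
    x ∈ T.restrictScalars K ⊔
      Submodule.span K ({1, z} ∪ (fun l => z * (B l : A)) '' Set.Icc 1 m) := by
  have hJ := smul_smul_span_le_of_relations hI hjac hc hd h0 hY hZ hT hs
  set M : Submodule R A := Submodule.span R {1, z} with hM
  rw [sup_of_le_left hJ] at hs
  set W := T.restrictScalars K ⊔
      Submodule.span K ({1, z} ∪ (fun l => z * (B l : A)) '' Set.Icc 1 m) with hW
  have hTW : ∀ y ∈ T, y ∈ W := fun y hy => (le_sup_left : _ ≤ W) hy
  have hSW : ∀ y ∈ ({1, z} ∪ (fun l => z * (B l : A)) '' Set.Icc 1 m : Set A), y ∈ W :=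
    fun y hy => (le_sup_right : _ ≤ W) (Submodule.subset_span hy)
  have hBI : ∀ i ≤ m + 2, B i ∈ I := fun i hi => by
    rw [hI]
    exact Ideal.subset_span ⟨i, hi, rfl⟩
  have h1M : (1 : A) ∈ M := Submodule.subset_span (by simp)
  have hYY : z ^ 4 ∈ T := by
    have h : B (m + 1) • B (m + 1) • (1 : A) ∈ T :=
      hJ (Submodule.smul_mem_smul (hBI _ (by omega))
        (Submodule.smul_mem_smul (hBI _ (by omega)) h1M))
    convert T.smul_of_tower_mem (1 / 9 : K) h using 1
    have h9 : algebraMap K A (1 / 9) * 9 = 1 := by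
      rw [← map_ofNat (algebraMap K A) 9, ← map_mul]
      norm_num
    simp only [Algebra.smul_def, Subalgebra.algebraMap_apply]
    rw [show algebraMap K A (1 / 9) * ((B (m + 1) : A) * ((B (m + 1) : A) * 1))
      = (algebraMap K A (1 / 9) * 9) * z ^ 4 by rw [hY]; ring, h9, one_mul]
  have hzB : ∀ l ≤ m + 2, z * (B l : A) ∈ W := fun l hl => by
    rcases Nat.eq_zero_or_pos l with rfl | hpos
    · simp [h0]
    rcases Nat.lt_or_ge m l with h | h
    · rcases Nat.lt_or_ge l (m + 2) with h' | h'
      · obtain rfl : l = m + 1 := by omega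
        refine hTW _ ?_
        convert T.smul_of_tower_mem (-3 : K) hT using 1
        rw [hY, neg_smul, Algebra.smul_def, map_ofNat]
        ring
      · obtain rfl : l = m + 2 := by omega
        refine hTW _ ?_
        convert T.smul_of_tower_mem (-2 : K) hYY using 1
        rw [hZ, neg_smul, Algebra.smul_def, map_ofNat]
        ring
    · exact hSW _ (Or.inr ⟨l, ⟨hpos, h⟩, rfl⟩)
  have hB : ∀ l ≤ m + 2, (B l : A) ∈ W := fun l hl => by
    cases l with
    | zero => simp [h0]
    | succ l =>
      have h1 : c l • (B (l + 1) : A) ∈ W := by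
        have := W.add_mem (hTW _ (hs l (by omega))) (W.smul_mem (d l) (hzB l (by omega)))
        rwa [sub_add_cancel] at this
      have := W.smul_mem (c l)⁻¹ h1
      rwa [smul_smul, inv_mul_cancel₀ (hc l (by omega)), one_smul] at this
  -- Since R = K + I, once I N lies in `W` it is enough to check generators of N. This is used for N
  -- = I M and then for N = M.
  have hext : ∀ (N : Submodule R A), (∀ i ∈ I, ∀ y ∈ N, i • y ∈ W) → ∀ S : Set A,
      N = Submodule.span R S → (∀ y ∈ S, y ∈ W) → ∀ y ∈ N, y ∈ W := by
    intro N hN S hS hSW y hy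
    rw [hS] at hy
    induction hy using Submodule.span_induction with
    | mem y h => exact hSW y h
    | zero => exact W.zero_mem
    | add y w _ _ h1 h2 => exact W.add_mem h1 h2
    | smul r y h h1 =>
      obtain ⟨k, hk⟩ := hR r
      have : r • y = k • y + (r - algebraMap K R k) • y := by
        rw [sub_smul, algebraMap_smul, add_sub_cancel]
      rw [this]
      exact W.add_mem (W.smul_mem k h1) (hN _ hk y (hS ▸ h))
  have hIM : ∀ y ∈ I • M, y ∈ W := by
    refine hext _ (fun i hi y hy => hTW _ (hJ (Submodule.smul_mem_smul hi hy))) _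
      (by rw [hI, hM, Submodule.span_smul_span]) ?_
    intro y hy
    obtain ⟨_, ⟨i, hi, rfl⟩, t, ht, rfl⟩ := hy
    rcases ht with rfl | rfl
    · convert hB i hi using 1
      simp [Algebra.smul_def]
    · convert hzB i hi using 1
      simp only [Algebra.smul_def, Subalgebra.algebraMap_apply]
      ring
  exact hext M (fun i hi y hy => hIM _ (Submodule.smul_mem_smul hi hy)) _ hM
    (fun y hy => hSW y (Or.inl hy)) x hx

end CuspAlgebra

/-! ### Liftable vector fields over the A_n germ. -/

section LiftFields

variable {𝕜 : Type*} [RCLike 𝕜] {m : ℕ}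

/-- The coefficients of order less than `K` of a polynomial that is `O(s ^ K)` at `0` vanish. -/
theorem Polynomial.coeff_eq_zero_of_isBigO {K : ℕ} {p : Polynomial 𝕜}
    (h : (fun s : 𝕜 => p.eval s) =O[𝓝[≠] 0] fun s : 𝕜 => s ^ K) {i : ℕ} (hi : i < K) :
    p.coeff i = 0 := by
  induction K generalizing p i with
  | zero => exact absurd hi (Nat.not_lt_zero _)
  | succ K ih =>
    have hle : 𝓝[≠] (0 : 𝕜) ≤ 𝓝 0 := nhdsWithin_le_nhds
    have t1 : Tendsto (fun s : 𝕜 => p.eval s) (𝓝[≠] 0) (𝓝 (p.coeff 0)) := by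
      rw [Polynomial.coeff_zero_eq_eval_zero]
      exact (p.continuous.tendsto 0).mono_left hle
    have t2 : Tendsto (fun s : 𝕜 => s ^ (K + 1)) (𝓝[≠] 0) (𝓝 0) := by
      have hc : Continuous fun s : 𝕜 => s ^ (K + 1) := by fun_prop
      simpa using (hc.tendsto 0).mono_left hle
    have h0 : p.coeff 0 = 0 := tendsto_nhds_unique t1 (h.trans_tendsto t2)
    have hp : ∀ s, p.eval s = s * p.divX.eval s := fun s => by
      conv_lhs => rw [← p.divX_mul_X_add, h0]
      simp [mul_comm]
    cases i with
    | zero => exact h0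
    | succ i =>
      rw [← Polynomial.coeff_divX]
      refine ih ?_ (Nat.lt_of_succ_lt_succ hi)
      have h2 := (Asymptotics.isBigO_refl (fun s : 𝕜 => s⁻¹) (𝓝[≠] 0)).mul h
      have hne : ∀ᶠ s : 𝕜 in 𝓝[≠] 0, s ≠ 0 := eventually_mem_nhdsWithin
      refine h2.congr' ?_ ?_
      · filter_upwards [hne] with s hs
        rw [hp, inv_mul_cancel_left₀ hs]
      · filter_upwards [hne] with s hs
        rw [pow_succ', inv_mul_cancel_left₀ hs]

/-- A polynomial of degree less than `K` that is `O(s ^ K)` at `0` vanishes. -/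
theorem coeff_eq_zero_of_isBigO {K : ℕ} (c : Fin K → 𝕜)
    (h : (fun s : 𝕜 => ∑ i, c i * s ^ (i : ℕ)) =O[𝓝[≠] 0] fun s : 𝕜 => s ^ K) : c = 0 := by
  funext i
  have h1 := Polynomial.coeff_eq_zero_of_isBigO (K := K)
    (p := ∑ i, Polynomial.C (c i) * Polynomial.X ^ (i : ℕ))
    (by simpa [Polynomial.eval_finsetSum] using h) i.2
  simpa [Polynomial.finsetSum_coeff, Polynomial.coeff_X_pow, Fin.val_inj] using h1

theorem SmoothNear.isBigO_one {E : Type*} [NormedAddCommGroup E] [NormedSpace 𝕜 E] {x : E}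
    {f : E → 𝕜} (hf : SmoothNear 𝕜 f x) : f =O[𝓝 x] fun _ => (1 : 𝕜) :=
  hf.continuousAt.tendsto.isBigO_one 𝕜

/-- Reduction of the powers of the first variable modulo `typeADeriv`. -/
theorem exists_pow_reduction (𝕜 : Type*) [RCLike 𝕜] (m q : ℕ) :
    ∃ (χ : (Fin (m + 2) → 𝕜) → 𝕜) (r : Fin (m + 2) → (Fin (m + 1) → 𝕜) → 𝕜),
      SmoothNear 𝕜 χ 0 ∧ (∀ i, SmoothNear 𝕜 (r i) 0) ∧
      (∀ᶠ x in 𝓝 0, x 0 ^ q = typeADeriv m x * χ x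
        + ∑ i, r i (fun j => x j.succ) * x 0 ^ (i : ℕ)) ∧
      (q < m + 2 → ∀ i u, r i u = if (i : ℕ) = q then 1 else 0) ∧
      (m + 2 ≤ q → ∀ i, r i 0 = 0) := by
  rcases Nat.lt_or_ge q (m + 2) with hq | hq
  · refine ⟨fun _ => 0, fun i _ => if (i : ℕ) = q then 1 else 0, contDiff_const.smoothNear 0,
      fun i => contDiff_const.smoothNear 0, Eventually.of_forall fun x => ?_, fun _ _ _ => rfl,
      fun h => absurd h (by omega)⟩
    rw [mul_zero, zero_add, Finset.sum_eq_single (⟨q, hq⟩ : Fin (m + 2))]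
    · simp
    · intro i _ hi
      change (if (i : ℕ) = q then (1 : 𝕜) else 0) * _ = 0
      rw [if_neg (fun h => hi (Fin.ext h)), zero_mul]
    · simp
  · obtain ⟨χ, r, hχ, hr, hd⟩ := exists_division_typeADeriv (𝕜 := 𝕜) (m := m)
      (h := fun x => x 0 ^ q) (ContDiff.smoothNear (by fun_prop) 0)
    refine ⟨χ, r, hχ, hr, hd, fun h => absurd h (by omega), fun _ => ?_⟩
    have hc : Continuous fun t : 𝕜 => (Pi.single 0 t : Fin (m + 2) → 𝕜) :=
      continuous_single (A := fun _ : Fin (m + 2) => 𝕜) 0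
    have ht : Tendsto (fun t : 𝕜 => (Pi.single 0 t : Fin (m + 2) → 𝕜)) (𝓝[≠] 0) (𝓝 0) := by
      have := hc.tendsto 0
      rw [Pi.single_zero] at this
      exact this.mono_left nhdsWithin_le_nhds
    have hO : (fun t : 𝕜 => χ (Pi.single 0 t)) =O[𝓝[≠] 0] fun _ => (1 : 𝕜) :=
      hχ.isBigO_one.comp_tendsto ht
    have hpow : (fun t : 𝕜 => t ^ q) =O[𝓝[≠] 0] fun t => t ^ (m + 2) := by
      obtain ⟨e, rfl⟩ := Nat.exists_eq_add_of_le hq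
      have hce : Continuous fun t : 𝕜 => t ^ e := by fun_prop
      have h1 : (fun t : 𝕜 => t ^ e) =O[𝓝[≠] 0] fun _ => (1 : 𝕜) :=
        ((hce.tendsto 0).mono_left nhdsWithin_le_nhds).isBigO_one 𝕜
      simpa [pow_add] using (Asymptotics.isBigO_refl (fun t : 𝕜 => t ^ (m + 2)) (𝓝[≠] 0)).mul h1
    -- On the x₁-axis the division reads t^q = (m + 3) t^(m+2) χ + ∑ r_i(0) t^i, so a polynomial of
    -- degree at most m + 1 is O(t^(m+2)) and must vanish.
    have hz : (fun i => r i 0) = 0 := by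
      refine coeff_eq_zero_of_isBigO _ ?_
      have h2 : (fun t : 𝕜 => ((m + 3 : ℕ) : 𝕜) * t ^ (m + 2) * χ (Pi.single 0 t))
          =O[𝓝[≠] 0] fun t => t ^ (m + 2) := by
        have := ((Asymptotics.isBigO_refl (fun t : 𝕜 => t ^ (m + 2)) (𝓝[≠] 0)).const_mul_left
          ((m + 3 : ℕ) : 𝕜)).mul hO
        simpa using this
      refine (hpow.sub h2).congr' ?_ EventuallyEq.rfl
      filter_upwards [ht.eventually hd] with t htd
      simp only [Pi.single_eq_same, typeADeriv, Pi.single_eq_of_ne (Fin.succ_ne_zero _),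
        mul_zero, zero_mul, Finset.sum_const_zero, add_zero] at htd
      rw [htd]
      exact add_sub_cancel_left _ _
    exact fun i => congrFun hz i

/-- The coefficients of the polynomial `t ^ (m + 3) + ∑ X j t ^ j - X 0` in `t`, shifted by one. -/
def shiftedCoeff (m : ℕ) : ℕ → (Fin (m + 2) → 𝕜) → 𝕜
  | 0, _ => 0
  | 1, X => -X 0
  | l + 2, X => if h : l + 1 < m + 2 then X ⟨l + 1, h⟩ else 0

theorem smoothNear_shiftedCoeff (l : ℕ) : SmoothNear 𝕜 (shiftedCoeff (𝕜 := 𝕜) m l) 0 := by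
  match l with
  | 0 => exact contDiff_const.smoothNear 0
  | 1 =>
    have h1 : ContDiff 𝕜 ∞ fun X : Fin (m + 2) → 𝕜 => -X 0 := by fun_prop
    exact h1.smoothNear 0
  | l + 2 =>
    by_cases h : l + 1 < m + 2
    · have h1 : shiftedCoeff (𝕜 := 𝕜) m (l + 2) = fun X => X ⟨l + 1, h⟩ := by
        funext X
        simp only [shiftedCoeff, dif_pos h]
      rw [h1]
      exact ContDiff.smoothNear (by fun_prop) 0
    · have h1 : shiftedCoeff (𝕜 := 𝕜) m (l + 2) = fun X => 0 := by
        funext X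
        simp only [shiftedCoeff, dif_neg h]
      rw [h1]
      exact contDiff_const.smoothNear 0

theorem shiftedCoeff_apply_zero (l : ℕ) : shiftedCoeff m l (0 : Fin (m + 2) → 𝕜) = 0 := by
  match l with
  | 0 => rfl
  | 1 => simp [shiftedCoeff]
  | l + 2 => simp [shiftedCoeff]

/-- An Euler identity. At a point of the source, t = x₁ is a root of p(t) = t^N + ∑ B_{l+1} t^l with
N = m + 3, so N p - t p' = -t P_t there, and the left side is ∑ (N - l) B_{l+1} t^l. -/
theorem sum_shiftedCoeff_typeAMap (x : Fin (m + 2) → 𝕜) :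
    ∑ l ∈ Finset.range (m + 2), ((m + 3 - l : ℕ) : 𝕜) *
      shiftedCoeff m (l + 1) (typeAMap 𝕜 (m + 2) (m + 2 + 1) x) * x 0 ^ l
      = -(x 0 * typeADeriv m x) := by
  rw [Finset.sum_range_succ', Finset.sum_range]
  have h : ∀ j : Fin (m + 1), shiftedCoeff m ((j : ℕ) + 1 + 1)
      (typeAMap 𝕜 (m + 2) (m + 2 + 1) x) = x j.succ := fun j => by
    simp only [shiftedCoeff]
    rw [dif_pos (by omega)]
    exact typeAMap_apply_succ _ x j
  simp only [h]
  simp only [shiftedCoeff, typeAMap_apply_zero, typeADeriv, pow_zero, mul_one, Nat.sub_zero,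
    mul_add, neg_add, Finset.mul_sum, mul_neg]
  have h2 : ∀ j : Fin (m + 1), ((m + 3 - ((j : ℕ) + 1) : ℕ) : 𝕜) * x j.succ * x 0 ^ ((j : ℕ) + 1)
      = ((m + 3 : ℕ) : 𝕜) * (x j.succ * x 0 ^ ((j : ℕ) + 1))
        - x 0 * ((((j : ℕ) + 1 : ℕ) : 𝕜) * x j.succ * x 0 ^ (j : ℕ)) := fun j => by
    rw [Nat.cast_sub (by omega)]
    ring
  simp only [h2, Finset.sum_sub_distrib]
  ring

/-- The vector fields `η` that lift over the `A_n` germ. -/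
def IsLiftableA (m : ℕ) (e : (Fin (m + 2) → 𝕜) → Fin (m + 2) → 𝕜) : Prop :=
  ∃ χ : (Fin (m + 2) → 𝕜) → 𝕜, SmoothNear 𝕜 χ 0 ∧ ∀ᶠ x in 𝓝 0,
    e (typeAMap 𝕜 (m + 2) (m + 2 + 1) x) 0
      - ∑ j : Fin (m + 1), x 0 ^ ((j : ℕ) + 1) * e (typeAMap 𝕜 (m + 2) (m + 2 + 1) x) j.succ
      = typeADeriv m x * χ x

theorem mem_Lift_germF {η : SmoothGerms 𝕜 (m + 2) (Fin (m + 2) → 𝕜)}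
    {e : (Fin (m + 2) → 𝕜) → Fin (m + 2) → 𝕜} (he : SmoothNear 𝕜 e 0)
    (hηe : η.1 = (e : Germ (𝓝 (0 : Fin (m + 2) → 𝕜)) (Fin (m + 2) → 𝕜))) :
    η ∈ (germF 𝕜 m).Lift ↔ IsLiftableA m e :=
  mem_range_tf_germF (he.comp_of_eq ((contDiff_typeAMap 𝕜 _ _).smoothNear 0) (typeAMap_zero 𝕜 _ _))
    ((germF 𝕜 m).coe_wf_apply hηe ())

/-- The basic liftable vector fields of the `A_n` germ, obtained by reducing the powers of the
first variable in `t ^ p * (t P_t)`. -/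
theorem exists_liftable_of_reduction (p : ℕ)
    {χ : ℕ → (Fin (m + 2) → 𝕜) → 𝕜} {r : ℕ → Fin (m + 2) → (Fin (m + 1) → 𝕜) → 𝕜}
    (hχ : ∀ q, SmoothNear 𝕜 (χ q) 0) (hr : ∀ q i, SmoothNear 𝕜 (r q i) 0)
    (hd : ∀ q, ∀ᶠ x in 𝓝 0, x 0 ^ q = typeADeriv m x * χ q x
        + ∑ i, r q i (fun j => x j.succ) * x 0 ^ (i : ℕ)) :
    ∃ e : (Fin (m + 2) → 𝕜) → Fin (m + 2) → 𝕜, SmoothNear 𝕜 e 0 ∧ IsLiftableA m e ∧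
      ∀ X (j : Fin (m + 1)), e X j.succ = ∑ l ∈ Finset.range (m + 2),
        ((m + 3 - l : ℕ) : 𝕜) * shiftedCoeff m (l + 1) X * r (l + p) j.succ (fun j => X j.succ) := by
  have htail : SmoothNear 𝕜 (fun X : Fin (m + 2) → 𝕜 => fun j : Fin (m + 1) => X j.succ) 0 :=
    ContDiff.smoothNear (by fun_prop) 0
  let G : (Fin (m + 2) → 𝕜) → Fin (m + 2) → 𝕜 := fun X i => ∑ l ∈ Finset.range (m + 2),
        ((m + 3 - l : ℕ) : 𝕜) * shiftedCoeff m (l + 1) X * r (l + p) i (fun j => X j.succ)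
  have hG : ∀ i, SmoothNear 𝕜 (fun X => G X i) 0 := fun i => SmoothNear.sum fun l _ =>
    ((contDiff_const.smoothNear 0).mul (smoothNear_shiftedCoeff _)).mul
      ((hr _ i).comp_of_eq htail rfl)
  have hF : SmoothNear 𝕜 (typeAMap 𝕜 (m + 2) (m + 2 + 1)) 0 :=
    (contDiff_typeAMap 𝕜 _ _).smoothNear 0
  -- The Euler identity times t^p, with powers of t reduced modulo P_t, says that ∑ G_i t^i is a
  -- multiple of P_t. Up to the sign of the first component, this is the lift equation for the field
  -- with components G_i.
  refine ⟨fun X => Fin.cons (-G X 0) fun j => G X j.succ, SmoothNear.pi fun i => ?_,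
    ⟨fun x => x 0 ^ (p + 1) + ∑ l ∈ Finset.range (m + 2), ((m + 3 - l : ℕ) : 𝕜) *
      shiftedCoeff m (l + 1) (typeAMap 𝕜 (m + 2) (m + 2 + 1) x) * χ (l + p) x, ?_, ?_⟩,
    fun X j => rfl⟩
  · refine Fin.cases ?_ (fun i => ?_) i
    · exact (hG 0).neg
    · exact hG i.succ
  · exact SmoothNear.add (ContDiff.smoothNear (by fun_prop) 0) (SmoothNear.sum fun l _ =>
      ((contDiff_const.smoothNear 0).mul ((smoothNear_shiftedCoeff _).comp_of_eq hF
        (typeAMap_zero 𝕜 _ _))).mul (hχ _))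
  · have hall : ∀ᶠ x : Fin (m + 2) → 𝕜 in 𝓝 0, ∀ l ∈ Finset.range (m + 2),
        x 0 ^ (l + p) = typeADeriv m x * χ (l + p) x
          + ∑ i, r (l + p) i (fun j => x j.succ) * x 0 ^ (i : ℕ) :=
      (Filter.eventually_all_finset _).2 fun l _ => hd (l + p)
    filter_upwards [hall] with x hx
    set X := typeAMap 𝕜 (m + 2) (m + 2 + 1) x with hX
    have hXt : (fun j : Fin (m + 1) => X j.succ) = fun j => x j.succ :=
      funext fun j => typeAMap_apply_succ _ x j
    have h1 : -G X 0 - ∑ j : Fin (m + 1), x 0 ^ ((j : ℕ) + 1) * G X j.succ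
        = -∑ l ∈ Finset.range (m + 2), ((m + 3 - l : ℕ) : 𝕜) * shiftedCoeff m (l + 1) X *
          ∑ i, r (l + p) i (fun j => x j.succ) * x 0 ^ (i : ℕ) := by
      have h2 : ∑ i : Fin (m + 2), x 0 ^ (i : ℕ) * G X i
          = G X 0 + ∑ j : Fin (m + 1), x 0 ^ ((j : ℕ) + 1) * G X j.succ := by
        rw [Fin.sum_univ_succ]
        simp
      rw [← neg_add', ← h2]
      simp only [G, hXt, Finset.mul_sum]
      rw [Finset.sum_comm]
      congr 1
      refine Finset.sum_congr rfl fun l _ => Finset.sum_congr rfl fun i _ => ?_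
      ring
    have h3 : ∑ l ∈ Finset.range (m + 2), ((m + 3 - l : ℕ) : 𝕜) * shiftedCoeff m (l + 1) X *
          ∑ i, r (l + p) i (fun j => x j.succ) * x 0 ^ (i : ℕ)
        = x 0 ^ p * (∑ l ∈ Finset.range (m + 2), ((m + 3 - l : ℕ) : 𝕜) *
            shiftedCoeff m (l + 1) X * x 0 ^ l)
          - typeADeriv m x * ∑ l ∈ Finset.range (m + 2), ((m + 3 - l : ℕ) : 𝕜) *
            shiftedCoeff m (l + 1) X * χ (l + p) x := by
      rw [Finset.mul_sum, Finset.mul_sum, ← Finset.sum_sub_distrib]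
      refine Finset.sum_congr rfl fun l hl => ?_
      rw [eq_sub_of_add_eq' (hx l hl).symm, pow_add]
      ring
    simp only [Fin.cons_zero, Fin.cons_succ]
    rw [h1, h3, sum_shiftedCoeff_typeAMap]
    ring

end LiftFields

/-- Pointwise scalar multiplication makes germs an algebra, so that the pulled-back germs can form a
subalgebra. -/
instance Filter.Germ.instAlgebraSelf {α K : Type*} [CommRing K] (l : Filter α) :
    Algebra K (Germ l K) :=
  Algebra.ofModule
    (fun c x y => Germ.inductionOn₂ x y fun f g => congrArg _ (smul_mul_assoc c f g))
    (fun c x y => Germ.inductionOn₂ x y fun f g => congrArg _ (mul_smul_comm c f g))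

/-! ### The ring of germs pulled back to the cuspidal edge, its ideal, and the module of restricted
liftable fields. -/

section Spanning

variable (𝕜 : Type*) [RCLike 𝕜] (m : ℕ)

/-- The germ of `f ∘ φ`, where `φ` is the parametrisation of the cuspidal edge. -/
def cuspPullback (f : (Fin (m + 2) → 𝕜) → 𝕜) : Germ (𝓝 (0 : Fin (m + 1) → 𝕜)) 𝕜 :=
  ((fun u => f (cuspParam 𝕜 m u) : (Fin (m + 1) → 𝕜) → 𝕜) : Germ (𝓝 (0 : Fin (m + 1) → 𝕜)) 𝕜)

theorem cuspPullback_congr {f g : (Fin (m + 2) → 𝕜) → 𝕜} (h : ∀ᶠ X in 𝓝 0, f X = g X) :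
    cuspPullback 𝕜 m f = cuspPullback 𝕜 m g :=
  Germ.coe_eq.2 ((tendsto_cuspParam 𝕜 m).eventually h)

/-- The ring of the germs `f ∘ φ` with `f` smooth. -/
def cuspSubalgebra : Subalgebra 𝕜 (Germ (𝓝 (0 : Fin (m + 1) → 𝕜)) 𝕜) where
  carrier := {g | ∃ f, SmoothNear 𝕜 f 0 ∧ cuspPullback 𝕜 m f = g}
  mul_mem' := by
    rintro _ _ ⟨f, hf, rfl⟩ ⟨g, hg, rfl⟩
    exact ⟨fun X => f X * g X, hf.mul hg, rfl⟩
  add_mem' := by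
    rintro _ _ ⟨f, hf, rfl⟩ ⟨g, hg, rfl⟩
    exact ⟨fun X => f X + g X, hf.add hg, rfl⟩
  algebraMap_mem' c := by
    refine ⟨fun _ => c, contDiff_const.smoothNear 0, ?_⟩
    rw [Algebra.algebraMap_eq_smul_one]
    refine Germ.coe_eq.2 (Eventually.of_forall fun u => ?_)
    simp

variable {𝕜 m}

/-- The element `f ∘ φ` of `cuspSubalgebra`. -/
def cuspElement {f : (Fin (m + 2) → 𝕜) → 𝕜} (hf : SmoothNear 𝕜 f 0) : cuspSubalgebra 𝕜 m :=
  ⟨cuspPullback 𝕜 m f, f, hf, rfl⟩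

theorem exists_eq_cuspElement (r : cuspSubalgebra 𝕜 m) :
    ∃ (f : (Fin (m + 2) → 𝕜) → 𝕜) (hf : SmoothNear 𝕜 f 0), r = cuspElement hf := by
  obtain ⟨f, hf, h⟩ := r.2
  exact ⟨f, hf, Subtype.ext h.symm⟩

theorem isUnit_cuspElement {f : (Fin (m + 2) → 𝕜) → 𝕜} (hf : SmoothNear 𝕜 f 0) (h0 : f 0 ≠ 0) :
    IsUnit (cuspElement hf) := by
  refine IsUnit.of_mul_eq_one (cuspElement (hf.inv h0)) (Subtype.ext ?_)
  refine Germ.coe_eq.2 ?_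
  filter_upwards [(tendsto_cuspParam 𝕜 m).eventually (hf.continuousAt.eventually_ne h0)] with u hu
  exact mul_inv_cancel₀ hu

/-- The elements `shiftedCoeff m l ∘ φ` of `cuspSubalgebra`. -/
def cuspCoeff (𝕜 : Type*) [RCLike 𝕜] (m l : ℕ) : cuspSubalgebra 𝕜 m :=
  cuspElement (smoothNear_shiftedCoeff l)

/-- The ideal of `cuspSubalgebra` generated by the coordinates. -/
def cuspIdeal (𝕜 : Type*) [RCLike 𝕜] (m : ℕ) : Ideal (cuspSubalgebra 𝕜 m) :=
  Ideal.span (cuspCoeff 𝕜 m '' Set.Iic (m + 2))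

/-- Hadamard's lemma writes f as a combination of coordinates, and up to sign the coordinates are
the generators. -/
theorem cuspElement_mem_cuspIdeal {f : (Fin (m + 2) → 𝕜) → 𝕜} (hf : SmoothNear 𝕜 f 0)
    (h0 : f 0 = 0) : cuspElement hf ∈ cuspIdeal 𝕜 m := by
  obtain ⟨g, hg, hfg⟩ := hf.exists_hadamard
  have hcoord : ∀ i : Fin (m + 2), SmoothNear 𝕜 (fun X : Fin (m + 2) → 𝕜 => X i) 0 := fun i =>
    ContDiff.smoothNear (by fun_prop) 0
  have hmem : ∀ l ≤ m + 2, cuspCoeff 𝕜 m l ∈ cuspIdeal 𝕜 m := fun l hl =>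
    Ideal.subset_span ⟨l, hl, rfl⟩
  have hci : ∀ i, cuspElement (hcoord i) ∈ cuspIdeal 𝕜 m := fun i => by
    refine Fin.cases ?_ (fun j => ?_) i
    · have := (cuspIdeal 𝕜 m).neg_mem (hmem 1 (by omega))
      convert this using 1
      refine Subtype.ext (Germ.coe_eq.2 (Eventually.of_forall fun u => ?_))
      exact (neg_neg _).symm
    · convert hmem ((j : ℕ) + 2) (by omega) using 1
      refine Subtype.ext (Germ.coe_eq.2 (Eventually.of_forall fun u => ?_))
      simp only [shiftedCoeff]
      rw [dif_pos (by omega)]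
      rfl
  have hsum : cuspElement hf = ∑ i, cuspElement (hcoord i) * cuspElement (hg i) := by
    apply Subtype.ext
    have h1 : ((∑ i, cuspElement (hcoord i) * cuspElement (hg i) : cuspSubalgebra 𝕜 m) :
        Germ (𝓝 (0 : Fin (m + 1) → 𝕜)) 𝕜)
        = cuspPullback 𝕜 m (fun X => ∑ i, X i * g i X) := by
      have h2 : ∀ s : Finset (Fin (m + 2)),
          ((∑ i ∈ s, cuspElement (hcoord i) * cuspElement (hg i) : cuspSubalgebra 𝕜 m) :
          Germ (𝓝 (0 : Fin (m + 1) → 𝕜)) 𝕜)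
          = cuspPullback 𝕜 m (fun X => ∑ i ∈ s, X i * g i X) := fun s => by
        induction s using Finset.induction_on with
        | empty => rfl
        | insert a s ha ih =>
          simp only [Finset.sum_insert ha]
          rw [Subalgebra.coe_add, ih]
          rfl
      exact h2 _
    rw [h1]
    refine cuspPullback_congr 𝕜 m ?_
    filter_upwards [hfg] with X hX
    rw [hX, h0, zero_add]
  rw [hsum]
  exact (cuspIdeal 𝕜 m).sum_mem fun i _ => (cuspIdeal 𝕜 m).mul_mem_right _ (hci i)

theorem value_eq_zero_of_mem_cuspIdeal {r : cuspSubalgebra 𝕜 m} (hr : r ∈ cuspIdeal 𝕜 m) :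
    (r : Germ (𝓝 (0 : Fin (m + 1) → 𝕜)) 𝕜).value = 0 := by
  let v : cuspSubalgebra 𝕜 m →+* 𝕜 :=
    (Germ.valueRingHom (x := (0 : Fin (m + 1) → 𝕜))).comp (cuspSubalgebra 𝕜 m).subtype
  have h : cuspIdeal 𝕜 m ≤ RingHom.ker v := by
    refine Ideal.span_le.2 ?_
    rintro _ ⟨l, -, rfl⟩
    change shiftedCoeff m l (cuspParam 𝕜 m 0) = 0
    rw [cuspParam_zero, shiftedCoeff_apply_zero]
  exact h hr

/-- One plus a multiple of an element of the ideal has value 1 at the origin, so it comes from a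
germ with a smooth inverse. -/
theorem cuspIdeal_le_jacobson : cuspIdeal 𝕜 m ≤ (⊥ : Ideal (cuspSubalgebra 𝕜 m)).jacobson := by
  intro r hr
  refine Ideal.mem_jacobson_bot.2 fun y => ?_
  have h0 := value_eq_zero_of_mem_cuspIdeal ((cuspIdeal 𝕜 m).mul_mem_right y hr)
  obtain ⟨f, hf, hrf⟩ := exists_eq_cuspElement (r * y + 1)
  rw [hrf]
  refine isUnit_cuspElement hf ?_
  have h1 : ((r * y + 1 : cuspSubalgebra 𝕜 m) : Germ (𝓝 (0 : Fin (m + 1) → 𝕜)) 𝕜).value = 1 := by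
    have h2 := map_add (Germ.valueRingHom (E := 𝕜) (x := (0 : Fin (m + 1) → 𝕜)))
      ((r * y : cuspSubalgebra 𝕜 m) : Germ (𝓝 (0 : Fin (m + 1) → 𝕜)) 𝕜) 1
    rw [map_one] at h2
    change _ = Germ.value _ + 1 at h2
    rw [h0, zero_add] at h2
    exact h2
  rw [hrf] at h1
  change f (cuspParam 𝕜 m 0) = 1 at h1
  rw [cuspParam_zero] at h1
  rw [h1]
  exact one_ne_zero

theorem exists_sub_algebraMap_mem_cuspIdeal (r : cuspSubalgebra 𝕜 m) :
    ∃ k : 𝕜, r - algebraMap 𝕜 (cuspSubalgebra 𝕜 m) k ∈ cuspIdeal 𝕜 m := by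
  obtain ⟨f, hf, rfl⟩ := exists_eq_cuspElement r
  refine ⟨f 0, ?_⟩
  have hs : SmoothNear 𝕜 (fun X => f X - f 0) 0 := hf.sub (contDiff_const.smoothNear 0)
  convert cuspElement_mem_cuspIdeal hs (sub_self _) using 1
  apply Subtype.ext
  rw [Subalgebra.coe_sub, Subalgebra.coe_algebraMap, Algebra.algebraMap_eq_smul_one]
  refine Germ.coe_eq.2 (Eventually.of_forall fun u => ?_)
  simp

/-- The germ of the last coordinate `z`. -/
def lastGerm (𝕜 : Type*) [RCLike 𝕜] (m : ℕ) : Germ (𝓝 (0 : Fin (m + 1) → 𝕜)) 𝕜 :=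
  ((fun u => u (Fin.last m) : (Fin (m + 1) → 𝕜) → 𝕜) : Germ (𝓝 (0 : Fin (m + 1) → 𝕜)) 𝕜)

/-- Every smooth germ is `f ∘ φ + z * g ∘ φ` with `f` and `g` smooth. -/
theorem coe_mem_span_one_lastGerm {h : (Fin (m + 1) → 𝕜) → 𝕜} (hh : SmoothNear 𝕜 h 0) :
    (h : Germ (𝓝 (0 : Fin (m + 1) → 𝕜)) 𝕜)
      ∈ Submodule.span (cuspSubalgebra 𝕜 m) {1, lastGerm 𝕜 m} := by
  -- After adding the variable y, h is divided by z² + y/3. On y = -3z² the divisor vanishes, and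
  -- the remainder r₀ + r₁ z has coefficients depending on (x, y) only.
  obtain ⟨q, r, -, hr, hd⟩ := exists_coord_division (Fin.last (m + 1)) 2
    ![(3 : 𝕜)⁻¹ • ContinuousLinearMap.proj (R := 𝕜) (φ := fun _ : Fin (m + 1) => 𝕜) (Fin.last m), 0]
    (hh.comp_of_eq (contDiff_dropY.smoothNear 0) dropY_zero)
  have hinit : SmoothNear 𝕜 (fun X : Fin (m + 2) → 𝕜 => fun j : Fin (m + 1) => X j.castSucc) 0 :=
    ContDiff.smoothNear (by fun_prop) 0
  have h0 : SmoothNear 𝕜 (fun X : Fin (m + 2) → 𝕜 => r 0 fun j => X j.castSucc) 0 :=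
    (hr 0).comp_of_eq hinit rfl
  have h1 : SmoothNear 𝕜 (fun X : Fin (m + 2) → 𝕜 => r 1 fun j => X j.castSucc) 0 :=
    (hr 1).comp_of_eq hinit rfl
  refine Submodule.mem_span_pair.2 ⟨cuspElement h0, cuspElement h1, ?_⟩
  refine Germ.coe_eq.2 ?_
  filter_upwards [tendsto_cuspCritical.eventually hd] with u hu
  have hrem : (Fin.last (m + 1)).removeNth (cuspCritical u)
      = fun j => cuspParam 𝕜 m u j.castSucc := by
    funext j
    simp only [Fin.removeNth, Fin.succAbove_last]
    induction j using Fin.lastCases with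
    | last => rw [cuspCritical_idxY, cuspParam_idxY]
    | cast j => simp
  rw [hrem, dropY_cuspCritical] at hu
  simp only [Fin.sum_univ_two, Matrix.cons_val_zero, Matrix.cons_val_one, FunLike.coe_smul,
    Pi.smul_apply, ContinuousLinearMap.proj_apply, smul_eq_mul, zero_apply, zero_mul, add_zero,
    cuspCritical_idxZ, cuspParam_idxY, Fin.val_zero, Fin.val_one, pow_zero, pow_one, mul_one] at hu
  change r 0 (fun j => cuspParam 𝕜 m u j.castSucc) * 1
    + r 1 (fun j => cuspParam 𝕜 m u j.castSucc) * u (Fin.last m) = h u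
  rw [hu]
  field_simp
  ring

/-- The germs `-z η_{n-1} ∘ φ + η_n ∘ φ` with `η` liftable over the `A_n` germ, as a module over
`cuspSubalgebra`. -/
def liftModule (𝕜 : Type*) [RCLike 𝕜] (m : ℕ) :
    Submodule (cuspSubalgebra 𝕜 m) (Germ (𝓝 (0 : Fin (m + 1) → 𝕜)) 𝕜) where
  carrier := {g | ∃ e : (Fin (m + 2) → 𝕜) → Fin (m + 2) → 𝕜, SmoothNear 𝕜 e 0 ∧ IsLiftableA m e ∧
    g = ((fun u => -u (Fin.last m) * e (cuspParam 𝕜 m u) (idxY m)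
      + e (cuspParam 𝕜 m u) (idxZ m) : (Fin (m + 1) → 𝕜) → 𝕜) :
        Germ (𝓝 (0 : Fin (m + 1) → 𝕜)) 𝕜)}
  add_mem' := by
    rintro _ _ ⟨e, he, ⟨χ, hχ, hl⟩, rfl⟩ ⟨e', he', ⟨χ', hχ', hl'⟩, rfl⟩
    refine ⟨fun X => e X + e' X, he.add he', ⟨fun x => χ x + χ' x, hχ.add hχ', ?_⟩, ?_⟩
    · filter_upwards [hl, hl'] with x h1 h2
      simp only [Pi.add_apply, mul_add, Finset.sum_add_distrib]
      linear_combination h1 + h2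
    · refine Germ.coe_eq.2 (Eventually.of_forall fun u => ?_)
      simp only [Pi.add_apply]
      ring
  zero_mem' := by
    refine ⟨fun _ => 0, contDiff_const.smoothNear 0, ⟨fun _ => 0, contDiff_const.smoothNear 0,
      Eventually.of_forall fun x => by simp⟩, ?_⟩
    refine Germ.coe_eq.2 (Eventually.of_forall fun u => ?_)
    simp
  smul_mem' := by
    rintro r _ ⟨e, he, ⟨χ, hχ, hl⟩, rfl⟩
    obtain ⟨f, hf, rfl⟩ := exists_eq_cuspElement r
    have hF : SmoothNear 𝕜 (typeAMap 𝕜 (m + 2) (m + 2 + 1)) 0 :=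
      (contDiff_typeAMap 𝕜 _ _).smoothNear 0
    refine ⟨fun X i => f X * e X i, SmoothNear.pi fun i => hf.mul (he.apply i),
      ⟨fun x => f (typeAMap 𝕜 (m + 2) (m + 2 + 1) x) * χ x,
        (hf.comp_of_eq hF (typeAMap_zero 𝕜 _ _)).mul hχ, ?_⟩, ?_⟩
    · filter_upwards [hl] with x h1
      simp only [mul_left_comm _ (f _), ← Finset.mul_sum]
      linear_combination f (typeAMap 𝕜 (m + 2) (m + 2 + 1) x) * h1
    · refine Germ.coe_eq.2 (Eventually.of_forall fun u => ?_)
      change f (cuspParam 𝕜 m u) * _ = _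
      ring

end Spanning

/-! ### Relations from liftable fields, and the spanning statement. -/

section Relations

variable {𝕜 : Type*} [RCLike 𝕜] {m : ℕ}

theorem cuspCoeff_zero : cuspCoeff 𝕜 m 0 = 0 := rfl

theorem coe_cuspCoeff_idxY (hm : 1 ≤ m) : (cuspCoeff 𝕜 m (m + 1) :
    Germ (𝓝 (0 : Fin (m + 1) → 𝕜)) 𝕜) = -3 * lastGerm 𝕜 m ^ 2 := by
  obtain ⟨k, rfl⟩ := Nat.exists_eq_add_of_le' hm
  refine Germ.coe_eq.2 (Eventually.of_forall fun u => ?_)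
  simp only [shiftedCoeff]
  rw [dif_pos (by omega)]
  exact cuspParam_idxY u

theorem coe_cuspCoeff_idxZ : (cuspCoeff 𝕜 m (m + 2) :
    Germ (𝓝 (0 : Fin (m + 1) → 𝕜)) 𝕜) = -2 * lastGerm 𝕜 m ^ 3 := by
  refine Germ.coe_eq.2 (Eventually.of_forall fun u => ?_)
  simp only [shiftedCoeff]
  rw [dif_pos (by omega)]
  exact cuspParam_idxZ u

/-- The liftable fields of the `A_n` germ give relations modulo quadratic terms. -/
theorem exists_mem_liftModule (hm : 1 ≤ m) {L : ℕ} (hL : L ≤ m + 1) :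
    ∃ δ : ℕ → Germ (𝓝 (0 : Fin (m + 1) → 𝕜)) 𝕜, (∀ l ≤ L, δ l = 0) ∧
      (∀ l ≤ m + 1, δ l ∈ cuspIdeal 𝕜 m • cuspIdeal 𝕜 m •
        Submodule.span (cuspSubalgebra 𝕜 m) {1, lastGerm 𝕜 m}) ∧
      ((m + 3 - L : ℕ) : 𝕜) • (cuspCoeff 𝕜 m (L + 1) : Germ (𝓝 (0 : Fin (m + 1) → 𝕜)) 𝕜)
        - ((m + 4 - L : ℕ) : 𝕜) • (lastGerm 𝕜 m * cuspCoeff 𝕜 m L)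
        + ∑ l ∈ Finset.range (m + 2), δ l ∈ liftModule 𝕜 m := by
  choose χ r hχ hr hd hlt hge using exists_pow_reduction 𝕜 m
  -- With this shift the power t^(l+p) is the top monomial t^(m+1), seen by the Z component, at l =
  -- L, and t^m, seen by the Y component, at l = L - 1. For l ≤ L no reduction takes place.
  obtain ⟨e, he, hel, hej⟩ := exists_liftable_of_reduction (m + 1 - L) hχ hr hd
  have htail : SmoothNear 𝕜 (fun X : Fin (m + 2) → 𝕜 => fun j : Fin (m + 1) => X j.succ) 0 :=
    ContDiff.smoothNear (by fun_prop) 0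
  have hrs : ∀ q i, SmoothNear 𝕜 (fun X : Fin (m + 2) → 𝕜 => r q i fun j => X j.succ) 0 :=
    fun q i => (hr q i).comp_of_eq htail rfl
  have hej' : ∀ X, ∀ i ≠ 0, e X i = ∑ l ∈ Finset.range (m + 2), ((m + 3 - l : ℕ) : 𝕜) *
      shiftedCoeff m (l + 1) X * r (l + (m + 1 - L)) i (fun j => X j.succ) := by
    intro X i hi
    obtain ⟨j, rfl⟩ := Fin.exists_succ_eq.2 hi
    exact hej X j
  have hY0 : idxY m ≠ 0 := by
    simp only [ne_eq, Fin.ext_iff, Fin.val_castSucc, Fin.val_last, Fin.val_zero]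
    omega
  have hZ0 : idxZ m ≠ 0 := by
    simp [Fin.ext_iff]
  let A := Germ (𝓝 (0 : Fin (m + 1) → 𝕜)) 𝕜
  let z : A := lastGerm 𝕜 m
  let R : ℕ → Fin (m + 2) → cuspSubalgebra 𝕜 m := fun q i => cuspElement (hrs q i)
  let τ : ℕ → A := fun l => ((m + 3 - l : ℕ) : 𝕜) • (cuspCoeff 𝕜 m (l + 1) *
    (R (l + (m + 1 - L)) (idxZ m) - z * R (l + (m + 1 - L)) (idxY m)) : A)
  -- The summand without its two leading terms. It survives only for l > L, where a coefficient
  -- vanishing at 0 multiplies B_{l+1}, so it is quadratic.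
  let δ : ℕ → A := fun l => τ l
    - (if l = L then ((m + 3 - l : ℕ) : 𝕜) • (cuspCoeff 𝕜 m (l + 1) : A) else 0)
    + (if l + 1 = L then ((m + 3 - l : ℕ) : 𝕜) • (z * cuspCoeff 𝕜 m (l + 1) : A) else 0)
  have hRlt : ∀ q < m + 2, ∀ i, R q i = if (i : ℕ) = q then 1 else 0 := by
    intro q hq i
    refine Subtype.ext ?_
    split_ifs with h
    · refine Germ.coe_eq.2 (Eventually.of_forall fun u => ?_)
      exact (hlt q hq i _).trans (if_pos h)
    · refine Germ.coe_eq.2 (Eventually.of_forall fun u => ?_)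
      exact (hlt q hq i _).trans (if_neg h)
  have hRge : ∀ q, m + 2 ≤ q → ∀ i, R q i ∈ cuspIdeal 𝕜 m := fun q hq i =>
    cuspElement_mem_cuspIdeal _ (hge q hq i)
  have hδ0 : ∀ l ≤ L, δ l = 0 := by
    intro l hl
    simp only [δ, τ]
    rw [hRlt _ (by omega), hRlt _ (by omega)]
    simp only [Fin.val_last, Fin.val_castSucc]
    rcases Nat.lt_trichotomy (l + 1) L with h | h | h
    · rw [if_neg (by omega), if_neg (by omega), if_neg (by omega), if_neg (by omega)]
      simp
    · rw [if_neg (by omega), if_pos (by omega), if_neg (by omega), if_pos h]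
      simp [mul_comm]
    · rw [if_pos (by omega), if_neg (by omega), if_pos (by omega), if_neg (by omega)]
      simp
  refine ⟨δ, hδ0, fun l hl => ?_, ?_⟩
  · rcases Nat.lt_or_ge L l with h | h
    · simp only [δ]
      rw [if_neg (by omega), if_neg (by omega), sub_zero, add_zero]
      refine Submodule.smul_of_tower_mem _ _ ?_
      refine Submodule.smul_mem_smul (N := cuspIdeal 𝕜 m • _)
        (Ideal.subset_span ⟨l + 1, by simp; omega, rfl⟩) (Submodule.sub_mem _ ?_ ?_)
      · have := Submodule.smul_mem_smul (hRge (l + (m + 1 - L)) (by omega) (idxZ m))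
          (Submodule.subset_span (s := ({1, z} : Set A)) (by simp : (1 : A) ∈ ({1, z} : Set A)))
        convert this using 1
        exact (mul_one _).symm
      · have := Submodule.smul_mem_smul (hRge (l + (m + 1 - L)) (by omega) (idxY m))
          (Submodule.subset_span (s := ({1, z} : Set A)) (by simp : (z : A) ∈ ({1, z} : Set A)))
        convert this using 1
        exact mul_comm _ _
    · rw [hδ0 l h]
      exact Submodule.zero_mem _
  · refine ⟨e, he, hel, ?_⟩
    have hτ : ∑ l ∈ Finset.range (m + 2), τ l = ((fun u => -u (Fin.last m) *
        e (cuspParam 𝕜 m u) (idxY m) + e (cuspParam 𝕜 m u) (idxZ m) : (Fin (m + 1) → 𝕜) → 𝕜) :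
        Germ (𝓝 (0 : Fin (m + 1) → 𝕜)) 𝕜) := by
      have h1 : ∀ s : Finset ℕ, ∑ l ∈ s, τ l = ((fun u => ∑ l ∈ s, ((m + 3 - l : ℕ) : 𝕜) *
          (shiftedCoeff m (l + 1) (cuspParam 𝕜 m u) *
            (r (l + (m + 1 - L)) (idxZ m) (fun j => cuspParam 𝕜 m u j.succ) -
              u (Fin.last m) * r (l + (m + 1 - L)) (idxY m) (fun j => cuspParam 𝕜 m u j.succ))) :
            (Fin (m + 1) → 𝕜) → 𝕜) : Germ (𝓝 (0 : Fin (m + 1) → 𝕜)) 𝕜) := fun s => by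
        induction s using Finset.induction_on with
        | empty => rfl
        | insert a s ha ih =>
          simp only [Finset.sum_insert ha]
          rw [ih]
          rfl
      rw [h1]
      refine Germ.coe_eq.2 (Eventually.of_forall fun u => ?_)
      simp only [hej' _ _ hY0, hej' _ _ hZ0, Finset.mul_sum, ← Finset.sum_add_distrib]
      refine Finset.sum_congr rfl fun l _ => ?_
      ring
    rw [← hτ]
    simp only [δ, Finset.sum_add_distrib, Finset.sum_sub_distrib]
    rw [Finset.sum_ite_eq' (Finset.range (m + 2)) L, if_pos (Finset.mem_range.2 (by omega))]
    have h2 : ∑ l ∈ Finset.range (m + 2), (if l + 1 = L then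
        ((m + 3 - l : ℕ) : 𝕜) • (z * cuspCoeff 𝕜 m (l + 1) : A) else 0)
        = ((m + 4 - L : ℕ) : 𝕜) • (z * cuspCoeff 𝕜 m L : A) := by
      cases L with
      | zero => simp [cuspCoeff_zero]
      | succ k =>
        simp only [Nat.succ_inj]
        rw [Finset.sum_ite_eq' (Finset.range (m + 2)) k, if_pos (Finset.mem_range.2 (by omega)),
          show m + 4 - (k + 1) = m + 3 - k by omega]
    rw [h2]
    abel

theorem relation_mem_sup (hm : 1 ≤ m) {L : ℕ} (hL : L ≤ m + 1) :
    ((m + 3 - L : ℕ) : 𝕜) • (cuspCoeff 𝕜 m (L + 1) : Germ (𝓝 (0 : Fin (m + 1) → 𝕜)) 𝕜)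
        - ((m + 4 - L : ℕ) : 𝕜) • (lastGerm 𝕜 m * cuspCoeff 𝕜 m L) ∈
      liftModule 𝕜 m ⊔ cuspIdeal 𝕜 m • cuspIdeal 𝕜 m •
        Submodule.span (cuspSubalgebra 𝕜 m) {1, lastGerm 𝕜 m} := by
  obtain ⟨δ, -, hδ, h⟩ := exists_mem_liftModule (𝕜 := 𝕜) hm hL
  have hs := Submodule.sum_mem _ fun l (hl : l ∈ Finset.range (m + 2)) => hδ l (by have := Finset.mem_range.1 hl; omega)
  have := Submodule.add_mem_sup h (Submodule.neg_mem _ hs)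
  rwa [add_neg_cancel_right] at this

/-- For L = m + 1 there is no error term, and the relation reads 2(-2z³) - 3z(-3z²) = 5z³. -/
theorem lastGerm_pow_three_mem (hm : 1 ≤ m) : lastGerm 𝕜 m ^ 3 ∈ liftModule 𝕜 m := by
  obtain ⟨δ, hδ0, -, h⟩ := exists_mem_liftModule (𝕜 := 𝕜) hm le_rfl
  rw [Finset.sum_eq_zero fun l hl => hδ0 l (by have := Finset.mem_range.1 hl; omega), add_zero,
    coe_cuspCoeff_idxZ, coe_cuspCoeff_idxY hm, show m + 3 - (m + 1) = 2 by omega,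
    show m + 4 - (m + 1) = 3 by omega] at h
  convert Submodule.smul_of_tower_mem _ (5⁻¹ : 𝕜) h using 1
  simp only [Algebra.smul_def, Nat.cast_ofNat, map_ofNat]
  have h5 : algebraMap 𝕜 (Germ (𝓝 (0 : Fin (m + 1) → 𝕜)) 𝕜) 5⁻¹ * 5 = 1 := by
    rw [← map_ofNat (algebraMap 𝕜 (Germ (𝓝 (0 : Fin (m + 1) → 𝕜)) 𝕜)) 5, ← map_mul,
      inv_mul_cancel₀ (by norm_num), map_one]
  linear_combination (-lastGerm 𝕜 m ^ 3) * h5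

/-- The germs `1, z, x₁ z, …, x_m z` span `𝒪_{n-1}` modulo `T_Σ`. -/
theorem TSigma_sup_span_monomialGerm (hm : 1 ≤ m) :
    TSigma (germF 𝕜 m) ⊔ Submodule.span 𝕜 (Set.range (monomialGerm 𝕜 m)) = ⊤ := by
  rw [eq_top_iff]
  intro ξ _
  obtain ⟨h, hh, he⟩ := ξ.2
  have hspan := mem_sup_span_of_mem_span (K := 𝕜) (R := cuspSubalgebra 𝕜 m) (T := liftModule 𝕜 m)
    (B := cuspCoeff 𝕜 m) (z := lastGerm 𝕜 m) (m := m) (I := cuspIdeal 𝕜 m)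
    (c := fun l => ((m + 3 - l : ℕ) : 𝕜)) (d := fun l => ((m + 4 - l : ℕ) : 𝕜)) rfl
    cuspIdeal_le_jacobson exists_sub_algebraMap_mem_cuspIdeal
    (fun l hl => Nat.cast_ne_zero.2 (by omega)) (fun l hl => Nat.cast_ne_zero.2 (by omega))
    cuspCoeff_zero (coe_cuspCoeff_idxY hm) coe_cuspCoeff_idxZ (lastGerm_pow_three_mem hm)
    (fun l hl => relation_mem_sup hm hl) (coe_mem_span_one_lastGerm hh)
  rw [← he] at hspan
  have hle : (liftModule 𝕜 m).restrictScalars 𝕜 ⊔ Submodule.span 𝕜 ({1, lastGerm 𝕜 m} ∪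
      (fun l => lastGerm 𝕜 m * (cuspCoeff 𝕜 m l : Germ (𝓝 (0 : Fin (m + 1) → 𝕜)) 𝕜)) ''
        Set.Icc 1 m) ≤ (TSigma (germF 𝕜 m) ⊔
      Submodule.span 𝕜 (Set.range (monomialGerm 𝕜 m))).map (SmoothGerms 𝕜 (m + 1) 𝕜).subtype := by
    rw [Submodule.map_sup]
    refine sup_le_sup ?_ ?_
    · rintro _ ⟨e, hes, hel, rfl⟩
      let η : SmoothGerms 𝕜 (m + 2) (Fin (m + 2) → 𝕜) :=
        ⟨(e : Germ (𝓝 (0 : Fin (m + 2) → 𝕜)) (Fin (m + 2) → 𝕜)), e, hes, rfl⟩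
      exact ⟨cuspRestrict 𝕜 m η, ⟨η, (mem_Lift_germF hes rfl).2 hel, rfl⟩,
        coe_cuspRestrict (η := η) (e := e) rfl⟩
    · refine Submodule.span_le.2 ?_
      have hmem : ∀ a, (monomialGerm 𝕜 m a).1 ∈ (Submodule.span 𝕜
          (Set.range (monomialGerm 𝕜 m))).map (SmoothGerms 𝕜 (m + 1) 𝕜).subtype := fun a =>
        Submodule.mem_map_of_mem (Submodule.subset_span (Set.mem_range_self a))
      rintro _ ((rfl | rfl) | ⟨l, ⟨hl1, hlm⟩, rfl⟩)
      · exact hmem 0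
      · exact hmem 1
      · have hmz := hmem (⟨l - 1, by omega⟩ : Fin m).succ.succ
        obtain ⟨l, rfl⟩ := Nat.exists_eq_add_of_le' hl1
        -- The first generator is -X₀ and the others are plain coordinates, hence the sign in the
        -- first case.
        cases l with
        | zero =>
          have := Submodule.neg_mem _ hmz
          rw [SetLike.mem_coe]
          convert this using 1
          refine Germ.coe_eq.2 (Eventually.of_forall fun u => ?_)
          have hc : cuspParam 𝕜 m u 0 = u (⟨0, hlm⟩ : Fin m).castSucc :=
            cuspParam_castSucc u ⟨0, hlm⟩
          simp only [shiftedCoeff, basisMonomial, Fin.cons_succ, hc]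
          change u (Fin.last m) * -_ = -(_ * u (Fin.last m))
          rw [mul_neg, mul_comm]
        | succ l =>
          rw [SetLike.mem_coe]
          convert hmz using 1
          refine Germ.coe_eq.2 (Eventually.of_forall fun u => ?_)
          have hc : cuspParam 𝕜 m u ⟨l + 1, by omega⟩ = u (⟨l + 1, hlm⟩ : Fin m).castSucc :=
            cuspParam_castSucc u ⟨l + 1, hlm⟩
          simp only [shiftedCoeff, basisMonomial, Fin.cons_succ]
          rw [dif_pos (by omega), hc]
          exact mul_comm _ _
  obtain ⟨ξ', hξ', hξe⟩ := hle hspan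
  rwa [← Subtype.ext hξe]

end Relations

/-! ### Expansions of smooth germs along curves. -/

section CurveExpansions

variable {𝕜 : Type*} [RCLike 𝕜] {d : ℕ}

theorem tendsto_nhds_zero_of_isBigO_pow {γ : 𝕜 → Fin d → 𝕜} {K : ℕ} (hK : 1 ≤ K)
    (hγ : ∀ l, (fun s => γ s l) =O[𝓝[≠] 0] fun s : 𝕜 => s ^ K) :
    Tendsto γ (𝓝[≠] 0) (𝓝 0) := by
  have t2 : Tendsto (fun s : 𝕜 => s ^ K) (𝓝[≠] 0) (𝓝 0) := by
    have hc : Continuous fun s : 𝕜 => s ^ K := by fun_prop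
    simpa [show K ≠ 0 by omega] using (hc.tendsto 0).mono_left nhdsWithin_le_nhds
  exact tendsto_pi_nhds.2 fun l => (hγ l).trans_tendsto t2

theorem SmoothNear.isBigO_comp_sub {f : (Fin d → 𝕜) → 𝕜} (hf : SmoothNear 𝕜 f 0)
    {γ : 𝕜 → Fin d → 𝕜} {K : ℕ} (hK : 1 ≤ K)
    (hγ : ∀ l, (fun s => γ s l) =O[𝓝[≠] 0] fun s : 𝕜 => s ^ K) :
    (fun s => f (γ s) - f 0) =O[𝓝[≠] 0] fun s : 𝕜 => s ^ K := by
  have ht := tendsto_nhds_zero_of_isBigO_pow hK hγ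
  obtain ⟨g, hg, hfg⟩ := hf.exists_hadamard
  have h1 : (fun s => ∑ l, γ s l * g l (γ s)) =O[𝓝[≠] 0] fun s : 𝕜 => s ^ K := by
    refine Asymptotics.IsBigO.fun_sum fun l _ => ?_
    simpa using (hγ l).mul ((hg l).isBigO_one.comp_tendsto ht)
  refine h1.congr' ?_ EventuallyEq.rfl
  filter_upwards [ht.eventually hfg] with s hs
  rw [hs, add_sub_cancel_left]

/-- First order expansion of a smooth germ along curves. -/
theorem SmoothNear.exists_linear_expansion {f : (Fin d → 𝕜) → 𝕜} (hf : SmoothNear 𝕜 f 0) :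
    ∃ A : Fin d → 𝕜, ∀ (γ : 𝕜 → Fin d → 𝕜) (K : ℕ), 1 ≤ K →
      (∀ l, (fun s => γ s l) =O[𝓝[≠] 0] fun s : 𝕜 => s ^ K) →
      (fun s => f (γ s) - f 0 - ∑ l, A l * γ s l) =O[𝓝[≠] 0] fun s : 𝕜 => s ^ (2 * K) := by
  obtain ⟨g, hg, hfg⟩ := hf.exists_hadamard
  refine ⟨fun l => g l 0, fun γ K hK hγ => ?_⟩
  have ht := tendsto_nhds_zero_of_isBigO_pow hK hγ
  have h1 : (fun s => ∑ l, γ s l * (g l (γ s) - g l 0)) =O[𝓝[≠] 0] fun s : 𝕜 => s ^ (2 * K) := by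
    refine Asymptotics.IsBigO.fun_sum fun l _ => ?_
    simpa [two_mul, pow_add] using (hγ l).mul ((hg l).isBigO_comp_sub hK hγ)
  refine h1.congr' ?_ EventuallyEq.rfl
  filter_upwards [ht.eventually hfg] with s hs
  rw [hs, add_sub_cancel_left, ← Finset.sum_sub_distrib]
  exact Finset.sum_congr rfl fun l _ => by ring

theorem isBigO_const_mul_pow (a : 𝕜) {i K : ℕ} (h : K ≤ i) :
    (fun s : 𝕜 => a * s ^ i) =O[𝓝[≠] 0] fun s : 𝕜 => s ^ K := by
  obtain ⟨e, rfl⟩ := Nat.exists_eq_add_of_le h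
  have hce : Continuous fun t : 𝕜 => a * t ^ e := by fun_prop
  have h1 : (fun t : 𝕜 => a * t ^ e) =O[𝓝[≠] 0] fun _ => (1 : 𝕜) :=
    ((hce.tendsto 0).mono_left nhdsWithin_le_nhds).isBigO_one 𝕜
  refine ((Asymptotics.isBigO_refl (fun t : 𝕜 => t ^ K) (𝓝[≠] 0)).mul h1).congr_left ?_ |>.trans ?_
  · intro s
    ring
  · simpa using Asymptotics.isBigO_refl (fun t : 𝕜 => t ^ K) (𝓝[≠] 0)

theorem Asymptotics.IsBigO.of_pow_mul {f : 𝕜 → 𝕜} {N K : ℕ}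
    (h : (fun s => s ^ N * f s) =O[𝓝[≠] 0] fun s : 𝕜 => s ^ (N + K)) :
    f =O[𝓝[≠] 0] fun s : 𝕜 => s ^ K := by
  have h2 := (Asymptotics.isBigO_refl (fun s : 𝕜 => (s ^ N)⁻¹) (𝓝[≠] 0)).mul h
  have hne : ∀ᶠ s : 𝕜 in 𝓝[≠] 0, s ≠ 0 := eventually_mem_nhdsWithin
  refine h2.congr' ?_ ?_
  · filter_upwards [hne] with s hs
    rw [inv_mul_cancel_left₀ (pow_ne_zero _ hs)]
  · filter_upwards [hne] with s hs
    rw [pow_add, inv_mul_cancel_left₀ (pow_ne_zero _ hs)]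

end CurveExpansions

/-! ### Constraints on the linear part of a liftable field. -/

section LinearPart

variable {𝕜 : Type*} [RCLike 𝕜] {m : ℕ}

/-- The polynomial `A 0 l - ∑ i, A i l X ^ i` attached to the column `l` of a matrix. -/
noncomputable def columnPoly (A : Fin (m + 2) → Fin (m + 2) → 𝕜) (l : Fin (m + 2)) :
    Polynomial 𝕜 :=
  ∑ i, Polynomial.C ((if i = 0 then 1 else -1) * A i l) * Polynomial.X ^ (i : ℕ)

theorem coeff_columnPoly (A : Fin (m + 2) → Fin (m + 2) → 𝕜) (l i : Fin (m + 2)) :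
    (columnPoly A l).coeff i = (if i = 0 then 1 else -1) * A i l := by
  simp [columnPoly, Polynomial.finsetSum_coeff, Polynomial.coeff_X_pow, Fin.val_inj]

theorem eval_columnPoly (A : Fin (m + 2) → Fin (m + 2) → 𝕜) (l : Fin (m + 2)) (s : 𝕜) :
    (columnPoly A l).eval s = ∑ i : Fin (m + 2), (if i = 0 then 1 else -1) * A i l * s ^ (i : ℕ) := by
  simp [columnPoly, Polynomial.eval_finsetSum]

/-- A test curve tangent to the first axis. -/
def testCurve (w : Fin (m + 1) → 𝕜) (s : 𝕜) : Fin (m + 2) → 𝕜 :=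
  Fin.cons s fun j => s ^ (m + 3) * w j

/-- The direction of the image of `testCurve` under the `A_n` germ. -/
def testImage (w : Fin (m + 1) → 𝕜) (s : 𝕜) : Fin (m + 2) → 𝕜 :=
  Fin.cons (1 + ∑ j, w j * s ^ ((j : ℕ) + 1)) w

/-- The value of `typeADeriv` along `testCurve`, up to a power of the parameter. -/
def testDeriv (w : Fin (m + 1) → 𝕜) (s : 𝕜) : 𝕜 :=
  ((m + 3 : ℕ) : 𝕜) + ∑ j : Fin (m + 1), (((j : ℕ) + 1 : ℕ) : 𝕜) * w j * s ^ ((j : ℕ) + 1)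

theorem typeAMap_testCurve (w : Fin (m + 1) → 𝕜) (s : 𝕜) (l : Fin (m + 2)) :
    typeAMap 𝕜 (m + 2) (m + 2 + 1) (testCurve w s) l = s ^ (m + 3) * testImage w s l := by
  refine Fin.cases ?_ (fun j => ?_) l
  · rw [typeAMap_apply_zero]
    simp only [testCurve, testImage, Fin.cons_zero, Fin.cons_succ, mul_add, mul_one,
      Finset.mul_sum, mul_assoc]
  · rw [typeAMap_apply_succ]
    simp only [testCurve, testImage, Fin.cons_succ]

theorem typeADeriv_testCurve (w : Fin (m + 1) → 𝕜) (s : 𝕜) :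
    typeADeriv m (testCurve w s) = s ^ (m + 2) * testDeriv w s := by
  simp only [typeADeriv, testCurve, testDeriv, Fin.cons_zero, Fin.cons_succ, mul_add,
    Finset.mul_sum]
  congr 1
  · ring
  · exact Finset.sum_congr rfl fun j _ => by ring

theorem continuous_testDeriv (w : Fin (m + 1) → 𝕜) : Continuous (testDeriv w) := by
  unfold testDeriv
  fun_prop

theorem continuous_testImage (w : Fin (m + 1) → 𝕜) (l : Fin (m + 2)) :
    Continuous fun s => testImage w s l := by
  refine Fin.cases ?_ (fun j => ?_) l
  · simp only [testImage, Fin.cons_zero]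
    fun_prop
  · simp only [testImage, Fin.cons_succ]
    fun_prop

theorem isBigO_one_of_continuous {f : 𝕜 → 𝕜} (hf : Continuous f) :
    f =O[𝓝[≠] 0] fun _ => (1 : 𝕜) :=
  ((hf.tendsto 0).mono_left nhdsWithin_le_nhds).isBigO_one 𝕜

theorem tendsto_testCurve (w : Fin (m + 1) → 𝕜) :
    Tendsto (testCurve w) (𝓝[≠] 0) (𝓝 0) := by
  refine tendsto_nhds_zero_of_isBigO_pow le_rfl fun l => ?_
  refine Fin.cases ?_ (fun j => ?_) l
  · simpa only [testCurve, Fin.cons_zero, one_mul, pow_one] using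
      isBigO_const_mul_pow (1 : 𝕜) (le_refl 1)
  · simpa only [testCurve, Fin.cons_succ, mul_comm] using
      isBigO_const_mul_pow (w j) (show 1 ≤ m + 3 by omega)

theorem isBigO_typeAMap_testCurve (w : Fin (m + 1) → 𝕜) (l : Fin (m + 2)) :
    (fun s => typeAMap 𝕜 (m + 2) (m + 2 + 1) (testCurve w s) l)
      =O[𝓝[≠] 0] fun s : 𝕜 => s ^ (m + 3) := by
  simp only [typeAMap_testCurve]
  simpa using (Asymptotics.isBigO_refl (fun s : 𝕜 => s ^ (m + 3)) (𝓝[≠] 0)).mul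
    (isBigO_one_of_continuous (continuous_testImage w l))

/-- Linear parts of liftable vector fields over the `A_n` germ. -/
theorem IsLiftableA.exists_linear_part {e : (Fin (m + 2) → 𝕜) → Fin (m + 2) → 𝕜}
    (he : SmoothNear 𝕜 e 0) (hl : IsLiftableA m e) :
    ∃ A : Fin (m + 2) → Fin (m + 2) → 𝕜,
      (∀ i (γ : 𝕜 → Fin (m + 2) → 𝕜) (K : ℕ), 1 ≤ K →
        (∀ l, (fun s => γ s l) =O[𝓝[≠] 0] fun s : 𝕜 => s ^ K) →
        (fun s => e (γ s) i - ∑ l, A i l * γ s l) =O[𝓝[≠] 0] fun s : 𝕜 => s ^ (2 * K)) ∧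
      ∀ (j : Fin (m + 1)) (k : ℕ), k < m + 2 →
        (Polynomial.C ((m + 3 : ℕ) : 𝕜) * columnPoly A j.succ
          + Polynomial.C (((m + 3 : ℕ) : 𝕜) - (((j : ℕ) + 1 : ℕ) : 𝕜)) *
            (columnPoly A 0 * Polynomial.X ^ ((j : ℕ) + 1))).coeff k = 0 := by
  obtain ⟨χ, hχ, hlift⟩ := hl
  choose A hA using fun i => (he.apply i).exists_linear_expansion
  let σ : Fin (m + 2) → 𝕜 := fun i => if i = 0 then 1 else -1
  -- the lift equation along a test curve
  have hcurve : ∀ w : Fin (m + 1) → 𝕜,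
      (fun s => ∑ i, σ i * e 0 i * s ^ (i : ℕ) + s ^ (m + 3) *
        ∑ l, (columnPoly A l).eval s * testImage w s l
        - s ^ (m + 2) * (testDeriv w s * χ (testCurve w s)))
        =O[𝓝[≠] 0] fun s : 𝕜 => s ^ (2 * (m + 3)) := by
    intro w
    have h1 : (fun s => ∑ i, σ i * s ^ (i : ℕ) *
        (e (typeAMap 𝕜 (m + 2) (m + 2 + 1) (testCurve w s)) i - e 0 i
          - ∑ l, A i l * typeAMap 𝕜 (m + 2) (m + 2 + 1) (testCurve w s) l))
        =O[𝓝[≠] 0] fun s : 𝕜 => s ^ (2 * (m + 3)) := by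
      refine Asymptotics.IsBigO.fun_sum fun i _ => ?_
      have h2 : (fun s : 𝕜 => σ i * s ^ (i : ℕ)) =O[𝓝[≠] 0] fun _ => (1 : 𝕜) :=
        isBigO_one_of_continuous (by fun_prop)
      simpa using h2.mul (hA i _ (m + 3) (by omega) (isBigO_typeAMap_testCurve w))
    refine h1.neg_left.congr' ?_ EventuallyEq.rfl
    filter_upwards [(tendsto_testCurve w).eventually hlift] with s hs
    rw [typeADeriv_testCurve] at hs
    have h3 : e (typeAMap 𝕜 (m + 2) (m + 2 + 1) (testCurve w s)) 0
        - ∑ j : Fin (m + 1), testCurve w s 0 ^ ((j : ℕ) + 1) *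
          e (typeAMap 𝕜 (m + 2) (m + 2 + 1) (testCurve w s)) j.succ
        = ∑ i, σ i * s ^ (i : ℕ) * e (typeAMap 𝕜 (m + 2) (m + 2 + 1) (testCurve w s)) i := by
      have ht : testCurve w s 0 = s := rfl
      rw [ht, Fin.sum_univ_succ (n := m + 1)]
      simp [σ, sub_eq_add_neg]
    rw [h3] at hs
    have h4 : ∑ i, σ i * s ^ (i : ℕ) *
        ∑ l, A i l * typeAMap 𝕜 (m + 2) (m + 2 + 1) (testCurve w s) l
        = s ^ (m + 3) * ∑ l, (columnPoly A l).eval s * testImage w s l := by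
      simp only [typeAMap_testCurve, eval_columnPoly, Finset.mul_sum, Finset.sum_mul]
      rw [Finset.sum_comm]
      refine Finset.sum_congr rfl fun l _ => Finset.sum_congr rfl fun i _ => ?_
      ring
    have h5 : ∑ i, σ i * s ^ (i : ℕ) * e 0 i = ∑ i, σ i * e 0 i * s ^ (i : ℕ) :=
      Finset.sum_congr rfl fun i _ => by ring
    simp only [mul_sub, Finset.sum_sub_distrib]
    rw [h4, h5, hs]
    ring
  have hPO : ∀ w : Fin (m + 1) → 𝕜, (fun s => ∑ l, (columnPoly A l).eval s * testImage w s l)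
      =O[𝓝[≠] 0] fun _ => (1 : 𝕜) := fun w => isBigO_one_of_continuous
    (continuous_finsetSum _ fun l _ => (columnPoly A l).continuous.mul (continuous_testImage w l))
  have hDO : ∀ w : Fin (m + 1) → 𝕜, testDeriv w =O[𝓝[≠] 0] fun _ => (1 : 𝕜) := fun w =>
    isBigO_one_of_continuous (continuous_testDeriv w)
  have hχO : ∀ w : Fin (m + 1) → 𝕜, (fun s => χ (testCurve w s)) =O[𝓝[≠] 0] fun _ => (1 : 𝕜) :=
    fun w => hχ.isBigO_one.comp_tendsto (tendsto_testCurve w)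
  have hpow : ∀ {i K : ℕ}, K ≤ i → (fun s : 𝕜 => s ^ i) =O[𝓝[≠] 0] fun s : 𝕜 => s ^ K :=
    fun h => by simpa only [one_mul] using isBigO_const_mul_pow (1 : 𝕜) h
  -- All other terms of the lift equation are O(s^(m+2)), while the constant parts form a polynomial
  -- of degree at most m + 1 in s.
  have he0 : ∀ i, e 0 i = 0 := by
    have h1 : (fun s => ∑ i, σ i * e 0 i * s ^ (i : ℕ)) =O[𝓝[≠] 0] fun s : 𝕜 => s ^ (m + 2) := by
      have h2 := (hcurve 0).trans (hpow (show m + 2 ≤ 2 * (m + 3) by omega))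
      have h3 : (fun s => s ^ (m + 3) * ∑ l, (columnPoly A l).eval s * testImage 0 s l)
          =O[𝓝[≠] 0] fun s : 𝕜 => s ^ (m + 2) := by
        simpa using (hpow (show m + 2 ≤ m + 3 by omega)).mul (hPO 0)
      have h4 : (fun s => s ^ (m + 2) * (testDeriv (0 : Fin (m + 1) → 𝕜) s * χ (testCurve 0 s)))
          =O[𝓝[≠] 0] fun s : 𝕜 => s ^ (m + 2) := by
        simpa using (hpow le_rfl).mul ((hDO 0).mul (hχO 0))
      refine ((h2.sub h3).add h4).congr_left fun s => ?_
      ring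
    intro i
    have h2 := congrFun (coeff_eq_zero_of_isBigO _ h1) i
    simp only [Pi.zero_apply, σ] at h2
    split_ifs at h2 <;> simpa using h2
  refine ⟨A, fun i γ K hK hγ => ?_, fun j k hk => ?_⟩
  · simpa only [he0, sub_zero] using hA i γ K hK hγ
  · refine Polynomial.coeff_eq_zero_of_isBigO (K := m + 2) ?_ hk
    let w : Fin (m + 1) → 𝕜 := Pi.single j 1
    have hcw := hcurve w
    have hc0 := hcurve 0
    simp only [he0, mul_zero, zero_mul, Finset.sum_const_zero, zero_add] at hcw hc0
    have hd0 : ∀ s : 𝕜, testDeriv (0 : Fin (m + 1) → 𝕜) s = ((m + 3 : ℕ) : 𝕜) := fun s => by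
      simp [testDeriv]
    have hdw : ∀ s : 𝕜, testDeriv w s
        = ((m + 3 : ℕ) : 𝕜) + (((j : ℕ) + 1 : ℕ) : 𝕜) * s ^ ((j : ℕ) + 1) := fun s => by
      simp [testDeriv, w, Pi.single_apply]
    have hP0 : ∀ s : 𝕜, ∑ l, (columnPoly A l).eval s * testImage (0 : Fin (m + 1) → 𝕜) s l
        = (columnPoly A 0).eval s := fun s => by
      rw [Fin.sum_univ_succ]
      simp [testImage]
    have hPw : ∀ s : 𝕜, ∑ l, (columnPoly A l).eval s * testImage w s l
        = (columnPoly A 0).eval s * (1 + s ^ ((j : ℕ) + 1)) + (columnPoly A j.succ).eval s :=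
      fun s => by
      rw [Fin.sum_univ_succ]
      simp [testImage, w, Pi.single_apply]
    -- The two curves differ by O(s^(m+3)), and χ is Lipschitz near 0.
    have hdiff : (fun s => χ (testCurve w s) - χ (testCurve 0 s))
        =O[𝓝[≠] 0] fun s : 𝕜 => s ^ (m + 3) := by
      have h1 := (hχ.contDiffAt.hasStrictFDerivAt (by simp)).isBigO_sub.comp_tendsto
        ((tendsto_testCurve w).prodMk_nhds (tendsto_testCurve 0))
      refine h1.trans (Asymptotics.isBigO_pi.2 fun l => ?_)
      refine Fin.cases ?_ (fun i => ?_) l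
      · simpa [testCurve] using Asymptotics.isBigO_zero _ _
      · simpa [testCurve, mul_comm] using isBigO_const_mul_pow (w i) (le_refl (m + 3))
    refine Asymptotics.IsBigO.of_pow_mul (N := m + 3) ?_
    -- The equation for w times m + 3, minus the equation for 0 times `testDeriv w`, eliminates χ up
    -- to `hdiff`. After division by s^(m+3) the stated polynomial is O(s^(m+2)).
    have h1 : (fun s => testDeriv w s * (s ^ (m + 3) *
        ∑ l, (columnPoly A l).eval s * testImage (0 : Fin (m + 1) → 𝕜) s l
        - s ^ (m + 2) * (testDeriv (0 : Fin (m + 1) → 𝕜) s * χ (testCurve 0 s))))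
        =O[𝓝[≠] 0] fun s : 𝕜 => s ^ (m + 3 + (m + 2)) := by
      simpa using (hDO w).mul (hc0.trans (hpow (show m + 3 + (m + 2) ≤ 2 * (m + 3) by omega)))
    have h2 := (hcw.trans (hpow (show m + 3 + (m + 2) ≤ 2 * (m + 3) by omega))).const_mul_left
      ((m + 3 : ℕ) : 𝕜)
    have h3 : (fun s => s ^ (m + 2) * ((((m + 3 : ℕ) : 𝕜) * testDeriv w s) *
        (χ (testCurve w s) - χ (testCurve 0 s)))) =O[𝓝[≠] 0] fun s : 𝕜 => s ^ (m + 3 + (m + 2)) := by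
      have := (hpow (le_refl (m + 2))).mul ((((hDO w).const_mul_left ((m + 3 : ℕ) : 𝕜)).mul hdiff))
      refine this.congr_right fun s => ?_
      ring
    refine ((h2.sub h1).add h3).congr_left fun s => ?_
    simp only [hd0, hP0, hPw, hdw, Polynomial.eval_add, Polynomial.eval_mul, Polynomial.eval_C,
      Polynomial.eval_pow, Polynomial.eval_X]
    ring

end LinearPart

/-! ### Linear independence modulo T_Σ, the bases, and the codimension. -/

section Independence

variable {𝕜 : Type*} [RCLike 𝕜] {m : ℕ}

/-- The relations between the last two rows of the linear part of a liftable vector field when the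
penultimate coordinates of the last row vanish. -/
theorem row_eq_zero_of_columnPoly (hm : 1 ≤ m) {A : Fin (m + 2) → Fin (m + 2) → 𝕜}
    (hA : ∀ (j : Fin (m + 1)) (k : ℕ), k < m + 2 →
        (Polynomial.C ((m + 3 : ℕ) : 𝕜) * columnPoly A j.succ
          + Polynomial.C (((m + 3 : ℕ) : 𝕜) - (((j : ℕ) + 1 : ℕ) : 𝕜)) *
            (columnPoly A 0 * Polynomial.X ^ ((j : ℕ) + 1))).coeff k = 0)
    (hZ : ∀ l : Fin (m + 1), A (idxZ m) l.castSucc = 0) (l : Fin m) :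
    A (idxY m) l.castSucc.castSucc = 0 := by
  have hY0 : idxY m ≠ 0 := by
    simp only [ne_eq, Fin.ext_iff, Fin.val_castSucc, Fin.val_last, Fin.val_zero]
    omega
  have hN : ((m + 3 : ℕ) : 𝕜) ≠ 0 := Nat.cast_ne_zero.2 (by omega)
  have hNj : ∀ j : Fin (m + 1), ((m + 3 : ℕ) : 𝕜) - (((j : ℕ) + 1 : ℕ) : 𝕜) ≠ 0 := fun j => by
    rw [sub_ne_zero, Ne, Nat.cast_inj]
    omega
  -- the first column vanishes below the diagonal
  have hp : ∀ k, 1 ≤ k → k < m + 2 → (columnPoly A 0).coeff k = 0 := by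
    intro k hk1 hk
    rcases Nat.lt_or_ge k (m + 1) with h | h
    · have h1 := hA ⟨m - k, by omega⟩ (m + 1) (by omega)
      have h2 : (columnPoly A (⟨m - k, by omega⟩ : Fin (m + 1)).succ).coeff (m + 1) = 0 := by
        have := coeff_columnPoly A (⟨m - k, by omega⟩ : Fin (m + 1)).succ (idxZ m)
        rw [Fin.val_last] at this
        rw [this]
        have h3 : (⟨m - k, by omega⟩ : Fin (m + 1)).succ
            = (⟨m - k + 1, by omega⟩ : Fin (m + 1)).castSucc := rfl
        rw [h3, hZ, mul_zero]
      rw [Polynomial.coeff_add, Polynomial.coeff_C_mul, Polynomial.coeff_C_mul, h2, mul_zero,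
        zero_add, Polynomial.coeff_mul_X_pow', if_pos (by simp)] at h1
      have h4 := (mul_eq_zero.1 h1).resolve_left (hNj _)
      rwa [show m + 1 - (m - k + 1) = k by omega] at h4
    · obtain rfl : k = m + 1 := by omega
      have := coeff_columnPoly A 0 (idxZ m)
      rw [Fin.val_last] at this
      rw [this]
      have h3 : (0 : Fin (m + 2)) = (0 : Fin (m + 1)).castSucc := rfl
      rw [h3, hZ, mul_zero]
  have hY : ∀ l, A (idxY m) l = -(columnPoly A l).coeff m := fun l => by
    have := coeff_columnPoly A l (idxY m)
    rw [Fin.val_castSucc, Fin.val_last, if_neg hY0] at this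
    rw [this]
    ring
  rw [hY, neg_eq_zero]
  obtain ⟨l, hl⟩ := l
  cases l with
  | zero => exact hp m hm (by omega)
  | succ l =>
    have h1 := hA ⟨l, by omega⟩ m (by omega)
    rw [Polynomial.coeff_add, Polynomial.coeff_C_mul, Polynomial.coeff_C_mul,
      Polynomial.coeff_mul_X_pow', if_pos (by simp; omega), hp _ (by simp; omega) (by simp; omega),
      mul_zero, add_zero] at h1
    exact (mul_eq_zero.1 h1).resolve_left hN

/-- The curve is chosen so that the image coordinates x and Y have order s² and Z has order s³.
Quadratic errors are then O(s⁴), and degrees 0 to 3 see only the linear part. -/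
theorem sum_cuspParam_curve (a : Fin (m + 2) → 𝕜) (ξ : Fin m → 𝕜) (s : 𝕜) :
    ∑ l, a l * cuspParam 𝕜 m (Fin.snoc (fun i => s ^ 2 * ξ i) s) l
      = (∑ i, a i.castSucc.castSucc * ξ i - 3 * a (idxY m)) * s ^ 2 - 2 * a (idxZ m) * s ^ 3 := by
  rw [Fin.sum_univ_castSucc, Fin.sum_univ_castSucc]
  simp only [cuspParam_castSucc, cuspParam_idxY, cuspParam_idxZ, Fin.snoc_castSucc, Fin.snoc_last,
    sub_mul, Finset.sum_mul]
  have h : ∀ i : Fin m, a i.castSucc.castSucc * (s ^ 2 * ξ i) = a i.castSucc.castSucc * ξ i * s ^ 2 :=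
    fun i => by ring
  simp only [h]
  ring

/-- The germs `1, z, x₁ z, …, x_m z` are linearly independent modulo `T_Σ`. -/
theorem eq_zero_of_sum_basisMonomial (hm : 1 ≤ m) {e : (Fin (m + 2) → 𝕜) → Fin (m + 2) → 𝕜}
    (he : SmoothNear 𝕜 e 0) (hl : IsLiftableA m e) {c : Fin (m + 2) → 𝕜}
    (h : ∀ᶠ u : Fin (m + 1) → 𝕜 in 𝓝 0, -u (Fin.last m) * e (cuspParam 𝕜 m u) (idxY m)
      + e (cuspParam 𝕜 m u) (idxZ m)
        = ∑ a, c a * basisMonomial (fun i => u i.castSucc) (u (Fin.last m)) a) :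
    c = 0 := by
  obtain ⟨A, hA, hcol⟩ := IsLiftableA.exists_linear_part he hl
  -- These are the coefficients of 1, s, s², s³ in the difference of the two sides of `h` along the
  -- curve.
  have key : ∀ ξ : Fin m → 𝕜, ![c 0, c 1,
      -(∑ i, A (idxZ m) i.castSucc.castSucc * ξ i - 3 * A (idxZ m) (idxY m)),
      (∑ i, A (idxY m) i.castSucc.castSucc * ξ i - 3 * A (idxY m) (idxY m))
        + 2 * A (idxZ m) (idxZ m) + ∑ i : Fin m, c i.succ.succ * ξ i] = 0 := by
    intro ξ
    refine coeff_eq_zero_of_isBigO _ ?_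
    let v : 𝕜 → Fin (m + 1) → 𝕜 := fun s => Fin.snoc (fun i => s ^ 2 * ξ i) s
    let γ : 𝕜 → Fin (m + 2) → 𝕜 := fun s => cuspParam 𝕜 m (v s)
    have hγ : ∀ l, (fun s => γ s l) =O[𝓝[≠] 0] fun s : 𝕜 => s ^ 2 := fun l => by
      induction l using Fin.lastCases with
      | last =>
        simpa only [γ, v, cuspParam_idxZ, Fin.snoc_last] using
          isBigO_const_mul_pow (-2 : 𝕜) (show 2 ≤ 3 by omega)
      | cast l =>
        induction l using Fin.lastCases with
        | last =>
          simpa only [γ, v, cuspParam_idxY, Fin.snoc_last] using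
            isBigO_const_mul_pow (-3 : 𝕜) (le_refl 2)
        | cast i =>
          simpa only [γ, v, cuspParam_castSucc, Fin.snoc_castSucc, mul_comm] using
            isBigO_const_mul_pow (ξ i) (le_refl 2)
    have hv : Tendsto v (𝓝[≠] 0) (𝓝 0) := by
      refine tendsto_nhds_zero_of_isBigO_pow le_rfl fun l => ?_
      induction l using Fin.lastCases with
      | last => simpa only [v, Fin.snoc_last, one_mul, pow_one] using
          isBigO_const_mul_pow (1 : 𝕜) (le_refl 1)
      | cast i => simpa only [v, Fin.snoc_castSucc, mul_comm] using
          isBigO_const_mul_pow (ξ i) (show 1 ≤ 2 by omega)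
    have hZ := hA (idxZ m) γ 2 (by omega) hγ
    have hY := hA (idxY m) γ 2 (by omega) hγ
    have hYs : (fun s => -s * (e (γ s) (idxY m) - ∑ l, A (idxY m) l * γ s l))
        =O[𝓝[≠] 0] fun s : 𝕜 => s ^ 4 := by
      have := (isBigO_one_of_continuous (continuous_neg (G := 𝕜))).mul hY
      simpa using this
    -- The explicit quartic term is -s times the Z-entry of the Y row applied to -2s³.
    refine ((hYs.add hZ).add (isBigO_const_mul_pow (2 * A (idxY m) (idxZ m)) (le_refl 4))).congr'
      ?_ EventuallyEq.rfl
    filter_upwards [hv.eventually h] with s hs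
    have h1 : v s (Fin.last m) = s := by simp [v]
    have h2 : ∀ i : Fin m, v s i.castSucc = s ^ 2 * ξ i := fun i => by simp [v]
    simp only [h1, h2] at hs
    have h3 : ∑ a, c a * basisMonomial (fun i : Fin m => s ^ 2 * ξ i) s a
        = c 0 + c 1 * s + (∑ i : Fin m, c i.succ.succ * ξ i) * s ^ 3 := by
      rw [Fin.sum_univ_succ, Fin.sum_univ_succ]
      simp only [basisMonomial, Fin.cons_zero, Fin.cons_succ, Finset.sum_mul, Fin.succ_zero_eq_one,
        mul_one, add_assoc]
      congr 2
      exact Finset.sum_congr rfl fun i _ => by ring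
    rw [h3] at hs
    simp only [γ, v, sum_cuspParam_curve, Fin.sum_univ_four, Matrix.cons_val] at hs ⊢
    simp only [Fin.val_zero, Fin.val_one, Fin.val_two, pow_zero, pow_one]
    rw [show (((3 : Fin 4) : ℕ)) = 3 from rfl]
    linear_combination hs
  have h00 := key 0
  have hZ0 := congrFun h00 2
  have hY0 := congrFun h00 3
  simp only [Matrix.cons_val, Pi.zero_apply, mul_zero, Finset.sum_const_zero, zero_sub, add_zero]
    at hZ0 hY0
  have hZY : A (idxZ m) (idxY m) = 0 := by
    simpa using hZ0
  have hZl : ∀ l : Fin (m + 1), A (idxZ m) l.castSucc = 0 := fun l => by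
    induction l using Fin.lastCases with
    | last => exact hZY
    | cast i =>
      have h1 := congrFun (key (Pi.single i 1)) 2
      simpa [Pi.single_apply, hZY] using h1
  -- With the x-entries of the Y row gone, the cubic coefficient at a unit vector minus the one at ξ
  -- = 0 is the coefficient of a single x_i z.
  have hYl := row_eq_zero_of_columnPoly hm hcol hZl
  funext a
  refine Fin.cases ?_ (fun b => Fin.cases ?_ (fun i => ?_) b) a
  · exact congrFun h00 0
  · exact congrFun h00 1
  · have h1 := congrFun (key (Pi.single i 1)) 3
    simp only [Matrix.cons_val, Pi.zero_apply, Pi.single_apply, mul_ite, mul_one, mul_zero,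
      Finset.sum_ite_eq', Finset.mem_univ, if_true, hYl] at h1
    rw [Pi.zero_apply]
    linear_combination h1 - hY0

/-- The basis of `𝒪_{n-1} / T_Σ` given by `1, z, x₁ z, …, x_m z`. -/
theorem exists_basis_quotient_TSigma (𝕜 : Type*) [RCLike 𝕜] (hm : 1 ≤ m) :
    ∃ b : Module.Basis (Fin (m + 2)) 𝕜 (SmoothGerms 𝕜 (m + 1) 𝕜 ⧸ TSigma (germF 𝕜 m)),
      ∀ a, b a = (TSigma (germF 𝕜 m)).mkQ (monomialGerm 𝕜 m a) := by
  have hli : LinearIndependent 𝕜 fun a => (TSigma (germF 𝕜 m)).mkQ (monomialGerm 𝕜 m a) := by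
    rw [Fintype.linearIndependent_iff]
    intro c hc
    simp only [← map_smul, ← map_sum] at hc
    rw [Submodule.mkQ_apply, Submodule.Quotient.mk_eq_zero] at hc
    obtain ⟨η, hη, hηc⟩ := hc
    obtain ⟨e, he, hee⟩ := η.2
    have h1 := congrArg Subtype.val hηc
    rw [coe_cuspRestrict hee] at h1
    have h2 : ((∑ a, c a • monomialGerm 𝕜 m a : SmoothGerms 𝕜 (m + 1) 𝕜) :
        Germ (𝓝 (0 : Fin (m + 1) → 𝕜)) 𝕜)
        = ((fun u => ∑ a, c a * basisMonomial (fun i => u i.castSucc) (u (Fin.last m)) a :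
          (Fin (m + 1) → 𝕜) → 𝕜) : Germ (𝓝 (0 : Fin (m + 1) → 𝕜)) 𝕜) := by
      have h3 : ∀ s : Finset (Fin (m + 2)),
          ((∑ a ∈ s, c a • monomialGerm 𝕜 m a : SmoothGerms 𝕜 (m + 1) 𝕜) :
            Germ (𝓝 (0 : Fin (m + 1) → 𝕜)) 𝕜)
          = ((fun u => ∑ a ∈ s, c a * basisMonomial (fun i => u i.castSucc) (u (Fin.last m)) a :
            (Fin (m + 1) → 𝕜) → 𝕜) : Germ (𝓝 (0 : Fin (m + 1) → 𝕜)) 𝕜) := fun s => by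
        induction s using Finset.induction_on with
        | empty => rfl
        | insert a s ha ih =>
          simp only [Finset.sum_insert ha]
          rw [Submodule.coe_add, ih]
          rfl
      exact h3 _
    rw [h2, Germ.coe_eq] at h1
    exact congrFun (eq_zero_of_sum_basisMonomial hm he ((mem_Lift_germF he hee).1 hη) h1)
  refine ⟨Module.Basis.mk hli ?_, fun a => Module.Basis.mk_apply hli _ a⟩
  have h1 := congrArg (Submodule.map (TSigma (germF 𝕜 m)).mkQ) (TSigma_sup_span_monomialGerm (𝕜 := 𝕜) hm)
  rw [Submodule.map_sup, Submodule.map_top, Submodule.range_mkQ, Submodule.mkQ_map_self, bot_sup_eq,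
    Submodule.map_span, ← Set.range_comp] at h1
  exact h1.ge

end Independence

theorem mainTheorem4 {𝕜 : Type*} [RCLike 𝕜] (m : ℕ) (hm : 1 ≤ m) :
    -- `n = m + 2 ≥ 3`
    (germf 𝕜 m).IsStableUnfolding₂ (germF 𝕜 m) ∧
    (cuspidalConcat (germF 𝕜 m)).codimAe = ((m + 2 : ℕ) : Cardinal) ∧
    (∃ b : Module.Basis (Fin (m + 2)) 𝕜 (SmoothGerms 𝕜 (m + 1) 𝕜 ⧸ TSigma (germF 𝕜 m)),
      ∀ a, b a = (TSigma (germF 𝕜 m)).mkQ (monomialGerm 𝕜 m a)) ∧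
    (∃ b : Module.Basis (Fin (m + 2)) 𝕜 (cuspidalConcat (germF 𝕜 m)).NAe,
      ∀ a, b a = (cuspidalConcat (germF 𝕜 m)).tangentAe.mkQ (monomialField 𝕜 m a)) := by
  obtain ⟨b, hb⟩ := exists_basis_quotient_TSigma 𝕜 hm
  obtain ⟨E, hE⟩ := exists_quotient_TSigma_equiv (isStable_germF (𝕜 := 𝕜) (m := m))
  have hbE : ∀ a, b.map E a
      = (cuspidalConcat (germF 𝕜 m)).tangentAe.mkQ (monomialField 𝕜 m a) := fun a => by
    rw [Module.Basis.map_apply, hb, hE, lastField_monomialGerm]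
  refine ⟨isStableUnfolding_germF hm, ?_, ⟨b, hb⟩, ⟨b.map E, hbE⟩⟩
  rw [MultiGerm.codimAe, rank_eq_card_basis (b.map E), Fintype.card_fin]
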